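/- Fix a prime $p\ge 3$. For a finite non-empty subset $S$ of a group $\Gamma$ let $\mu_S$ be the uniform probability measure on $S$, and let $\mu_S^{(l)}$ be its $l$-th convolution power (so $\mu_S^{(0)}$ is the point mass at $1$). For $M>0$, an integer $n>1$ is called $M$-admissible if it has no prime factor less than $M$; a polynomial $f\in\mathbb F_p[t]$ is $M$-admissible if the degree of every irreducible factor of $f$ is an $M$-admissible integer. Let $\pi_f: SL_2(\mathbb F_p[t])\to SL_2(\mathbb F_p[t]/(f))$ be the congruence map. The girth of $(G,S)$, for $S$ a symmetric subset of a group $G$, is the length of the shortest non-trivial reduced word in $S$ that equals $1$ in $G$. The following two statements hold. (1) For all $\tilde D, m\in\mathbb N$ there exist $C,M,\gamma>0$ (depending only on $\tilde D$, $m$ and $p$) such that the following holds. Let $T\subseteq SL_2(\mathbb F_p[t])$ be the symmetric closure $X\cup X^{-1}$ of a finite set $X$ freely generating a non-abelian free subgroup, with $|T|=m$ and with every entry of every element of $T$ of degree at most $\tilde D$. Let $f\in\mathbb F_p[t]$ be an $M$-admissible square-free polynomial with no two (non-associated) irreducible factors having the same degree. Then for every proper subgroup $H$ of $G=SL_2(\mathbb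 F_p[t]/(f))$ there exists an integer $0\le l\le C\log|G|$ such that $$\mu_T^{(2l)}(H) := \mu_T^{(2l)}\bigl(\pi_f^{-1}(H)\bigr)\le [G:H]^{-\gamma}.$$ (2) For every $C_1>0$ and every integer $k\ge 2$ there exist $C_2,C_3,\gamma>0$ (depending only on $C_1$, $k$ and $p$) such that, for all sufficiently large $C_2$-admissible integers $n$ (how large depending only on $C_1$, $k$, $p$), the following holds. If $S\subseteq SL_2(\mathbb F_{p^n})$ is symmetric with $|S|=2k$ and the girth of $(SL_2(\mathbb F_{p^n}),S)$ is at least $C_1 n$, then for every proper subgroup $H$ of $SL_2(\mathbb F_{p^n})$ there exists an integer $0\le l\le C_3\log|SL_2(\mathbb F_{p^n})|$ such that $$\mu_S^{(2l)}(H)\le |SL_2(\mathbb F_{p^n})|^{-\gamma}.$$ -/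

import Mathlib

open Polynomial
open scoped Pointwise ENNReal MatrixGroups

namespace SL2Walk

noncomputable section

/-- An integer `n > 1` is `M`-admissible if it has no prime factor less than `M`. -/
def AdmissibleNat (M : ℝ) (n : ℕ) : Prop :=
  1 < n ∧ ∀ q : ℕ, q.Prime → q ∣ n → M ≤ (q : ℝ)

/-- A polynomial is `M`-admissible if the degree of each of its irreducible factors is an
`M`-admissible integer. -/
def AdmissiblePoly {K : Type*} [Field K] (M : ℝ) (f : K[X]) : Prop :=
  ∀ q : K[X], Irreducible q → q ∣ f → AdmissibleNat M q.natDegree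

/-- No two (non-associated) irreducible factors of `f` have the same degree. -/
def DistinctFactorDegrees {K : Type*} [Field K] (f : K[X]) : Prop :=
  ∀ q r : K[X], Irreducible q → Irreducible r → q ∣ f → r ∣ f →
    q.natDegree = r.natDegree → Associated q r

section Walk

variable {G : Type*} [Group G]

/-- The density of the uniform probability measure on a finite nonempty set `S`. -/
def mu (S : Set G) : G → ℝ :=
  S.indicator fun _ => (S.ncard : ℝ)⁻¹

/-- Convolution `(φ * ψ)(g) = ∑ₕ φ(h) ψ(h⁻¹ g)` of (finitely supported) functions on `G`. -/
def conv (φ ψ : G → ℝ) : G → ℝ :=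
  fun g => ∑ᶠ h : G, φ h * ψ (h⁻¹ * g)

/-- Convolution powers: `φ⁽⁰⁾` is the indicator function of the identity, and
`φ⁽ˡ⁺¹⁾ = φ⁽ˡ⁾ * φ`. -/
def convPow (φ : G → ℝ) : ℕ → G → ℝ
  | 0 => Set.indicator {1} fun _ => 1
  | l + 1 => conv (convPow φ l) φ

/-- The mass that a (finitely supported) function gives to a set. -/
def mass (φ : G → ℝ) (A : Set G) : ℝ :=
  ∑ᶠ g ∈ A, φ g

/-- `T` is the symmetric closure of a finite set which freely generates a non-abelian free
subgroup of `G`. -/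
def IsSymmetricFreeBasis (T : Set G) : Prop :=
  ∃ X : Set G, X.Finite ∧ T = X ∪ X⁻¹ ∧
    Function.Injective (FreeGroup.lift ((↑) : X → G)) ∧
    ∃ a ∈ Subgroup.closure X, ∃ b ∈ Subgroup.closure X, a * b ≠ b * a

/-- `w` is a reduced word in the letters `S`: no letter is followed by its inverse. -/
def IsReducedWord (S : Set G) (w : List G) : Prop :=
  (∀ s ∈ w, s ∈ S) ∧ w.IsChain fun a b => b ≠ a⁻¹

/-- The length of the shortest non-trivial reduced word in `S` which equals `1` in `G`
(and `⊤` if there is no such word). -/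
def girth (S : Set G) : ℕ∞ :=
  ⨅ w : {w : List G // IsReducedWord S w ∧ w ≠ [] ∧ w.prod = 1}, (w.1.length : ℕ∞)

end Walk

/-- The group `SL₂(K[t]/(f))`. -/
abbrev SL2Quot {K : Type*} [Field K] (f : K[X]) : Type _ :=
  SL(2, K[X] ⧸ Ideal.span {f})

/-- The congruence map `SL₂(K[t]) → SL₂(K[t]/(f))`. -/
def congruenceMap {K : Type*} [Field K] (f : K[X]) : SL(2, K[X]) →* SL2Quot f :=
  Matrix.SpecialLinearGroup.map (Ideal.Quotient.mk (Ideal.span {f}))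

end

end SL2Walk

/-! Both statements follow from one comparison in a free group: points have exponentially small mass
under the walk, while the relevant subsets of a ball have only quadratic size.

The steps of the walk are the images of the letters of a free group on at least two generators, so
the mass of a subgroup is the mass of its preimage under the free walk. At most one letter shortens
a given word, hence `(1/2)^|w|` contracts by `7/8` on average and after `l` steps no point has mass
above `(7/8)^l`. Centralizers in free groups are cyclic, so a set of words of length at most `n`
with trivial double commutators has `O(n^2)` elements (`card_le_of_metabelian`).

The link with proper subgroups is a weak form of Dickson's theorem (`exists_metabelian_subgroup`): a
proper subgroup of `SL₂(p^n)`, with `n` free of prime factors below `M`, has a metabelian subgroup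
of index at most `120 p^(3n/M)`. Over a finite extension splitting all traces, fixed points on the
projective line are counted, as for finite rotation groups. Either a point stabiliser has index at
most two, or the order is at most `120`, or a parabolic fixed point has a large group of dilations.
In the last case the squared dilation factors preserve the group of translations, hence lie in a
proper subring of the field; proper subrings are small because `n` is admissible.

Double commutators of short words in the pulled back metabelian subgroup are trivial in the finite
quotient. Large girth, or a degree bound together with freeness, makes them trivial in the free
group. Modulo a square-free `f` only the factors on which `H` does not project onto `SL₂` are used:
distinct degrees make the other projections independent (Goursat), so the index of `H` is bounded in
terms of the total degree of the bad factors, which also sets the length of the walk. -/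

namespace SL2Walk

/-! ### Convolution powers as iterates of an averaging operator -/

section StepAverage

variable {G ι : Type*} [Group G] [Fintype ι]

/-- The averaging operator of the right random walk on `G` with steps `a i`. -/
noncomputable def stepAvg (a : ι → G) (u : G → ℝ) : G → ℝ :=
  fun g => (Fintype.card ι : ℝ)⁻¹ * ∑ i, u (g * a i)

theorem conv_mu_apply {a : ι → G} (ha : Function.Injective a) (φ : G → ℝ) (g : G) :
    conv φ (mu (Set.range a)) g = (Fintype.card ι : ℝ)⁻¹ * ∑ i, φ (g * (a i)⁻¹) := by
  classical
  have hcard : (Set.range a).ncard = Fintype.card ι := by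
    rw [← Set.image_univ, Set.ncard_image_of_injective _ ha, Set.ncard_univ,
      Nat.card_eq_fintype_card]
  have hinj : Function.Injective fun i => g * (a i)⁻¹ := fun i j h => by
    simpa [ha.eq_iff] using h
  unfold conv
  rw [finsum_eq_sum_of_support_subset (s := Finset.univ.image fun i => g * (a i)⁻¹),
    Finset.sum_image hinj.injOn, Finset.mul_sum]
  · refine Finset.sum_congr rfl fun i _ => ?_
    simp [mu, hcard, mul_comm]
  · intro h hh
    rw [Function.mem_support] at hh
    have h2 : h⁻¹ * g ∈ Set.range a := by
      by_contra hn
      exact hh (by simp [mu, hn])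
    obtain ⟨i, hi⟩ := h2
    simp only [Finset.coe_image, Finset.coe_univ, Set.image_univ, Set.mem_range]
    exact ⟨i, by rw [hi]; group⟩

theorem finite_support_convPow {a : ι → G} (ha : Function.Injective a) (l : ℕ) :
    (Function.support (convPow (mu (Set.range a)) l)).Finite := by
  induction l with
  | zero => exact (Set.finite_singleton (1 : G)).subset (by simp [convPow])
  | succ l ih =>
    refine (Set.finite_iUnion fun i => ih.image (· * a i)).subset fun g hg => ?_
    rw [Function.mem_support, convPow, conv_mu_apply ha] at hg
    obtain ⟨i, -, hi⟩ := Finset.exists_ne_zero_of_sum_ne_zero (right_ne_zero_of_mul hg)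
    exact Set.mem_iUnion.2 ⟨i, _, hi, by simp⟩

/-- Convolution on the right by the uniform measure is adjoint to `stepAvg`: the substitution `g ↦ g
* a i` moves each step from the measure to the test function. -/
theorem finsum_convPow_mul {a : ι → G} (ha : Function.Injective a) (l : ℕ) (u : G → ℝ) :
    ∑ᶠ g, convPow (mu (Set.range a)) l g * u g = (stepAvg a)^[l] u 1 := by
  induction l generalizing u with
  | zero =>
    rw [finsum_eq_single _ 1 fun g hg => by simp [convPow, hg]]
    simp [convPow]
  | succ l ih =>
    rw [Function.iterate_succ_apply, ← ih]
    set φ := convPow (mu (Set.range a)) l with hφ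
    have hfin := finite_support_convPow ha l
    rw [← hφ] at hfin
    have h1 : ∀ i, ∑ᶠ g, φ (g * (a i)⁻¹) * u g = ∑ᶠ g, φ g * u (g * a i) := fun i => by
      rw [← finsum_comp_equiv (Equiv.mulRight (a i))]
      simp
    have hsupp : ∀ i, (Function.support fun g => φ (g * (a i)⁻¹) * u g).Finite := fun i => by
      refine (hfin.image (· * a i)).subset fun g hg => ?_
      exact ⟨g * (a i)⁻¹, left_ne_zero_of_mul hg, by simp⟩
    have hsupp' : ∀ i, (Function.support fun g => φ g * u (g * a i)).Finite := fun i =>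
      hfin.subset fun g hg => left_ne_zero_of_mul hg
    calc ∑ᶠ g, convPow (mu (Set.range a)) (l + 1) g * u g
        = ∑ᶠ g, (Fintype.card ι : ℝ)⁻¹ * ∑ i, φ (g * (a i)⁻¹) * u g := by
          refine finsum_congr fun g => ?_
          rw [convPow, conv_mu_apply ha, mul_assoc, Finset.sum_mul]
      _ = (Fintype.card ι : ℝ)⁻¹ * ∑ i, ∑ᶠ g, φ (g * (a i)⁻¹) * u g := by
          rw [← finsum_sum_comm _ _ fun i _ => hsupp i, mul_finsum]
      _ = (Fintype.card ι : ℝ)⁻¹ * ∑ i, ∑ᶠ g, φ g * u (g * a i) := by simp only [h1]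
      _ = ∑ᶠ g, φ g * stepAvg a u g := by
          rw [← finsum_sum_comm _ _ fun i _ => hsupp' i, mul_finsum]
          refine finsum_congr fun g => ?_
          rw [stepAvg, ← Finset.mul_sum]
          ring

theorem mass_convPow_mu {a : ι → G} (ha : Function.Injective a) (l : ℕ) (A : Set G) :
    mass (convPow (mu (Set.range a)) l) A = (stepAvg a)^[l] (A.indicator 1) 1 := by
  rw [← finsum_convPow_mul ha, mass, finsum_mem_def]
  refine finsum_congr fun g => ?_
  by_cases hg : g ∈ A <;> simp [hg]

/-- This transfers the walk on a group to the free group that parametrises its steps. -/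
theorem stepAvg_comp_hom {F : Type*} [Group F] (φ : F →* G) (e : ι → F) (l : ℕ) (u : G → ℝ)
    (w : F) : (stepAvg e)^[l] (u ∘ φ) w = (stepAvg (φ ∘ e))^[l] u (φ w) := by
  induction l generalizing u with
  | zero => rfl
  | succ l ih =>
    rw [Function.iterate_succ_apply, Function.iterate_succ_apply, ← ih]
    refine congrArg (fun v => (stepAvg e)^[l] v w) ?_
    ext w
    simp [stepAvg]

theorem iterate_stepAvg_sum {κ : Type*} (a : ι → G) (l : ℕ) (s : Finset κ) (u : κ → G → ℝ) :
    (stepAvg a)^[l] (fun g => ∑ k ∈ s, u k g) = fun g => ∑ k ∈ s, (stepAvg a)^[l] (u k) g := by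
  induction l generalizing u with
  | zero => rfl
  | succ l ih =>
    simp only [Function.iterate_succ_apply]
    rw [← ih]
    congr 1
    ext g
    simp only [stepAvg]
    rw [Finset.sum_comm, Finset.mul_sum]

theorem iterate_stepAvg_mono (a : ι → G) (l : ℕ) {u v : G → ℝ} (h : u ≤ v) :
    (stepAvg a)^[l] u ≤ (stepAvg a)^[l] v := by
  induction l generalizing u v with
  | zero => exact h
  | succ l ih =>
    rw [Function.iterate_succ_apply, Function.iterate_succ_apply]
    refine ih fun g => ?_
    exact mul_le_mul_of_nonneg_left (Finset.sum_le_sum fun i _ => h _) (by positivity)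

theorem iterate_stepAvg_le_of_stepAvg_le (a : ι → G) {u : G → ℝ} {c : ℝ} (hc : 0 ≤ c)
    (h : ∀ g, stepAvg a u g ≤ c * u g) (l : ℕ) (g : G) :
    (stepAvg a)^[l] u g ≤ c ^ l * u g := by
  induction l generalizing g with
  | zero => simp
  | succ l ih =>
    rw [Function.iterate_succ_apply']
    calc stepAvg a ((stepAvg a)^[l] u) g
        ≤ stepAvg a (fun g => c ^ l * u g) g :=
          mul_le_mul_of_nonneg_left (Finset.sum_le_sum fun i _ => ih _) (by positivity)
      _ = c ^ l * stepAvg a u g := by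
          simp only [stepAvg, ← Finset.mul_sum]
          ring
      _ ≤ c ^ l * (c * u g) := by gcongr; exact h g
      _ = c ^ (l + 1) * u g := by ring

/-- After `l` steps the walk only sees the values of `u` within distance `l`. -/
theorem iterate_stepAvg_congr (a : ι → G) (len : G → ℕ) (hlen : ∀ g i, len (g * a i) ≤ len g + 1)
    (l : ℕ) {u v : G → ℝ} {g : G} (h : ∀ x, len x ≤ len g + l → u x = v x) :
    (stepAvg a)^[l] u g = (stepAvg a)^[l] v g := by
  induction l generalizing g with
  | zero => exact h g le_rfl
  | succ l ih =>
    rw [Function.iterate_succ_apply', Function.iterate_succ_apply', stepAvg, stepAvg]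
    congr 1
    refine Finset.sum_congr rfl fun i _ => ih fun x hx => h x ?_
    have := hlen g i
    omega

end StepAverage

/-! ### Point masses of the free walk, and growth of metabelian sets of words -/

section FreeGroup

open scoped commutatorElement

variable {X : Type*} [DecidableEq X]

/-- A letter, as an element of the free group. -/
def letter (a : X × Bool) : FreeGroup X := FreeGroup.mk [a]

omit [DecidableEq X] in
theorem letter_inv (a : X × Bool) : (letter a)⁻¹ = letter (a.1, !a.2) := by
  simp [letter, FreeGroup.inv_mk, FreeGroup.invRev]

theorem norm_letter_mul_le (a : X × Bool) (u : FreeGroup X) :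
    (letter a * u).norm ≤ u.norm + 1 := by
  refine (FreeGroup.norm_mul_le _ _).trans ?_
  rw [add_comm]
  exact Nat.add_le_add_left (FreeGroup.norm_mk_le (L₁ := [a])) _

theorem norm_mul_letter_le (u : FreeGroup X) (a : X × Bool) :
    (u * letter a).norm ≤ u.norm + 1 :=
  (FreeGroup.norm_mul_le _ _).trans
    (Nat.add_le_add_left (FreeGroup.norm_mk_le (L₁ := [a])) _)

theorem norm_le_norm_letter_mul (a : X × Bool) (u : FreeGroup X) :
    u.norm ≤ (letter a * u).norm + 1 := by
  have h := norm_letter_mul_le (a.1, !a.2) (letter a * u)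
  rwa [← letter_inv, inv_mul_cancel_left] at h

theorem toWord_letter_mul {a : X × Bool} {u : FreeGroup X}
    (h : ∀ b ∈ u.toWord.head?, b ≠ (a.1, !a.2)) :
    (letter a * u).toWord = a :: u.toWord := by
  have hred : FreeGroup.IsReduced (a :: u.toWord) := by
    have hu : FreeGroup.IsReduced u.toWord := FreeGroup.isReduced_toWord
    rw [FreeGroup.IsReduced, List.isChain_cons]
    refine ⟨fun b hb hab => ?_, hu⟩
    have := h b hb
    rcases a with ⟨x, s⟩
    rcases b with ⟨y, t⟩
    simp only at hab
    subst hab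
    simpa [eq_comm] using this
  rw [letter, FreeGroup.toWord_mul, FreeGroup.toWord_mk, FreeGroup.reduce_singleton,
    List.singleton_append, hred.reduce_eq]

theorem norm_letter_mul {a : X × Bool} {u : FreeGroup X}
    (h : ∀ b ∈ u.toWord.head?, b ≠ (a.1, !a.2)) : (letter a * u).norm = u.norm + 1 := by
  simp [FreeGroup.norm, toWord_letter_mul h]

theorem norm_mul_letter {a : X × Bool} {u : FreeGroup X}
    (h : ∀ b ∈ u.toWord.getLast?, b ≠ (a.1, !a.2)) : (u * letter a).norm = u.norm + 1 := by
  have hkey : ∀ b ∈ u⁻¹.toWord.head?, b ≠ ((a.1, !a.2).1, !(a.1, !a.2).2) := by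
    intro b hb
    rw [FreeGroup.toWord_inv, FreeGroup.invRev, List.head?_reverse, List.getLast?_map] at hb
    obtain ⟨c, hc, rfl⟩ := Option.map_eq_some_iff.1 hb
    have := h c hc
    rcases a with ⟨x, s⟩
    rcases c with ⟨y, t⟩
    simpa using this
  have := norm_letter_mul hkey
  rwa [← letter_inv, ← mul_inv_rev, FreeGroup.norm_inv_eq, FreeGroup.norm_inv_eq] at this

/-- At most one of the `2m` letters cancels against the head of `u`; it contributes at most `2 *
(1/2)^|u|`, and every other letter half of `(1/2)^|u|`. The total factor `m + 3/2` is at most `7/8 *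
2m` exactly when `m ≥ 2`. -/
theorem sum_half_pow_norm_le [Fintype X] (hX : 2 ≤ Fintype.card X) (u : FreeGroup X) :
    ∑ a : X × Bool, (1 / 2 : ℝ) ^ (letter a * u).norm
      ≤ Fintype.card (X × Bool) * (7 / 8 * (1 / 2) ^ u.norm) := by
  have hX' : (2 : ℝ) ≤ Fintype.card X := by exact_mod_cast hX
  obtain ⟨b, hb⟩ : ∃ b : X × Bool, ∀ a ≠ b, (letter a * u).norm = u.norm + 1 := by
    rcases h : u.toWord.head? with _ | c
    · have : Nonempty X := Fintype.card_pos_iff.1 (by omega)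
      -- Nothing cancels against the empty word, so any letter may play the exceptional role.
      exact ⟨(Classical.arbitrary X, true), fun a _ => norm_letter_mul (by simp [h])⟩
    · refine ⟨(c.1, !c.2), fun a ha => norm_letter_mul ?_⟩
      intro d hd hda
      rw [h, Option.mem_some_iff] at hd
      subst hd
      apply ha
      rw [hda]
      simp
  rw [← Finset.add_sum_erase _ _ (Finset.mem_univ b),
    Finset.sum_congr rfl fun a ha => by rw [hb a (Finset.ne_of_mem_erase ha)],
    Finset.sum_const, Finset.card_erase_of_mem (Finset.mem_univ b), Finset.card_univ,
    nsmul_eq_mul, Nat.cast_sub (by simp; omega)]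
  have h1 : (1 / 2 : ℝ) ^ (letter b * u).norm ≤ 2 * (1 / 2) ^ u.norm := by
    have := pow_le_pow_of_le_one (by norm_num : (0 : ℝ) ≤ 1 / 2) (by norm_num)
      (norm_le_norm_letter_mul b u)
    rw [pow_succ] at this
    linarith
  have h0 : (0 : ℝ) < (1 / 2) ^ u.norm := by positivity
  rw [pow_succ]
  simp only [Fintype.card_prod, Fintype.card_bool, Nat.cast_mul, Nat.cast_ofNat, Nat.cast_one]
  nlinarith

/-- The indicator of `g` lies below `w ↦ (1/2)^|w⁻¹ g|`, which one step of the walk contracts by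
`7/8`. -/
theorem iterate_stepAvg_letter_singleton_le [Fintype X] (hX : 2 ≤ Fintype.card X) (l : ℕ)
    (g w : FreeGroup X) :
    (stepAvg letter)^[l] (({g} : Set (FreeGroup X)).indicator 1) w ≤ (7 / 8 : ℝ) ^ l := by
  have hstep : ∀ w : FreeGroup X, stepAvg letter (fun w => (1 / 2 : ℝ) ^ (w⁻¹ * g).norm) w
      ≤ 7 / 8 * (1 / 2) ^ (w⁻¹ * g).norm := by
    intro w
    have hcard : (0 : ℝ) < Fintype.card (X × Bool) := by
      rw [Fintype.card_prod, Fintype.card_bool]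
      exact_mod_cast (by omega : 0 < Fintype.card X * 2)
    rw [stepAvg, inv_mul_le_iff₀ hcard]
    refine le_trans (le_of_eq ?_) (sum_half_pow_norm_le hX (w⁻¹ * g))
    -- Since `(w a)⁻¹ g = a⁻¹ (w⁻¹ g)`, reindexing by inversion of letters turns right steps into
    -- left multiplications.
    refine Fintype.sum_equiv ((Equiv.refl X).prodCongr Equiv.boolNot) _ _ fun a => ?_
    rw [mul_inv_rev, letter_inv, mul_assoc]
    rfl
  calc _ ≤ (stepAvg letter)^[l] (fun w => (1 / 2 : ℝ) ^ (w⁻¹ * g).norm) w := by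
        refine iterate_stepAvg_mono _ _ (fun x => ?_) w
        by_cases hx : x = g
        · simp [hx]
        · simp only [Set.mem_singleton_iff, hx, not_false_eq_true, Set.indicator_of_notMem]
          positivity
    _ ≤ (7 / 8) ^ l * (1 / 2) ^ (w⁻¹ * g).norm :=
        iterate_stepAvg_le_of_stepAvg_le _ (by norm_num) hstep l w
    _ ≤ (7 / 8) ^ l := mul_le_of_le_one_right (by positivity)
        (pow_le_one₀ (by norm_num) (by norm_num))

/-- The walk of length `l` gives mass at most `#(A ∩ Ball l) (7/8)^l` to a set `A`. -/
theorem iterate_stepAvg_letter_le [Fintype X] (hX : 2 ≤ Fintype.card X) (l : ℕ)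
    (A : Set (FreeGroup X)) (s : Finset (FreeGroup X)) (hs : ∀ w ∈ A, w.norm ≤ l → w ∈ s) :
    (stepAvg letter)^[l] (A.indicator 1) 1 ≤ s.card * (7 / 8 : ℝ) ^ l := by
  classical
  have h1 : (stepAvg letter)^[l] (A.indicator 1) (1 : FreeGroup X) =
      (stepAvg letter)^[l] ((A ∩ {w | w.norm ≤ l}).indicator 1) 1 := by
    refine iterate_stepAvg_congr _ FreeGroup.norm norm_mul_letter_le l fun x hx => ?_
    rw [FreeGroup.norm_one, zero_add] at hx
    by_cases hA : x ∈ A <;> simp [hA, hx]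
  rw [h1]
  calc _ ≤ (stepAvg letter)^[l]
        (fun w => ∑ g ∈ s, ({g} : Set (FreeGroup X)).indicator 1 w) 1 := by
        refine iterate_stepAvg_mono _ _ (fun w => ?_) 1
        by_cases hw : w ∈ A ∩ {w | w.norm ≤ l}
        · rw [Set.indicator_of_mem hw]
          refine le_trans ?_ (Finset.single_le_sum (f := fun g =>
            ({g} : Set (FreeGroup X)).indicator (1 : FreeGroup X → ℝ) w) (fun g _ => ?_) (hs w hw.1 hw.2))
          · simp
          · exact Set.indicator_nonneg (by simp) _
        · rw [Set.indicator_of_notMem hw]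
          exact Finset.sum_nonneg fun g _ => Set.indicator_nonneg (by simp) _
    _ = ∑ g ∈ s, (stepAvg letter)^[l] (({g} : Set (FreeGroup X)).indicator 1) 1 := by
        rw [iterate_stepAvg_sum]
    _ ≤ ∑ g ∈ s, (7 / 8 : ℝ) ^ l :=
        Finset.sum_le_sum fun g _ => iterate_stepAvg_letter_singleton_le hX l g 1
    _ = _ := by simp

-- If `z` is not trivial, some letter `a` cancels on neither side of `z`, so `a z a⁻¹` is longer
-- than `z` by two and cannot equal it.
omit [DecidableEq X] in
theorem eq_one_of_forall_commute [Nontrivial X] {z : FreeGroup X} (hz : ∀ w, Commute w z) :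
    z = 1 := by
  classical
  by_contra hne
  have hw : z.toWord ≠ [] := by simpa [FreeGroup.toWord_eq_nil_iff] using hne
  set h := z.toWord.head hw with hh
  set t := z.toWord.getLast hw with ht
  -- A generator other than that of the first letter avoids cancellation on the left; its sign is
  -- then chosen to avoid cancellation on the right.
  obtain ⟨a, ha1, ha2⟩ : ∃ a : X × Bool, h ≠ (a.1, !a.2) ∧ t ≠ a := by
    obtain ⟨y, hy⟩ := exists_ne h.1
    by_cases hty : t = (y, true)
    · refine ⟨(y, false), fun hc => hy ?_, by simp [hty]⟩
      rw [hc]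
    · refine ⟨(y, true), fun hc => hy ?_, hty⟩
      rw [hc]
  have h1 : (z * letter (a.1, !a.2)).norm = z.norm + 1 := by
    refine norm_mul_letter fun b hb => ?_
    rw [List.getLast?_eq_some_getLast hw, Option.mem_some_iff] at hb
    simpa [← hb] using ha2
  have h2 : (letter a * (z * letter (a.1, !a.2))).norm = z.norm + 1 + 1 := by
    rw [← h1]
    refine norm_letter_mul fun b hb => ?_
    have hword : (z * letter (a.1, !a.2)).toWord = z.toWord ++ [(a.1, !a.2)] := by
      have hsub := FreeGroup.toWord_mul_sublist z (letter (a.1, !a.2))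
      have hl : (letter (a.1, !a.2)).toWord = [(a.1, !a.2)] := by
        simp [letter, FreeGroup.toWord_mk]
      rw [hl] at hsub
      refine hsub.eq_of_length ?_
      simpa [FreeGroup.norm] using h1
    rw [hword, List.head?_append_of_ne_nil _ hw, List.head?_eq_some_head hw,
      Option.mem_some_iff] at hb
    rw [← hb]
    exact ha1
  rw [← letter_inv, ← mul_assoc, (hz (letter a)).eq, mul_inv_cancel_right] at h2
  omega

-- The centralizer of `z` is free by Nielsen–Schreier and has `z` as a non-trivial central element,
-- so it has rank at most one.
omit [DecidableEq X] in
theorem exists_centralizer_le_zpowers {z : FreeGroup X} (hz : z ≠ 1) :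
    ∃ r : FreeGroup X, r ≠ 1 ∧ ∀ w, Commute w z → w ∈ Subgroup.zpowers r := by
  let C := Subgroup.centralizer ({z} : Set (FreeGroup X))
  have hzC : z ∈ C := Subgroup.mem_centralizer_singleton_iff.2 rfl
  let e := IsFreeGroup.toFreeGroup C
  have hcomm : ∀ w, Commute w (e ⟨z, hzC⟩) := by
    intro w
    obtain ⟨c, rfl⟩ := e.surjective w
    refine Commute.map (Subtype.ext ?_) e
    exact (Subgroup.mem_centralizer_singleton_iff.1 c.2)
  have hne : e ⟨z, hzC⟩ ≠ 1 := by
    simpa [Subtype.ext_iff] using hz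
  rcases subsingleton_or_nontrivial (IsFreeGroup.Generators C) with hs | hn
  · have hcyc : IsCyclic (FreeGroup (IsFreeGroup.Generators C)) := by
      rcases isEmpty_or_nonempty (IsFreeGroup.Generators C) with h | ⟨⟨x⟩⟩
      · infer_instance
      · have : Unique (IsFreeGroup.Generators C) := ⟨⟨x⟩, fun y => Subsingleton.elim _ _⟩
        infer_instance
    obtain ⟨r, hr⟩ := hcyc.exists_generator
    refine ⟨e.symm r, ?_, fun w hw => ?_⟩
    · rintro h1
      have : r = 1 := by simpa using h1
      subst this
      exact hne (by simpa using hr (e ⟨z, hzC⟩))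
    · have hwC : w ∈ C := Subgroup.mem_centralizer_singleton_iff.2 hw.eq
      obtain ⟨n, hn⟩ := Subgroup.mem_zpowers_iff.1 (hr (e ⟨w, hwC⟩))
      refine Subgroup.mem_zpowers_iff.2 ⟨n, ?_⟩
      have : e.symm r ^ n = ⟨w, hwC⟩ := by
        rw [← map_zpow, hn, MulEquiv.symm_apply_apply]
      simpa using congrArg Subtype.val this
  · exact absurd (eq_one_of_forall_commute hcomm) hne

/-- The cyclically reduced core of `r` is non-empty and occurs `n` times in the reduced word of `r ^
n`. -/
theorem le_norm_pow {r : FreeGroup X} (hr : r ≠ 1) (n : ℕ) : n ≤ (r ^ n).norm := by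
  rcases n with _ | n
  · simp
  have hne : FreeGroup.reduceCyclically r.toWord ≠ [] := by
    intro h
    have h2 := FreeGroup.reduceCyclically.conj_conjugator_reduceCyclically r.toWord
    rw [h, List.append_nil] at h2
    apply hr
    rw [← FreeGroup.mk_toWord (x := r), ← h2, ← FreeGroup.mul_mk, ← FreeGroup.inv_mk,
      mul_inv_cancel]
  have hpos := List.length_pos_iff.2 hne
  rw [FreeGroup.norm, FreeGroup.toWord_pow,
    FreeGroup.reduceCyclically.reduce_flatten_replicate_succ FreeGroup.isReduced_toWord]
  simp only [List.length_append, List.length_flatten, List.map_replicate, List.sum_replicate,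
    smul_eq_mul]
  nlinarith

theorem natAbs_le_norm_zpow {r : FreeGroup X} (hr : r ≠ 1) (n : ℤ) :
    n.natAbs ≤ (r ^ n).norm := by
  obtain ⟨m, rfl | rfl⟩ := n.eq_nat_or_neg
  · simpa using le_norm_pow hr m
  · simpa [FreeGroup.norm_inv_eq] using le_norm_pow hr m

/-- Centralizers in free groups have linear growth. -/
theorem exists_finset_centralizer {z : FreeGroup X} (hz : z ≠ 1) (n : ℕ) :
    ∃ s : Finset (FreeGroup X), s.card ≤ 2 * n + 1 ∧ ∀ w, Commute w z → w.norm ≤ n → w ∈ s := by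
  obtain ⟨r, hr, hC⟩ := exists_centralizer_le_zpowers hz
  refine ⟨(Finset.Icc (-n : ℤ) n).image (r ^ ·), Finset.card_image_le.trans ?_, fun w hw hn => ?_⟩
  · rw [Int.card_Icc]
    omega
  · obtain ⟨m, rfl⟩ := Subgroup.mem_zpowers_iff.1 (hC w hw)
    have := natAbs_le_norm_zpow hr m
    refine Finset.mem_image_of_mem _ (Finset.mem_Icc.2 ⟨?_, ?_⟩) <;> omega

theorem norm_commutatorElement_le (a b : FreeGroup X) :
    ⁅a, b⁆.norm ≤ 2 * a.norm + 2 * b.norm := by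
  rw [commutatorElement_def]
  have h1 := FreeGroup.norm_mul_le (a * b * a⁻¹) b⁻¹
  have h2 := FreeGroup.norm_mul_le (a * b) a⁻¹
  have h3 := FreeGroup.norm_mul_le a b
  rw [FreeGroup.norm_inv_eq] at h1 h2
  omega

/-- A set of elements of length at most `n` of a free group whose double commutators are trivial
has at most quadratic size. -/
theorem card_le_of_metabelian (s : Finset (FreeGroup X)) (n : ℕ) (hn : ∀ w ∈ s, w.norm ≤ n)
    (h : ∀ a ∈ s, ∀ b ∈ s, ∀ c ∈ s, ∀ d ∈ s, ⁅⁅a, b⁆, ⁅c, d⁆⁆ = 1) :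
    s.card ≤ (8 * n + 1) * (4 * n + 1) := by
  by_cases hcomm : ∀ a ∈ s, ∀ b ∈ s, ⁅a, b⁆ = 1
  · by_cases h1 : ∃ a ∈ s, a ≠ 1
    · obtain ⟨a, ha, hne⟩ := h1
      obtain ⟨t, ht, hst⟩ := exists_finset_centralizer hne n
      have hsub : s ⊆ t := fun w hw =>
        hst w (commutatorElement_eq_one_iff_commute.1 (hcomm w hw a ha)) (hn w hw)
      refine (Finset.card_le_card hsub).trans (ht.trans ?_)
      nlinarith
    · push Not at h1
      have : s ⊆ {1} := fun w hw => Finset.mem_singleton.2 (h1 w hw)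
      refine (Finset.card_le_card this).trans ?_
      rw [Finset.card_singleton]
      exact Nat.mul_pos (by omega) (by omega)
  · push Not at hcomm
    obtain ⟨a, ha, b, hb, hz⟩ := hcomm
    obtain ⟨t, ht, hst⟩ := exists_finset_centralizer hz (4 * n)
    have hane : a ≠ 1 := by
      rintro rfl
      exact hz (commutatorElement_one_left b)
    obtain ⟨t', ht', hst'⟩ := exists_finset_centralizer hane (2 * n)
    -- The law makes `⁅a, d⁆` commute with `z = ⁅a, b⁆`, so `d ↦ ⁅a, d⁆` maps `s` into words of
    -- length at most `4n` in one cyclic group.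
    have hmaps : ∀ d ∈ s, ⁅a, d⁆ ∈ t := by
      intro d hd
      refine hst _ (commutatorElement_eq_one_iff_commute.1 (h a ha d hd a ha b hb)) ?_
      have := norm_commutatorElement_le a d
      have := hn a ha
      have := hn d hd
      omega
    -- Two elements with the same commutator with `a` differ by an element of the centralizer of
    -- `a`, of length at most `2n`.
    have hfib : ∀ y ∈ t, (s.filter fun d => ⁅a, d⁆ = y).card ≤ 4 * n + 1 := by
      intro y _
      rcases (s.filter fun d => ⁅a, d⁆ = y).eq_empty_or_nonempty with he | ⟨d₀, hd₀⟩
      · simp [he]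
      · obtain ⟨hd₀s, hd₀y⟩ := Finset.mem_filter.1 hd₀
        refine le_trans (Finset.card_le_card_of_injOn (fun d => d₀⁻¹ * d) (fun d hd => ?_)
          ((mul_right_injective d₀⁻¹).injOn)) (ht'.trans (by omega))
        obtain ⟨hds, hdy⟩ := Finset.mem_filter.1 hd
        refine hst' _ ?_ ?_
        · have heq : ⁅a, d⁆ = ⁅a, d₀⁆ := hdy.trans hd₀y.symm
          rw [commutatorElement_def, commutatorElement_def] at heq
          have h1 : d * a⁻¹ * d⁻¹ = d₀ * a⁻¹ * d₀⁻¹ := by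
            simpa [mul_assoc] using heq
          have h2 : (d₀⁻¹ * d) * a⁻¹ = a⁻¹ * (d₀⁻¹ * d) := by
            calc (d₀⁻¹ * d) * a⁻¹ = d₀⁻¹ * (d * a⁻¹ * d⁻¹) * d := by group
              _ = a⁻¹ * (d₀⁻¹ * d) := by rw [h1]; group
          exact Commute.inv_right_iff.1 h2
        · have := FreeGroup.norm_mul_le d₀⁻¹ d
          rw [FreeGroup.norm_inv_eq] at this
          have := hn d hds
          have := hn d₀ hd₀s
          simp only
          omega
    calc s.card = ∑ y ∈ t, (s.filter fun d => ⁅a, d⁆ = y).card :=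
          Finset.card_eq_sum_card_fiberwise hmaps
      _ ≤ ∑ _y ∈ t, (4 * n + 1) := Finset.sum_le_sum hfib
      _ = t.card * (4 * n + 1) := by simp
      _ ≤ (8 * n + 1) * (4 * n + 1) := Nat.mul_le_mul_right _ (by omega)

theorem finite_setOf_norm_le [Finite X] (n : ℕ) : {w : FreeGroup X | w.norm ≤ n}.Finite :=
  Set.Finite.of_finite_image ((List.finite_length_le (X × Bool) n).subset
    (by rintro _ ⟨w, hw, rfl⟩; exact hw)) FreeGroup.toWord_injective.injOn

/-- If short elements of `B` satisfy the metabelian law and `B` has finite index in `H`, then `H`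
has few elements of length at most `n`. -/
theorem card_le_relIndex_mul [Finite X] {B H : Subgroup (FreeGroup X)} (hBH : B.relIndex H ≠ 0)
    (n : ℕ) (s : Finset (FreeGroup X)) (hs : ∀ w ∈ s, w ∈ H ∧ w.norm ≤ n)
    (h : ∀ a ∈ B, ∀ b ∈ B, ∀ c ∈ B, ∀ d ∈ B, a.norm ≤ 2 * n → b.norm ≤ 2 * n → c.norm ≤ 2 * n →
      d.norm ≤ 2 * n → ⁅⁅a, b⁆, ⁅c, d⁆⁆ = 1) :
    s.card ≤ B.relIndex H * ((16 * n + 1) * (8 * n + 1)) := by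
  classical
  -- The value outside `H` is immaterial, as `s` lies in `H`. Quotients of two elements of a fibre
  -- lie in `B` and have length at most `2n`.
  let f : FreeGroup X → H ⧸ B.subgroupOf H := fun w =>
    if hw : w ∈ H then QuotientGroup.mk ⟨w, hw⟩ else QuotientGroup.mk 1
  have : (B.subgroupOf H).FiniteIndex := ⟨hBH⟩
  have := Fintype.ofFinite (H ⧸ B.subgroupOf H)
  have hfib : ∀ y ∈ (Finset.univ : Finset (H ⧸ B.subgroupOf H)),
      (s.filter fun w => f w = y).card ≤ (16 * n + 1) * (8 * n + 1) := by
    intro y _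
    rcases (s.filter fun w => f w = y).eq_empty_or_nonempty with he | ⟨w₀, hw₀⟩
    · simp [he]
    obtain ⟨hw₀s, hw₀y⟩ := Finset.mem_filter.1 hw₀
    obtain ⟨hw₀H, hw₀n⟩ := hs w₀ hw₀s
    rw [← Finset.card_image_of_injective _ (mul_right_injective w₀⁻¹)]
    have himg : ∀ v ∈ (s.filter fun w => f w = y).image (w₀⁻¹ * ·), v ∈ B ∧ v.norm ≤ 2 * n := by
      intro v hv
      obtain ⟨w, hw, rfl⟩ := Finset.mem_image.1 hv
      obtain ⟨hws, hwy⟩ := Finset.mem_filter.1 hw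
      obtain ⟨hwH, hwn⟩ := hs w hws
      constructor
      · have heq : f w₀ = f w := hw₀y.trans hwy.symm
        simp only [f, hw₀H, hwH, dif_pos] at heq
        rw [QuotientGroup.eq, Subgroup.mem_subgroupOf] at heq
        exact heq
      · have := FreeGroup.norm_mul_le w₀⁻¹ w
        rw [FreeGroup.norm_inv_eq] at this
        omega
    refine (card_le_of_metabelian _ (2 * n) (fun v hv => (himg v hv).2) fun a ha b hb c hc d hd =>
      ?_).trans (le_of_eq (by ring))
    exact h a (himg a ha).1 b (himg b hb).1 c (himg c hc).1 d (himg d hd).1 (himg a ha).2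
      (himg b hb).2 (himg c hc).2 (himg d hd).2
  calc s.card = ∑ y, (s.filter fun w => f w = y).card :=
        Finset.card_eq_sum_card_fiberwise fun _ _ => by simp
    _ ≤ ∑ _y : H ⧸ B.subgroupOf H, (16 * n + 1) * (8 * n + 1) := Finset.sum_le_sum hfib
    _ = _ := by
      rw [Finset.sum_const, Finset.card_univ, smul_eq_mul, ← Nat.card_eq_fintype_card,
        Subgroup.relIndex, Subgroup.index]

theorem iterate_stepAvg_letter_subgroup_le [Fintype X] (hX : 2 ≤ Fintype.card X)
    {B H : Subgroup (FreeGroup X)} (hBH : B.relIndex H ≠ 0) (n : ℕ)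
    (h : ∀ a ∈ B, ∀ b ∈ B, ∀ c ∈ B, ∀ d ∈ B, a.norm ≤ 2 * n → b.norm ≤ 2 * n → c.norm ≤ 2 * n →
      d.norm ≤ 2 * n → ⁅⁅a, b⁆, ⁅c, d⁆⁆ = 1) :
    (stepAvg letter)^[n] ((H : Set (FreeGroup X)).indicator 1) 1
      ≤ B.relIndex H * ((16 * n + 1) * (8 * n + 1)) * (7 / 8 : ℝ) ^ n := by
  have hfin : ((H : Set (FreeGroup X)) ∩ {w | w.norm ≤ n}).Finite :=
    (finite_setOf_norm_le n).subset Set.inter_subset_right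
  refine (iterate_stepAvg_letter_le hX n _ hfin.toFinset fun w hw hn => by simp_all).trans ?_
  gcongr
  exact_mod_cast card_le_relIndex_mul hBH n _ (fun w hw => by simpa using hw) h

end FreeGroup

/-! ### Arithmetic of the orbit equation -/

section OrbitArithmetic

/-- These are the spherical triangle groups. The dihedral triples `(2, 2, c)` have `N = 2c` and are
excluded by `hc`; what remains is `(2, 3, c)` with `c ≤ 5`, where `2 / N = 1 / c - 1 / 6 ≥ 1 / 30`.
-/
theorem le_sixty_of_sum_inv {a b c N : ℕ} (ha : 2 ≤ a) (hab : a ≤ b) (hbc : b ≤ c)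
    (hN : 0 < N) (hc : 2 * c < N) (h : (1 / a + 1 / b + 1 / c : ℚ) = 1 + 2 / N) : N ≤ 60 := by
  have hN' : (0 : ℚ) < N := by exact_mod_cast hN
  have hNpos : (0 : ℚ) < 2 / N := by positivity
  have inv_le : ∀ {m k : ℕ}, 0 < m → m ≤ k → (1 / k : ℚ) ≤ 1 / m := fun hm hmk =>
    one_div_le_one_div_of_le (by exact_mod_cast hm) (by exact_mod_cast hmk)
  have h1 := inv_le (by omega) hab
  have h2 := inv_le (by omega) hbc
  have ha2 : a = 2 := by
    by_contra hne
    have h3 := inv_le (m := 3) (by omega) (by omega : 3 ≤ a)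
    rw [Nat.cast_ofNat] at h3
    linarith
  subst ha2
  have hb3 : b ≤ 3 := by
    by_contra hne
    have h3 := inv_le (m := 4) (by omega) (by omega : 4 ≤ b)
    norm_num at h3 h h2
    linarith
  interval_cases b
  · exfalso
    have hcpos : (0 : ℚ) < c := by exact_mod_cast (by omega : 0 < c)
    have h4 : (1 / c : ℚ) = 2 / N := by
      norm_num at h ⊢
      linarith
    have h5 : (N : ℚ) = 2 * c := by field_simp at h4; linarith
    have h6 : N = 2 * c := by exact_mod_cast h5
    omega
  · have hc5 : c ≤ 5 := by
      by_contra hne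
      have h3 := inv_le (m := 6) (by omega) (by omega : 6 ≤ c)
      norm_num at h3 h
      linarith
    have h3 := inv_le (by omega) hc5
    have h4 := inv_le (by omega) hbc
    by_contra hlt
    have h6 : (2 / N : ℚ) < 1 / 30 := by
      have : (60 : ℚ) < N := by exact_mod_cast (not_le.1 hlt)
      rw [div_lt_div_iff₀ hN' (by norm_num)]
      linarith
    interval_cases c <;> norm_num at h <;> linarith

/-- The arithmetic of the orbit equation of a finite group of order `N` acting on a projective
line, with point stabilisers of order `n i` and unipotent parts of order `Q i`. -/
theorem orbit_equation_cases {ι : Type*} [Fintype ι] (n Q : ι → ℕ) (N : ℕ) (hN : 0 < N)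
    (hn : ∀ i, 0 < n i) (hQn : ∀ i, Q i ∣ n i)
    (hQ : ∀ i, Q i = 1 ∨ 3 ≤ Q i)
    (hsum : ∑ i, ((n i : ℚ) + Q i - 2) / n i = 2 - 2 / N) :
    (∃ i, N ≤ 2 * n i) ∨ N ≤ 60 ∨ ∃ i K, 3 ≤ Q i ∧ n i = Q i * K ∧ N < 6 * Q i * K ^ 2 := by
  classical
  by_contra! hcon
  obtain ⟨hA, hB, hC⟩ := hcon
  set t : ι → ℚ := fun i => ((n i : ℚ) + Q i - 2) / n i with ht
  have hN' : (60 : ℚ) < N := by exact_mod_cast hB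
  have hNpos : (0 : ℚ) < 2 / N := by positivity
  have hN30 : (2 / N : ℚ) < 1 / 30 := by
    rw [div_lt_div_iff₀ (by linarith) (by norm_num)]
    linarith
  have hn' : ∀ i, (0 : ℚ) < n i := fun i => by exact_mod_cast hn i
  -- Each orbit has a trivial stabiliser (term `0`), a stabiliser without unipotents (term in `[1/2,
  -- 1)`), or a unipotent part (term above `1`).
  have hcases : ∀ i, (t i = 0) ∨ (2 ≤ n i ∧ Q i = 1 ∧ t i = 1 - 1 / n i ∧ 1 / 2 ≤ t i) ∨
      (3 ≤ Q i ∧ 1 < t i) := by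
    intro i
    have := hn' i
    rcases hQ i with h1 | h3
    · rcases Nat.lt_or_ge (n i) 2 with h | h
      · have : n i = 1 := by have := hn i; omega
        left
        simp [ht, this, h1]
        norm_num
      · right; left
        have e1 : t i = 1 - 1 / n i := by
          simp only [ht, h1]
          field_simp
          push_cast
          ring
        have h2 : (1 / n i : ℚ) ≤ 1 / 2 :=
          one_div_le_one_div_of_le (by norm_num) (by exact_mod_cast h)
        exact ⟨h, h1, e1, by rw [e1]; linarith⟩
    · right; right
      refine ⟨h3, ?_⟩
      simp only [ht]
      rw [lt_div_iff₀ this]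
      have : (3 : ℚ) ≤ Q i := by exact_mod_cast h3
      linarith
  set s := Finset.univ.filter fun i => t i ≠ 0 with hs
  have hs_sum : ∑ i ∈ s, t i = 2 - 2 / N := by
    rw [hs, Finset.sum_filter_ne_zero]
    exact hsum
  have hs_half : ∀ i ∈ s, 1 / 2 ≤ t i := by
    intro i hi
    rcases hcases i with h | h | h
    · exact absurd h (Finset.mem_filter.1 hi).2
    · exact h.2.2.2
    · linarith [h.2]
  by_cases hpar : ∃ i, 3 ≤ Q i
  · obtain ⟨i₀, hi₀⟩ := hpar
    have hq3 : (3 : ℚ) ≤ Q i₀ := by exact_mod_cast hi₀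
    have ht₀ : 1 < t i₀ := by
      rcases hcases i₀ with h | h | h
      · exfalso
        have := hn' i₀
        simp only [ht] at h
        rw [div_eq_zero_iff] at h
        rcases h with h | h <;> linarith
      · omega
      · exact h.2
    have hmem : i₀ ∈ s := Finset.mem_filter.2 ⟨Finset.mem_univ _, by linarith⟩
    rw [← Finset.add_sum_erase _ _ hmem] at hs_sum
    have hcard : ((s.erase i₀).card : ℚ) * (1 / 2) ≤ ∑ i ∈ s.erase i₀, t i := by
      rw [← nsmul_eq_mul]
      exact Finset.card_nsmul_le_sum _ _ _ fun i hi => hs_half i (Finset.mem_of_mem_erase hi)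
    -- The total is below `2` and the parabolic term already exceeds `1`, so at most one term `≥
    -- 1/2` is left.
    have hle : (s.erase i₀).card ≤ 1 := by
      by_contra hlt
      have : (2 : ℚ) ≤ (s.erase i₀).card := by exact_mod_cast (not_le.1 hlt)
      linarith
    obtain ⟨K, hK⟩ := hQn i₀
    have hKpos : 0 < K := by
      rcases Nat.eq_zero_or_pos K with h | h
      · have := hn i₀
        rw [hK, h] at this
        simp at this
      · exact h
    have hK' : (0 : ℚ) < K := by exact_mod_cast hKpos
    have ht₀' : t i₀ = 1 + (1 - 2 / Q i₀) / K := by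
      simp only [ht, hK]
      push_cast
      field_simp
      ring
    have hf1 : (2 / Q i₀ : ℚ) ≤ 2 / 3 := div_le_div_of_nonneg_left (by norm_num) (by norm_num) hq3
    have hf0 : (0 : ℚ) < 2 / Q i₀ := by positivity
    rcases Nat.le_one_iff_eq_zero_or_eq_one.1 hle with h0 | h1
    · rw [Finset.card_eq_zero.1 h0, Finset.sum_empty, ht₀'] at hs_sum
      -- With no other term, `K = 1` gives `N = Q`, contrary to `hA`, and `K ≥ 2` keeps the total at
      -- most `3/2`.
      rcases Nat.lt_or_ge K 2 with hK2 | hK2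
      · have hK1 : K = 1 := by omega
        rw [hK1] at hs_sum
        have e : (2 / Q i₀ : ℚ) = 2 / N := by
          simp only [Nat.cast_one, div_one] at hs_sum
          linarith
        have e2 : (N : ℚ) = Q i₀ := by
          field_simp at e
          linarith
        have e3 : N = Q i₀ := by exact_mod_cast e2
        have := hA i₀
        rw [hK, hK1] at this
        omega
      · have : (1 - 2 / Q i₀ : ℚ) / K ≤ 1 / 2 := by
          have hK2' : (2 : ℚ) ≤ K := by exact_mod_cast hK2
          rw [div_le_iff₀ hK']
          linarith
        linarith
    · obtain ⟨j, hj⟩ := Finset.card_eq_one.1 h1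
      have hjs : j ∈ s := Finset.mem_of_mem_erase (hj ▸ Finset.mem_singleton_self j)
      rw [hj, Finset.sum_singleton, ht₀'] at hs_sum
      have hfK : 0 < (1 - 2 / Q i₀ : ℚ) / K := div_pos (by linarith) hK'
      rcases hcases j with h | h | h
      · exact (Finset.mem_filter.1 hjs).2 h
      · obtain ⟨hj2, -, hjt, -⟩ := h
        rw [hjt] at hs_sum
        have hnj := hn' j
        have key : (1 / n j : ℚ) = 2 / N + (1 - 2 / Q i₀) / K := by linarith
        have hnj3 : (n j : ℚ) < 3 * K := by
          have : (1 / 3 : ℚ) / K < 1 / n j := by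
            rw [key]
            have : (1 / 3 : ℚ) / K ≤ (1 - 2 / Q i₀) / K := by
              gcongr
              linarith
            linarith
          rw [div_lt_div_iff₀ hK' hnj] at this
          linarith
        have key2 : (2 * (Q i₀ * K * n j) : ℚ) = N * (Q i₀ * K - (Q i₀ - 2) * n j) := by
          field_simp at key
          linarith
        -- The factor multiplying `N` is a positive integer, hence at least `1`; this yields `N ≤ 2
        -- Q K n_j`, and `n_j < 3K`.
        have hint : (1 : ℚ) ≤ Q i₀ * K - (Q i₀ - 2) * n j := by
          have hpos : (0 : ℚ) < Q i₀ * K - (Q i₀ - 2) * n j := by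
            by_contra hneg
            have h1 : (0 : ℚ) < 2 * (Q i₀ * K * n j) := by positivity
            have h2 : (N : ℚ) * (Q i₀ * K - (Q i₀ - 2) * n j) ≤ 0 :=
              mul_nonpos_of_nonneg_of_nonpos (by linarith) (not_lt.1 hneg)
            linarith
          have hcast : ((Q i₀ * K - (Q i₀ - 2) * n j : ℤ) : ℚ) =
              Q i₀ * K - (Q i₀ - 2) * n j := by push_cast; ring
          rw [← hcast] at hpos ⊢
          exact_mod_cast hpos
        have hle2 : (N : ℚ) ≤ 2 * (Q i₀ * K * n j) := by
          rw [key2]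
          exact le_mul_of_one_le_right (by linarith) hint
        have hlt : (N : ℚ) < 6 * Q i₀ * K ^ 2 := by
          have : (2 * (Q i₀ * K * n j) : ℚ) < 2 * (Q i₀ * K * (3 * K)) := by gcongr
          nlinarith
        have := hC i₀ K hi₀ hK
        have hlt' : N < 6 * Q i₀ * K ^ 2 := by exact_mod_cast hlt
        omega
      · linarith [h.2]
  · push Not at hpar
    have hs1 : ∀ i ∈ s, 2 ≤ n i ∧ t i = 1 - 1 / n i := by
      intro i hi
      rcases hcases i with h | h | h
      · exact absurd h (Finset.mem_filter.1 hi).2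
      · exact ⟨h.1, h.2.2.1⟩
      · have := hpar i
        omega
    have hinv : ∀ i, (1 / n i : ℚ) > 2 / N := by
      intro i
      have h1 : (2 * n i : ℚ) < N := by exact_mod_cast hA i
      rw [gt_iff_lt, div_lt_div_iff₀ (by linarith) (hn' i)]
      linarith
    have hcard : (s.card : ℚ) * (1 / 2) ≤ ∑ i ∈ s, t i := by
      rw [← nsmul_eq_mul]
      exact Finset.card_nsmul_le_sum _ _ _ hs_half
    have hle : s.card ≤ 3 := by
      by_contra hlt
      have : (4 : ℚ) ≤ s.card := by exact_mod_cast (not_le.1 hlt)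
      linarith
    -- Without unipotents, up to two non-zero terms are incompatible with `1 / n i > 2 / N`; three
    -- terms give the triangle equation.
    interval_cases hc : s.card
    · rw [Finset.card_eq_zero.1 hc, Finset.sum_empty] at hs_sum
      linarith
    · obtain ⟨i, hi⟩ := Finset.card_eq_one.1 hc
      rw [hi, Finset.sum_singleton, (hs1 i (by simp [hi])).2] at hs_sum
      have := hinv i
      linarith
    · obtain ⟨i, j, hij, hi⟩ := Finset.card_eq_two.1 hc
      rw [hi, Finset.sum_pair hij, (hs1 i (by simp [hi])).2, (hs1 j (by simp [hi])).2] at hs_sum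
      have := hinv i
      have := hinv j
      linarith
    · obtain ⟨i, j, k, hij, hik, hjk, hi⟩ := Finset.card_eq_three.1 hc
      rw [hi, Finset.sum_insert (by simp [hij, hik]), Finset.sum_pair hjk,
        (hs1 i (by simp [hi])).2, (hs1 j (by simp [hi])).2, (hs1 k (by simp [hi])).2] at hs_sum
      have hi2 := (hs1 i (by simp [hi])).1
      have hj2 := (hs1 j (by simp [hi])).1
      have hk2 := (hs1 k (by simp [hi])).1
      have h0 : (1 / n i + 1 / n j + 1 / n k : ℚ) = 1 + 2 / N := by linarith
      have hAi := hA i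
      have hAj := hA j
      have hAk := hA k
      have : N ≤ 60 := by
        rcases le_total (n i) (n j) with h1 | h1 <;> rcases le_total (n j) (n k) with h2 | h2 <;>
          rcases le_total (n i) (n k) with h3 | h3
        · exact le_sixty_of_sum_inv hi2 h1 h2 hN hAk h0
        · exact le_sixty_of_sum_inv hi2 h1 h2 hN hAk h0
        · exact le_sixty_of_sum_inv hi2 h3 h2 hN hAj (by linarith)
        · exact le_sixty_of_sum_inv hk2 h3 h1 hN hAj (by linarith)
        · exact le_sixty_of_sum_inv hj2 h1 h3 hN hAk (by linarith)
        · exact le_sixty_of_sum_inv hj2 h2 h3 hN hAi (by linarith)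
        · exact le_sixty_of_sum_inv hk2 h2 h1 hN hAi (by linarith)
        · exact le_sixty_of_sum_inv hk2 h2 h1 hN hAi (by linarith)
      omega

end OrbitArithmetic

/-! ### The action of `SL₂` on the projective line and its point stabilisers -/

section ProjectiveLine

open Matrix

variable {F : Type*} [Field F]

theorem sl_two_mul_apply {R : Type*} [CommRing R] (g h : SL(2, R)) (i j : Fin 2) :
    (g * h) i j = g i 0 * h 0 j + g i 1 * h 1 j := by
  simp [Matrix.mul_apply, Fin.sum_univ_two]

theorem sl_two_det {R : Type*} [CommRing R] (g : SL(2, R)) :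
    g 0 0 * g 1 1 - g 0 1 * g 1 0 = 1 := by
  rw [← Matrix.det_fin_two, g.det_coe]

theorem sl_two_ext {R : Type*} [CommRing R] {g h : SL(2, R)} (h00 : g 0 0 = h 0 0)
    (h01 : g 0 1 = h 0 1) (h10 : g 1 0 = h 1 0) (h11 : g 1 1 = h 1 1) : g = h := by
  refine Matrix.SpecialLinearGroup.ext _ _ fun i j => ?_
  fin_cases i <;> fin_cases j <;> assumption

theorem sl_two_inv_apply {R : Type*} [CommRing R] (g : SL(2, R)) :
    (g⁻¹ 0 0 = g 1 1 ∧ g⁻¹ 0 1 = -g 0 1) ∧ g⁻¹ 1 0 = -g 1 0 ∧ g⁻¹ 1 1 = g 0 0 := by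
  simp [Matrix.SpecialLinearGroup.SL2_inv_expl]

/-- The unipotent matrix `[1, b; 0, 1]`. -/
abbrev upperUnipotent {R : Type*} [CommRing R] (b : R) : SL(2, R) :=
  Matrix.SpecialLinearGroup.transvection (zero_ne_one : (0 : Fin 2) ≠ 1) b

/-- The unipotent matrix `[1, 0; b, 1]`. -/
abbrev lowerUnipotent {R : Type*} [CommRing R] (b : R) : SL(2, R) :=
  Matrix.SpecialLinearGroup.transvection (one_ne_zero : (1 : Fin 2) ≠ 0) b

theorem upperUnipotent_apply {R : Type*} [CommRing R] (b : R) :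
    (upperUnipotent b 0 0 = 1 ∧ upperUnipotent b 0 1 = b) ∧
      upperUnipotent b 1 0 = 0 ∧ upperUnipotent b 1 1 = 1 := by
  simp [Matrix.SpecialLinearGroup.transvection_coe]

theorem lowerUnipotent_apply {R : Type*} [CommRing R] (b : R) :
    (lowerUnipotent b 0 0 = 1 ∧ lowerUnipotent b 0 1 = 0) ∧
      lowerUnipotent b 1 0 = b ∧ lowerUnipotent b 1 1 = 1 := by
  simp [Matrix.SpecialLinearGroup.transvection_coe]

theorem eq_top_of_unipotent_mem {H : Subgroup SL(2, F)} (hu : ∀ b, upperUnipotent b ∈ H)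
    (hl : ∀ b, lowerUnipotent b ∈ H) : H = ⊤ := by
  refine (Subgroup.eq_top_iff' H).2 fun g =>
    Matrix.SL2.transvection_induction (· ∈ H) (fun i j hij c => ?_) (fun _ _ => mul_mem) g
  fin_cases i <;> fin_cases j
  · exact absurd rfl hij
  · exact hu c
  · exact hl c
  · exact absurd rfl hij

theorem trace_conj {R : Type*} [CommRing R] (g h : SL(2, R)) :
    Matrix.trace (g⁻¹ * h * g : SL(2, R)).1 = Matrix.trace h.1 := by
  rw [Matrix.SpecialLinearGroup.coe_mul, Matrix.trace_mul_comm,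
    ← Matrix.SpecialLinearGroup.coe_mul, ← mul_assoc, mul_inv_cancel, one_mul]

variable [DecidableEq F]

/-- The action of `SL(2, F)` on the projective line by Möbius transformations. -/
noncomputable instance slTwoAction : MulAction SL(2, F) (OnePoint F) :=
  MulAction.compHom _ (Matrix.SpecialLinearGroup.toGL (n := Fin 2) (R := F))

theorem sl_smul_infty (g : SL(2, F)) :
    g • (OnePoint.infty : OnePoint F) = if g 1 0 = 0 then (OnePoint.infty : OnePoint F) else ((g 0 0 / g 1 0 : F) : OnePoint F) :=
  OnePoint.smul_infty_eq_ite (Matrix.SpecialLinearGroup.toGL g)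

theorem sl_smul_coe (g : SL(2, F)) (x : F) : g • (x : OnePoint F) =
    if g 1 0 * x + g 1 1 = 0 then (OnePoint.infty : OnePoint F)
    else (((g 0 0 * x + g 0 1) / (g 1 0 * x + g 1 1) : F) : OnePoint F) :=
  OnePoint.smul_some_eq_ite (g := Matrix.SpecialLinearGroup.toGL g)

theorem sl_smul_infty_eq_iff (g : SL(2, F)) : g • (OnePoint.infty : OnePoint F) = (OnePoint.infty : OnePoint F) ↔ g 1 0 = 0 := by
  rw [sl_smul_infty]
  split_ifs with h <;> simp [h]

theorem upperUnipotent_smul_coe (b x : F) :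
    upperUnipotent b • (x : OnePoint F) = ((x + b : F) : OnePoint F) := by
  rw [sl_smul_coe, (upperUnipotent_apply b).1.1, (upperUnipotent_apply b).1.2,
    (upperUnipotent_apply b).2.1, (upperUnipotent_apply b).2.2]
  simp

theorem exists_smul_infty_eq (x : OnePoint F) : ∃ g : SL(2, F), g • (OnePoint.infty : OnePoint F) = x := by
  cases x with
  | infty => exact ⟨1, one_smul _ _⟩
  | coe x =>
    let w : SL(2, F) := ⟨!![0, -1; 1, 0], by simp⟩
    have hw : w • (OnePoint.infty : OnePoint F) = ((0 : F) : OnePoint F) := by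
      rw [sl_smul_infty]
      simp [w]
    exact ⟨upperUnipotent x * w, by rw [mul_smul, hw, upperUnipotent_smul_coe, zero_add]⟩

variable (F) in
/-- The upper triangular subgroup of `SL(2, F)`, as the stabiliser of `∞`. -/
noncomputable def borel : Subgroup SL(2, F) := MulAction.stabilizer SL(2, F) (OnePoint.infty : OnePoint F)

theorem mem_borel_iff {g : SL(2, F)} : g ∈ borel F ↔ g 1 0 = 0 := sl_smul_infty_eq_iff g

theorem borel_mul_eq_one {g : SL(2, F)} (hg : g ∈ borel F) : g 0 0 * g 1 1 = 1 := by
  have := sl_two_det g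
  rwa [mem_borel_iff.1 hg, mul_zero, sub_zero] at this

variable (F) in
/-- The top left entry, as a character of the upper triangular group. -/
noncomputable def borelChar : borel F →* Fˣ :=
  MonoidHom.toHomUnits
    { toFun := fun g => g.1 0 0
      map_one' := by simp
      map_mul' := fun g h => by
        change (g.1 * h.1) 0 0 = _
        rw [sl_two_mul_apply, mem_borel_iff.1 h.2, mul_zero, add_zero] }

theorem borelChar_apply (g : borel F) : (borelChar F g : F) = g.1 0 0 := rfl

theorem borelChar_eq_one_iff (g : borel F) : borelChar F g = 1 ↔ g.1 = upperUnipotent (g.1 0 1) := by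
  rw [Units.ext_iff, borelChar_apply, Units.val_one]
  constructor
  · intro h
    have h1 := borel_mul_eq_one g.2
    rw [h, one_mul] at h1
    obtain ⟨⟨e1, e2⟩, e3, e4⟩ := upperUnipotent_apply (g.1 0 1)
    exact sl_two_ext (by rw [e1, h]) e2.symm (by rw [e3, mem_borel_iff.1 g.2]) (by rw [e4, h1])
  · intro h
    rw [h]
    exact (upperUnipotent_apply _).1.1

theorem upperUnipotent_add {R : Type*} [CommRing R] (a b : R) :
    upperUnipotent (a + b) = upperUnipotent a * upperUnipotent b := by
  obtain ⟨⟨e1, e2⟩, e3, e4⟩ := upperUnipotent_apply (a + b)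
  obtain ⟨⟨f1, f2⟩, f3, f4⟩ := upperUnipotent_apply a
  obtain ⟨⟨g1, g2⟩, g3, g4⟩ := upperUnipotent_apply b
  apply sl_two_ext <;> simp only [sl_two_mul_apply, *] <;> ring

theorem upperUnipotent_zero {R : Type*} [CommRing R] : upperUnipotent (0 : R) = 1 :=
  Matrix.SpecialLinearGroup.transvection_coeff_zero _

theorem upperUnipotent_neg {R : Type*} [CommRing R] (a : R) :
    upperUnipotent (-a) = (upperUnipotent a)⁻¹ := by
  rw [eq_inv_iff_mul_eq_one, ← upperUnipotent_add, neg_add_cancel, upperUnipotent_zero]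

-- Commutators lie in the kernel of the diagonal character, which is a copy of the additive group of
-- the field.
open scoped commutatorElement in
theorem borel_metabelian {a b c d : SL(2, F)} (ha : a ∈ borel F) (hb : b ∈ borel F)
    (hc : c ∈ borel F) (hd : d ∈ borel F) : ⁅⁅a, b⁆, ⁅c, d⁆⁆ = 1 := by
  have key : ∀ a b : borel F, ∃ t, ((⁅a, b⁆ : borel F) : SL(2, F)) = upperUnipotent t := fun a b =>
    ⟨_, (borelChar_eq_one_iff _).1 (by
      rw [map_commutatorElement, commutatorElement_eq_one_iff_commute]
      exact Commute.all _ _)⟩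
  obtain ⟨s, hs⟩ := key ⟨a, ha⟩ ⟨b, hb⟩
  obtain ⟨t, ht⟩ := key ⟨c, hc⟩ ⟨d, hd⟩
  have hs' : ⁅a, b⁆ = upperUnipotent s := hs
  have ht' : ⁅c, d⁆ = upperUnipotent t := ht
  rw [hs', ht', commutatorElement_eq_one_iff_mul_comm, ← upperUnipotent_add, add_comm,
    upperUnipotent_add]

open scoped commutatorElement in
theorem stabilizer_metabelian (x : OnePoint F) {a b c d : SL(2, F)} (ha : a • x = x)
    (hb : b • x = x) (hc : c • x = x) (hd : d • x = x) : ⁅⁅a, b⁆, ⁅c, d⁆⁆ = 1 := by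
  obtain ⟨g, rfl⟩ := exists_smul_infty_eq x
  have key : ∀ a : SL(2, F), a • g • (OnePoint.infty : OnePoint F) = g • (OnePoint.infty : OnePoint F) → MulAut.conj g⁻¹ a ∈ borel F := by
    intro a ha
    rw [borel, MulAction.mem_stabilizer_iff, MulAut.conj_apply, inv_inv, mul_smul, mul_smul, ha,
      inv_smul_smul]
  have := borel_metabelian (key a ha) (key b hb) (key c hc) (key d hd)
  rwa [← map_commutatorElement, ← map_commutatorElement, ← map_commutatorElement,
    map_eq_one_iff _ (MulAut.conj g⁻¹).injective] at this

/-- The number of elements of `H` fixing `x` whose trace satisfies `P`. -/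
noncomputable def stabCount (H : Subgroup SL(2, F)) (x : OnePoint F) (P : F → Prop) : ℕ :=
  Nat.card {h : H // h.1 • x = x ∧ P (Matrix.trace h.1.1)}

theorem stabCount_smul (H : Subgroup SL(2, F)) (g : SL(2, F)) (x : OnePoint F) (P : F → Prop) :
    stabCount H (g • x) P = stabCount (H.map (MulAut.conj g⁻¹).toMonoidHom) x P := by
  let e : H ≃* H.map (MulAut.conj g⁻¹).toMonoidHom := H.equivMapOfInjective _ (MulAut.conj g⁻¹).injective
  refine Nat.card_congr (e.toEquiv.subtypeEquiv fun h => ?_)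
  have he : ((e.toEquiv h : _) : SL(2, F)) = g⁻¹ * h.1 * g := by
    change MulAut.conj g⁻¹ h.1 = _
    rw [MulAut.conj_apply, inv_inv]
  rw [he, trace_conj, mul_smul, mul_smul, inv_smul_eq_iff]

theorem stabCount_smul_of_mem {H : Subgroup SL(2, F)} {g : SL(2, F)} (hg : g ∈ H) (x : OnePoint F)
    (P : F → Prop) : stabCount H (g • x) P = stabCount H x P := by
  rw [stabCount_smul]
  congr 1
  ext h
  rw [Subgroup.mem_map]
  constructor
  · rintro ⟨k, hk, rfl⟩
    simpa using H.mul_mem (H.mul_mem (H.inv_mem hg) hk) hg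
  · intro hh
    exact ⟨g * h * g⁻¹, H.mul_mem (H.mul_mem hg hh) (H.inv_mem hg), by simp [mul_assoc]⟩

/-- The translations contained in a subgroup of `SL(2, F)`. -/
def translations (H : Subgroup SL(2, F)) : AddSubgroup F where
  carrier := {b | upperUnipotent b ∈ H}
  zero_mem' := by
    change upperUnipotent (0 : F) ∈ H
    rw [upperUnipotent_zero]
    exact H.one_mem
  add_mem' {a b} ha hb := by
    change upperUnipotent (a + b) ∈ H
    rw [upperUnipotent_add]
    exact H.mul_mem ha hb
  neg_mem' {a} ha := by
    change upperUnipotent (-a) ∈ H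
    rw [upperUnipotent_neg]
    exact H.inv_mem ha

omit [DecidableEq F] in
theorem mem_translations {H : Subgroup SL(2, F)} {b : F} :
    b ∈ translations H ↔ upperUnipotent b ∈ H := Iff.rfl

/-- The character of the stabiliser of `∞` in `H`. -/
noncomputable def stabChar (H : Subgroup SL(2, F)) : (borel F).subgroupOf H →* Fˣ :=
  (borelChar F).comp
    ((H.subtype.comp ((borel F).subgroupOf H).subtype).codRestrict (borel F) fun g => g.2)

theorem stabChar_apply (H : Subgroup SL(2, F)) (g : (borel F).subgroupOf H) :
    (stabChar H g : F) = g.1.1 0 0 := rfl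

/-- With eigenvalues `a` and `a⁻¹`, trace `2` means `a = 1` and squared trace `4` means `a = ±1`.
The trace is invariant under conjugation, so it detects the unipotent part of the stabiliser of any
point. -/
theorem trace_eq_stabChar (H : Subgroup SL(2, F)) (g : (borel F).subgroupOf H) :
    Matrix.trace g.1.1.1 = stabChar H g + (stabChar H g : F)⁻¹ := by
  have h1 : g.1.1 0 0 * g.1.1 1 1 = 1 := borel_mul_eq_one g.2
  rw [Matrix.trace_fin_two, stabChar_apply, eq_inv_of_mul_eq_one_right h1]

omit [DecidableEq F] in
theorem units_add_inv_eq_two_iff (a : Fˣ) : (a + (a : F)⁻¹ = 2) ↔ a = 1 := by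
  rw [Units.ext_iff, Units.val_one]
  have := a.ne_zero
  constructor
  · intro h
    field_simp at h
    have : ((a : F) - 1) ^ 2 = 0 := by linear_combination h
    rwa [sq_eq_zero_iff, sub_eq_zero] at this
  · intro h
    rw [h]
    norm_num

omit [DecidableEq F] in
theorem units_add_inv_sq_eq_four_iff (a : Fˣ) : ((a + (a : F)⁻¹) ^ 2 = 4) ↔ a = 1 ∨ a = -1 := by
  have ha := a.ne_zero
  rw [Units.ext_iff, Units.ext_iff, Units.val_one, Units.val_neg, Units.val_one]
  constructor
  · intro h
    field_simp at h
    have : ((a : F) ^ 2 - 1) ^ 2 = 0 := by linear_combination h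
    rwa [sq_eq_zero_iff, sub_eq_zero, sq_eq_one_iff] at this
  · rintro (h | h) <;> rw [h] <;> norm_num

theorem stabCount_infty (H : Subgroup SL(2, F)) (P : F → Prop) :
    stabCount H (OnePoint.infty : OnePoint F) P =
      Nat.card {g : (borel F).subgroupOf H // P (stabChar H g + (stabChar H g : F)⁻¹)} := by
  refine Nat.card_congr
    ((Equiv.subtypeSubtypeEquivSubtypeInter (fun h : H => h.1 • (OnePoint.infty : OnePoint F) = (OnePoint.infty : OnePoint F))
      (fun h => P (Matrix.trace h.1.1))).symm.trans (Equiv.subtypeEquivRight fun g => ?_))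
  rw [← trace_eq_stabChar H g]

theorem card_ker_stabChar (H : Subgroup SL(2, F)) :
    Nat.card (stabChar H).ker = Nat.card (translations H) := by
  symm
  refine Nat.card_congr (Equiv.ofBijective (fun b => ⟨⟨⟨upperUnipotent b.1, b.2⟩,
    mem_borel_iff.2 (upperUnipotent_apply b.1).2.1⟩, ?_⟩) ⟨fun b c h => ?_, fun g => ?_⟩)
  · rw [MonoidHom.mem_ker, Units.ext_iff]
    exact (upperUnipotent_apply b.1).1.1
  · have h1 : upperUnipotent b.1 = upperUnipotent c.1 :=
      congrArg (fun k : (stabChar H).ker => k.1.1.1) h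
    have h2 : upperUnipotent b.1 0 1 = upperUnipotent c.1 0 1 := by rw [h1]
    exact Subtype.ext (by rwa [(upperUnipotent_apply _).1.2, (upperUnipotent_apply _).1.2] at h2)
  · have h1 := (borelChar_eq_one_iff ⟨g.1.1.1, g.1.2⟩).1 g.2
    have h2 : upperUnipotent (g.1.1.1 0 1) ∈ H := h1 ▸ g.1.1.2
    exact ⟨⟨_, h2⟩, Subtype.ext (Subtype.ext (Subtype.ext h1.symm))⟩

theorem stabCount_infty_eq_two (H : Subgroup SL(2, F)) :
    stabCount H (OnePoint.infty : OnePoint F) (· = 2) = Nat.card (translations H) := by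
  rw [stabCount_infty, ← card_ker_stabChar]
  exact Nat.card_congr (Equiv.subtypeEquivRight fun g => by
    rw [units_add_inv_eq_two_iff, MonoidHom.mem_ker])

theorem stabCount_infty_true (H : Subgroup SL(2, F)) :
    stabCount H (OnePoint.infty : OnePoint F) (fun _ => True) = Nat.card (translations H) * Nat.card (stabChar H).range := by
  rw [stabCount_infty, ← card_ker_stabChar, ← Subgroup.index_ker, Subgroup.card_mul_index]
  exact Nat.card_congr (Equiv.subtypeUnivEquiv fun _ => trivial)

/-- The elements counted are the unipotents and their negatives, two disjoint families because `1 ≠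
-1`. -/
theorem stabCount_infty_sq_eq_four [Finite F] (h2 : (2 : F) ≠ 0) {H : Subgroup SL(2, F)}
    (hH : -1 ∈ H) : stabCount H (OnePoint.infty : OnePoint F) (fun t => t ^ 2 = 4) = 2 * Nat.card (translations H) := by
  rw [stabCount_infty, ← card_ker_stabChar]
  let m : (borel F).subgroupOf H := ⟨⟨-1, hH⟩, mem_borel_iff.2 (by simp)⟩
  have hm : stabChar H m = -1 := by
    rw [Units.ext_iff, stabChar_apply]
    simp [m]
  have hne : (-1 : Fˣ) ≠ 1 := by
    intro h
    rw [Units.ext_iff, Units.val_neg, Units.val_one] at h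
    exact h2 (by linear_combination -h)
  let e : Bool × (stabChar H).ker → {g : (borel F).subgroupOf H //
      (stabChar H g + (stabChar H g : F)⁻¹) ^ 2 = 4} := fun p => ⟨cond p.1 m 1 * p.2.1, by
    rw [units_add_inv_sq_eq_four_iff, map_mul, MonoidHom.mem_ker.1 p.2.2, mul_one]
    rcases p.1 with _ | _
    · left; simp
    · right; exact hm⟩
  have he : Function.Bijective e := by
    constructor
    · rintro ⟨b, k⟩ ⟨c, l⟩ h
      have h1 : cond b m 1 * k.1 = cond c m 1 * l.1 := congrArg Subtype.val h
      have h3 := congrArg (stabChar H) h1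
      rw [map_mul, map_mul, MonoidHom.mem_ker.1 k.2, MonoidHom.mem_ker.1 l.2, mul_one,
        mul_one] at h3
      have hbc : b = c := by
        rcases b with _ | _ <;> rcases c with _ | _
        · rfl
        · exact absurd (hm.symm.trans (h3.symm.trans (map_one _))) hne
        · exact absurd (hm.symm.trans (h3.trans (map_one _))) hne
        · rfl
      subst hbc
      exact Prod.ext rfl (Subtype.ext (mul_left_cancel h1))
    · rintro ⟨g, hg⟩
      rcases (units_add_inv_sq_eq_four_iff _).1 hg with h | h
      · exact ⟨(false, ⟨g, h⟩), Subtype.ext (one_mul g)⟩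
      · refine ⟨(true, ⟨m⁻¹ * g, ?_⟩), Subtype.ext (mul_inv_cancel_left m g)⟩
        rw [MonoidHom.mem_ker, map_mul, map_inv, hm, h, inv_mul_cancel]
  rw [← Nat.card_congr (Equiv.ofBijective e he), Nat.card_prod]
  simp

theorem even_card_range_stabChar [Finite F] (h2 : (2 : F) ≠ 0) {H : Subgroup SL(2, F)}
    (hH : -1 ∈ H) : 2 ∣ Nat.card (stabChar H).range := by
  let m : (borel F).subgroupOf H := ⟨⟨-1, hH⟩, mem_borel_iff.2 (by simp)⟩
  have hm : stabChar H m = -1 := by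
    rw [Units.ext_iff, stabChar_apply]
    simp [m]
  have ho : orderOf (⟨-1, ⟨m, hm⟩⟩ : (stabChar H).range) = 2 := by
    rw [orderOf_eq_prime_iff]
    refine ⟨Subtype.ext (by simp), fun h => h2 ?_⟩
    have h3 := congrArg (fun u : (stabChar H).range => ((u : Fˣ) : F)) h
    simp only [Units.val_neg, Units.val_one, OneMemClass.coe_one] at h3
    linear_combination -h3
  exact (dvd_of_eq ho.symm).trans (orderOf_dvd_natCard _)

-- By Cauchy's theorem an even order would produce a non-zero `b` with `2b = 0`. Oddness later
-- excludes unipotent parts of order `2`.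
omit [DecidableEq F] in
theorem odd_card_translations [Finite F] (h2 : (2 : F) ≠ 0) (H : Subgroup SL(2, F)) :
    Odd (Nat.card (translations H)) := by
  by_contra hodd
  rw [Nat.not_odd_iff_even, even_iff_two_dvd] at hodd
  obtain ⟨b, hb⟩ := exists_prime_addOrderOf_dvd_card' 2 hodd
  have hb2 : 2 • b = 0 := by rw [← hb]; exact addOrderOf_nsmul_eq_zero b
  have h3 : (2 : F) * b.1 = 0 := by
    have := congrArg Subtype.val hb2
    simpa [two_mul, two_nsmul] using this
  have : b = 0 := Subtype.ext ((mul_eq_zero.1 h3).resolve_left h2)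
  rw [this, addOrderOf_zero] at hb
  omega

/-- Orders of a point stabiliser of a subgroup containing `-1`, and of its parts. -/
theorem stabCount_structure [Finite F] (h2 : (2 : F) ≠ 0) {H : Subgroup SL(2, F)} (hH : -1 ∈ H)
    (x : OnePoint F) :
    Odd (stabCount H x (· = 2)) ∧
      stabCount H x (fun t => t ^ 2 = 4) = 2 * stabCount H x (· = 2) ∧
      ∃ K, 0 < K ∧ stabCount H x (fun _ => True) = 2 * (stabCount H x (· = 2) * K) := by
  obtain ⟨g, rfl⟩ := exists_smul_infty_eq x
  simp only [stabCount_smul]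
  set J := H.map (MulAut.conj g⁻¹).toMonoidHom with hJ
  have hJ1 : -1 ∈ J := ⟨-1, hH, by simp⟩
  rw [stabCount_infty_eq_two, stabCount_infty_sq_eq_four h2 hJ1, stabCount_infty_true]
  refine ⟨odd_card_translations h2 J, rfl, ?_⟩
  obtain ⟨K, hK⟩ := even_card_range_stabChar h2 hJ1
  refine ⟨K, ?_, by rw [hK]; ring⟩
  have : 0 < Nat.card (stabChar J).range := Nat.card_pos
  omega

end ProjectiveLine

/-! ### Counting fixed points over a field that contains all eigenvalues -/

section FixedPoints

variable {E : Type*} [Field E] [DecidableEq E]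

/-- The number `r` is an eigenvalue, and its eigenline is the fixed point. -/
theorem exists_fixed_point (h : SL(2, E)) {r : E} (hr : r ^ 2 - Matrix.trace h.1 * r + 1 = 0) :
    ∃ x : OnePoint E, h • x = x := by
  by_cases hc : h 1 0 = 0
  · exact ⟨_, (sl_smul_infty_eq_iff h).2 hc⟩
  · have hr0 : r ≠ 0 := by
      rintro rfl
      simp at hr
    refine ⟨(((r - h 1 1) / h 1 0 : E) : OnePoint E), ?_⟩
    have hden : h 1 0 * ((r - h 1 1) / h 1 0) + h 1 1 = r := by field_simp; ring
    rw [sl_smul_coe, hden, if_neg hr0, OnePoint.coe_eq_coe, div_eq_iff hr0]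
    have hdet := sl_two_det h
    rw [Matrix.trace_fin_two] at hr
    field_simp
    linear_combination -hr - hdet

/-- Number of fixed points of a non-central element with eigenvalues in the ground field. -/
theorem fixed_points_of_upper {h : SL(2, E)} (h1 : h ≠ 1) (h1' : h ≠ -1)
    (hb : h ∈ borel E) :
    (Matrix.trace h.1 ^ 2 = 4 → ∀ x : OnePoint E, h • x = x ↔ x = OnePoint.infty) ∧
      (Matrix.trace h.1 ^ 2 ≠ 4 → ∃ y : E, ∀ x : OnePoint E,
        h • x = x ↔ x = OnePoint.infty ∨ x = (y : OnePoint E)) := by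
  have had := borel_mul_eq_one hb
  have hc := mem_borel_iff.1 hb
  have hd0 : h 1 1 ≠ 0 := right_ne_zero_of_mul_eq_one had
  have hcoe : ∀ x : E, h • (x : OnePoint E) = x ↔ (h 0 0 - h 1 1) * x = - h 0 1 := by
    intro x
    rw [sl_smul_coe, hc, zero_mul, zero_add, if_neg hd0, OnePoint.coe_eq_coe, div_eq_iff hd0]
    constructor <;> intro hh <;> linear_combination hh
  have htr : Matrix.trace h.1 ^ 2 = 4 ↔ h 0 0 = h 1 1 := by
    rw [Matrix.trace_fin_two, ← sub_eq_zero (a := h 0 0), ← sq_eq_zero_iff (a := h 0 0 - h 1 1)]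
    constructor <;> intro hh
    · linear_combination hh - 4 * had
    · linear_combination hh + 4 * had
  refine ⟨fun ht x => ?_, fun ht => ?_⟩
  · cases x with
    | infty => simpa using MulAction.mem_stabilizer_iff.1 hb
    | coe x =>
      rw [hcoe, htr.1 ht, sub_self, zero_mul]
      simp only [OnePoint.coe_ne_infty, iff_false]
      intro hb0
      have h01 : h 0 1 = 0 := neg_eq_zero.1 hb0.symm
      have hsq : h 0 0 ^ 2 = 1 := by
        rw [← htr.1 ht] at had
        rw [pow_two, had]
      rcases sq_eq_one_iff.1 hsq with h00 | h00
      · exact h1 (sl_two_ext (by simp [h00]) (by simp [h01]) (by simp [hc])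
          (by simp [← htr.1 ht, h00]))
      · exact h1' (sl_two_ext (by simp [h00]) (by simp [h01]) (by simp [hc])
          (by simp [← htr.1 ht, h00]))
  · have hne : h 0 0 - h 1 1 ≠ 0 := sub_ne_zero.2 fun hh => ht (htr.2 hh)
    refine ⟨-h 0 1 / (h 0 0 - h 1 1), fun x => ?_⟩
    cases x with
    | infty => simpa using MulAction.mem_stabilizer_iff.1 hb
    | coe x =>
      rw [hcoe]
      simp only [OnePoint.coe_ne_infty, false_or, OnePoint.coe_eq_coe]
      rw [eq_div_iff hne, mul_comm]

-- Counting fixed points of parabolic elements twice makes all non-central elements contribute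
-- equally: `1 + 1` for a parabolic element, `2 + 0` for a semisimple one.
open scoped Classical in
theorem sum_fixed_points [Fintype E] {h : SL(2, E)} (h1 : h ≠ 1) (h1' : h ≠ -1)
    {r : E} (hr : r ^ 2 - Matrix.trace h.1 * r + 1 = 0) :
    ∑ x : OnePoint E, ((if h • x = x ∧ True then 1 else 0) +
      if h • x = x ∧ Matrix.trace h.1 ^ 2 = 4 then 1 else 0) = 2 := by
  obtain ⟨x₀, hx₀⟩ := exists_fixed_point h hr
  obtain ⟨g, rfl⟩ := exists_smul_infty_eq x₀
  set j := g⁻¹ * h * g with hj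
  have hjb : j ∈ borel E := by
    rw [borel, MulAction.mem_stabilizer_iff, hj, mul_smul, mul_smul, hx₀, inv_smul_smul]
  have hhj : h = g * j * g⁻¹ := by rw [hj]; group
  have hj1 : j ≠ 1 := fun hh => h1 (by rw [hhj, hh]; group)
  have hj1' : j ≠ -1 := fun hh => h1' (by rw [hhj, hh]; simp)
  have htr : Matrix.trace h.1 = Matrix.trace j.1 := (trace_conj g h).symm
  have hsmul : ∀ x : OnePoint E, h • g • x = g • x ↔ j • x = x := fun x => by
    rw [hj, mul_smul, mul_smul, inv_smul_eq_iff]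
  rw [← Equiv.sum_comp (MulAction.toPerm g)]
  simp only [MulAction.toPerm_apply, hsmul, htr]
  obtain ⟨hp, hq⟩ := fixed_points_of_upper hj1 hj1' hjb
  by_cases ht : Matrix.trace j.1 ^ 2 = 4
  · simp [ht, hp ht, Finset.sum_add_distrib]
  · obtain ⟨y, hy⟩ := hq ht
    simp only [ht, and_false, and_true, if_false, add_zero, hy]
    rw [← Finset.card_filter]
    have : (Finset.univ.filter fun x : OnePoint E => x = OnePoint.infty ∨ x = (y : OnePoint E)) =
        {OnePoint.infty, (y : OnePoint E)} := by
      ext x; simp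
    rw [this, Finset.card_pair (by simp)]

open scoped Classical in
theorem stabCount_eq_sum [Fintype E] (H : Subgroup SL(2, E)) [Fintype H] (x : OnePoint E)
    (P : E → Prop) [DecidablePred P] :
    stabCount H x P = ∑ h : H, if h.1 • x = x ∧ P (Matrix.trace h.1.1) then 1 else 0 := by
  rw [stabCount, Nat.card_eq_fintype_card, Fintype.card_subtype, Finset.card_filter]

-- Pairs of an element and a fixed point are counted in both orders. Each of `1` and `-1`
-- contributes twice the number of points, every other element contributes `2`.
open scoped Classical in
theorem sum_stabCount [Fintype E] (h2 : (2 : E) ≠ 0) {H : Subgroup SL(2, E)} (hH : -1 ∈ H)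
    (hsplit : ∀ h ∈ H, ∃ r : E, r ^ 2 - Matrix.trace h.1 * r + 1 = 0) :
    ∑ x : OnePoint E, (stabCount H x (fun _ => True) + stabCount H x fun t => t ^ 2 = 4) + 4 =
      4 * Fintype.card (OnePoint E) + 2 * Nat.card H := by
  have := Fintype.ofFinite H
  simp only [stabCount_eq_sum, ← Finset.sum_add_distrib]
  rw [Finset.sum_comm]
  let m : H := ⟨-1, hH⟩
  have hm1 : (1 : H) ≠ m := by
    intro h
    have h3 := congrArg (fun k : H => k.1 0 0) h
    simp only [OneMemClass.coe_one, Matrix.SpecialLinearGroup.coe_one, m,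
      Matrix.SpecialLinearGroup.coe_neg, Matrix.neg_apply, Matrix.one_apply_eq] at h3
    exact h2 (by linear_combination h3)
  have hmsmul : ∀ x : OnePoint E, (-1 : SL(2, E)) • x = x := by
    intro x
    cases x with
    | infty => rw [sl_smul_infty_eq_iff]; simp
    | coe x => rw [sl_smul_coe]; simp
  have hother : ∀ h ∈ Finset.univ \ ({1, m} : Finset H),
      ∑ x : OnePoint E, ((if h.1 • x = x ∧ True then 1 else 0) +
        if h.1 • x = x ∧ Matrix.trace h.1.1 ^ 2 = 4 then 1 else 0) = 2 := by
    intro h hh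
    obtain ⟨-, hh⟩ := Finset.mem_sdiff.1 hh
    rw [Finset.mem_insert, Finset.mem_singleton, not_or] at hh
    obtain ⟨r, hr⟩ := hsplit h.1 h.2
    exact sum_fixed_points (fun hc => hh.1 (Subtype.ext hc)) (fun hc => hh.2 (Subtype.ext hc)) hr
  rw [← Finset.sum_sdiff (Finset.subset_univ ({1, m} : Finset H)), Finset.sum_pair hm1,
    Finset.sum_congr rfl hother]
  have hc : (Finset.univ \ ({1, m} : Finset H)).card + 2 = Nat.card H := by
    have h3 := Finset.card_sdiff_add_card_eq_card (Finset.subset_univ ({1, m} : Finset H))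
    rwa [Finset.card_pair hm1, Finset.card_univ, ← Nat.card_eq_fintype_card] at h3
  have hone : ∑ x : OnePoint E, ((if (1 : H).1 • x = x ∧ True then 1 else 0) +
      if (1 : H).1 • x = x ∧ Matrix.trace (1 : H).1.1 ^ 2 = 4 then 1 else 0) =
      2 * Fintype.card (OnePoint E) := by
    have : Matrix.trace (1 : H).1.1 ^ 2 = (4 : E) := by simp; norm_num
    simp only [this]
    simp only [OneMemClass.coe_one, one_smul, and_true, if_true, Finset.sum_const,
      Finset.card_univ, smul_eq_mul]
    ring
  have hneg : ∑ x : OnePoint E, ((if m.1 • x = x ∧ True then 1 else 0) +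
      if m.1 • x = x ∧ Matrix.trace m.1.1 ^ 2 = 4 then 1 else 0) =
      2 * Fintype.card (OnePoint E) := by
    have : Matrix.trace m.1.1 ^ 2 = (4 : E) := by simp [m]; norm_num
    simp only [this, m, hmsmul, and_true, if_true, Finset.sum_const, Finset.card_univ, smul_eq_mul]
    ring
  rw [hone, hneg, Finset.sum_const, smul_eq_mul]
  omega

theorem card_orbit_mul_stabCount [Fintype E] (H : Subgroup SL(2, E)) (x : OnePoint E) :
    (MulAction.orbit H x).ncard * stabCount H x (fun _ => True) = Nat.card H := by
  rw [← MulAction.index_stabilizer, mul_comm, ← Subgroup.card_mul_index (MulAction.stabilizer H x)]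
  congr 1
  exact Nat.card_congr (Equiv.subtypeEquivRight fun h => by
    rw [and_true, MulAction.mem_stabilizer_iff, Subgroup.smul_def])

/-- Finite subgroups of `SL(2)` with split elements: one fixes a point up to index two, or is
small, or has a large group of dilations at a parabolic fixed point. -/
theorem exists_large_stabilizer [Fintype E] (h2 : (2 : E) ≠ 0) {H : Subgroup SL(2, E)}
    (hH : -1 ∈ H) (hsplit : ∀ h ∈ H, ∃ r : E, r ^ 2 - Matrix.trace h.1 * r + 1 = 0) :
    (∃ x, Nat.card H ≤ 2 * stabCount H x fun _ => True) ∨ Nat.card H ≤ 120 ∨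
      ∃ x K, 3 ≤ stabCount H x (· = 2) ∧
        stabCount H x (fun _ => True) = 2 * (stabCount H x (· = 2) * K) ∧
        Nat.card H < 12 * stabCount H x (· = 2) * K ^ 2 := by
  classical
  have hst := stabCount_structure h2 hH
  choose hodd hfour K hKpos hK using hst
  set Q : OnePoint E → ℕ := fun x => stabCount H x (· = 2) with hQ
  have hQpos : ∀ x, 0 < Q x := fun x => (hodd x).pos
  have horb := card_orbit_mul_stabCount H
  -- `N` is the order of the image of `H` in `PSL₂`, in which stabilisers have order `Q * K`.
  obtain ⟨N, hN⟩ : ∃ N, Nat.card H = 2 * N := by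
    have h0 := horb OnePoint.infty
    rw [hK] at h0
    exact ⟨_, by rw [← h0, mul_left_comm]⟩
  have hNpos : 0 < N := by
    have : 0 < Nat.card H := Nat.card_pos
    omega
  have hsum := sum_stabCount h2 hH hsplit
  have hsum' : ∑ x : OnePoint E, ((Q x * K x : ℚ) + Q x - 2) = 2 * N - 2 := by
    have h3 : ∑ x : OnePoint E, (2 * (Q x * K x) + 2 * Q x) + 4 =
        4 * Fintype.card (OnePoint E) + 2 * (2 * N) := by
      rw [← hN, ← hsum]
      congr 1
      exact Finset.sum_congr rfl fun x _ => by rw [hK, hfour]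
    have h4 : ∑ x : OnePoint E, (2 * (Q x * K x : ℚ) + 2 * Q x) + 4 =
        4 * Fintype.card (OnePoint E) + 2 * (2 * N) := by exact_mod_cast h3
    rw [Finset.sum_sub_distrib, Finset.sum_const, Finset.card_univ, nsmul_eq_mul]
    have h5 : ∑ x : OnePoint E, (2 * (Q x * K x : ℚ) + 2 * Q x) =
        2 * ∑ x : OnePoint E, ((Q x * K x : ℚ) + Q x) := by
      rw [Finset.mul_sum]
      exact Finset.sum_congr rfl fun x _ => by ring
    rw [h5] at h4
    linarith
  let ι := MulAction.orbitRel.Quotient H (OnePoint E)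
  have := Fintype.ofFinite ι
  let mkq : OnePoint E → ι := Quotient.mk _
  have hQinv : ∀ x y : OnePoint E, mkq x = mkq y → Q x = Q y ∧ K x = K y := by
    intro x y hxy
    obtain ⟨h, rfl⟩ := MulAction.orbitRel_apply.1 (Quotient.exact hxy)
    have e1 : Q (h • y) = Q y := stabCount_smul_of_mem h.2 y _
    have e2 : stabCount H (h • y) (fun _ => True) = stabCount H y (fun _ => True) :=
      stabCount_smul_of_mem h.2 y _
    rw [hK, hK] at e2
    have e3 : 2 * (Q (h • y) * K (h • y)) = 2 * (Q y * K y) := e2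
    rw [e1] at e3
    exact ⟨e1, Nat.eq_of_mul_eq_mul_left (hQpos y) (Nat.eq_of_mul_eq_mul_left two_pos e3)⟩
  have hfib : ∀ i : ι, ((Finset.univ.filter fun x => mkq x = i).card : ℚ) * (Q i.out * K i.out) =
      N := by
    intro i
    have hset : ((Finset.univ.filter fun x => mkq x = i : Finset (OnePoint E)) :
        Set (OnePoint E)) = MulAction.orbit H i.out := by
      ext x
      rw [Finset.coe_filter, Set.mem_ofPred_eq]
      simp only [Finset.mem_univ, true_and]
      rw [← MulAction.orbitRel_apply]
      constructor
      · rintro rfl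
        exact (MulAction.orbitRel H (OnePoint E)).symm (Quotient.mk_out x)
      · intro h
        rw [← Quotient.out_eq i]
        exact Quotient.sound h
    have h0 := horb i.out
    rw [← hset, Set.ncard_coe_finset, hK, hN] at h0
    have h1 : (Finset.univ.filter fun x => mkq x = i).card * (Q i.out * K i.out) = N := by
      have : 2 * ((Finset.univ.filter fun x => mkq x = i).card * (Q i.out * K i.out)) = 2 * N := by
        rw [← h0]; ring
      omega
    exact_mod_cast h1
  -- The sum over points is grouped by orbits; the orbit of `x` has `N / (Q x * K x)` points and
  -- constant summands.
  have hquot : ∑ i : ι, (((Q i.out * K i.out : ℕ) : ℚ) + Q i.out - 2) / (Q i.out * K i.out : ℕ) =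
      2 - 2 / N := by
    have hN' : (N : ℚ) ≠ 0 := by exact_mod_cast hNpos.ne'
    have key : (N : ℚ) * ∑ i : ι,
        (((Q i.out * K i.out : ℕ) : ℚ) + Q i.out - 2) / (Q i.out * K i.out : ℕ) = 2 * N - 2 := by
      rw [← hsum', ← Finset.sum_fiberwise Finset.univ mkq, Finset.mul_sum]
      refine Finset.sum_congr rfl fun i _ => ?_
      have hc : ∀ x ∈ Finset.univ.filter (fun x => mkq x = i),
          ((Q x * K x : ℚ) + Q x - 2) = (Q i.out * K i.out : ℚ) + Q i.out - 2 := by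
        intro x hx
        obtain ⟨e1, e2⟩ := hQinv x i.out (by
          rw [(Finset.mem_filter.1 hx).2]
          exact (Quotient.out_eq i).symm)
        rw [e1, e2]
      rw [Finset.sum_congr rfl hc, Finset.sum_const, nsmul_eq_mul, ← hfib i]
      have hq : (Q i.out : ℚ) ≠ 0 := by exact_mod_cast (hQpos _).ne'
      have hk : (K i.out : ℚ) ≠ 0 := by exact_mod_cast (hKpos _).ne'
      push_cast
      field_simp
    field_simp at key ⊢
    linarith
  have hQ13 : ∀ i : ι, Q i.out = 1 ∨ 3 ≤ Q i.out := by
    intro i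
    obtain ⟨m, hm⟩ := hodd i.out
    change Q i.out = _ at hm
    omega
  rcases orbit_equation_cases (fun i : ι => Q i.out * K i.out) (fun i => Q i.out) N hNpos
    (fun i => Nat.mul_pos (hQpos _) (hKpos _)) (fun i => dvd_mul_right _ _) hQ13 hquot with
    ⟨i, hi⟩ | h60 | ⟨i, k, hi3, hik, hlt⟩
  · left
    refine ⟨i.out, ?_⟩
    rw [hN, hK]
    change 2 * N ≤ 2 * (2 * (Q i.out * K i.out))
    omega
  · right; left
    omega
  · right; right
    have hkk : K i.out = k := Nat.eq_of_mul_eq_mul_left (hQpos _) hik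
    refine ⟨i.out, k, hi3, by rw [hK, hkk], ?_⟩
    change Nat.card H < 12 * Q i.out * k ^ 2
    rw [hN]
    calc 2 * N < 2 * (6 * Q i.out * k ^ 2) := by omega
      _ = _ := by ring

end FixedPoints

/-! ### Small subfields, dilations and extension of scalars -/

section WeakDickson

variable {k : Type*} [Field k]

omit [Field k] in
theorem AdmissibleNat.le_of_dvd {M : ℝ} {n r : ℕ} (h : AdmissibleNat M n) (hr : 2 ≤ r)
    (hrn : r ∣ n) : M ≤ r := by
  have h1 := h.2 r.minFac (Nat.minFac_prime (by omega)) ((Nat.minFac_dvd r).trans hrn)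
  exact h1.trans (by exact_mod_cast Nat.minFac_le (by omega))

/-- Proper subfields of a field of order `p ^ n` are small if `n` has no small prime factor. -/
theorem card_subring_le [Finite k] {p n : ℕ} (hp : p.Prime) (hk : Nat.card k = p ^ n) {M : ℝ}
    (hM0 : 0 < M) (hM : AdmissibleNat M n) {S : Subring k} (hS : S ≠ ⊤) :
    (Nat.card S : ℝ) ≤ (p : ℝ) ^ (n / M : ℝ) := by
  classical
  let : Fintype S := Fintype.ofFinite S
  let : Module S k := inferInstance
  let : Field S := Fintype.fieldOfDomain S
  have hr : Nat.card k = Nat.card S ^ Module.finrank S k := Module.natCard_eq_pow_finrank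
  set r := Module.finrank S k with hrdef
  have hr1 : r ≠ 1 := by
    intro h1
    rw [h1, pow_one] at hr
    apply hS
    have := AddSubgroup.eq_top_of_card_eq S.toAddSubgroup hr.symm
    exact Subring.toAddSubgroup_injective this
  have hr0 : r ≠ 0 := by
    intro h0
    rw [h0, pow_zero] at hr
    have : 1 < Nat.card k := Finite.one_lt_card
    omega
  obtain ⟨d, -, hd⟩ := (Nat.dvd_prime_pow hp).1
    (show Nat.card S ∣ p ^ n by rw [← hk, hr]; exact dvd_pow_self _ hr0)
  have hn : n = d * r := by
    rw [hk, hd, ← pow_mul] at hr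
    exact Nat.pow_right_injective hp.two_le hr
  have hMr : M ≤ r := hM.le_of_dvd (by omega) ⟨d, by rw [hn, mul_comm]⟩
  rw [hd, Nat.cast_pow, ← Real.rpow_natCast]
  refine Real.rpow_le_rpow_of_exponent_le (by exact_mod_cast hp.one_lt.le) ?_
  rw [le_div_iff₀ hM0, hn, Nat.cast_mul]
  gcongr

variable [DecidableEq k]

/-- Correcting `j` by a translation gives `w` with vanishing top left entry. Such a `w` exchanges
`0` and `∞`, hence conjugates upper unipotents into lower ones. -/
theorem eq_top_of_translations_eq_top {J : Subgroup SL(2, k)} (hA : translations J = ⊤)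
    {j : SL(2, k)} (hj : j ∈ J) (hjb : j ∉ borel k) : J = ⊤ := by
  have hu : ∀ b, upperUnipotent b ∈ J := fun b => by
    rw [← mem_translations, hA]
    trivial
  refine eq_top_of_unipotent_mem hu fun b => ?_
  rw [mem_borel_iff] at hjb
  set w := upperUnipotent (-(j 0 0 / j 1 0)) * j with hw
  have hwJ : w ∈ J := J.mul_mem (hu _) hj
  have hw00 : w 0 0 = 0 := by
    rw [hw, sl_two_mul_apply, (upperUnipotent_apply _).1.1, (upperUnipotent_apply _).1.2]
    field_simp
    ring
  have hdet := sl_two_det w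
  rw [hw00, zero_mul, zero_sub] at hdet
  have hw10 : w 1 0 ≠ 0 := by
    intro h
    rw [h, mul_zero, neg_zero] at hdet
    exact zero_ne_one hdet
  have key : lowerUnipotent b = w * upperUnipotent (-(b / w 1 0 ^ 2)) * w⁻¹ := by
    obtain ⟨⟨e1, e2⟩, e3, e4⟩ := upperUnipotent_apply (-(b / w 1 0 ^ 2))
    obtain ⟨⟨f1, f2⟩, f3, f4⟩ := lowerUnipotent_apply b
    obtain ⟨⟨i1, i2⟩, i3, i4⟩ := sl_two_inv_apply w
    apply sl_two_ext <;> simp only [sl_two_mul_apply, e1, e2, e3, e4, f1, f2, f3, f4, i1, i2, i3,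
      i4, hw00]
    · linear_combination -hdet
    · ring
    · field_simp
      ring
    · linear_combination -hdet
  rw [key]
  exact J.mul_mem (J.mul_mem hwJ (hu _)) (J.inv_mem hwJ)

theorem sq_stabChar_mul_mem {J : Subgroup SL(2, k)} (g : (borel k).subgroupOf J) {b : k}
    (hb : b ∈ translations J) : (stabChar J g : k) ^ 2 * b ∈ translations J := by
  rw [mem_translations] at hb ⊢
  have h1 : g.1.1 0 0 * g.1.1 1 1 = 1 := borel_mul_eq_one g.2
  have h2 : g.1.1 1 0 = 0 := mem_borel_iff.1 g.2
  have key : upperUnipotent ((stabChar J g : k) ^ 2 * b) = g.1.1 * upperUnipotent b * g.1.1⁻¹ := by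
    rw [stabChar_apply]
    obtain ⟨⟨e1, e2⟩, e3, e4⟩ := upperUnipotent_apply b
    obtain ⟨⟨f1, f2⟩, f3, f4⟩ := upperUnipotent_apply (g.1.1 0 0 ^ 2 * b)
    obtain ⟨⟨i1, i2⟩, i3, i4⟩ := sl_two_inv_apply g.1.1
    apply sl_two_ext <;> simp only [sl_two_mul_apply, e1, e2, e3, e4, f1, f2, f3, f4, i1, i2, i3,
      i4, h2]
    · linear_combination -h1
    · ring
    · ring
    · linear_combination -h1
  rw [key]
  exact J.mul_mem (J.mul_mem g.1.2 hb) (J.inv_mem g.1.2)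

/-- Conjugation by a diagonal part `a` multiplies translations by `a ^ 2`, so these squares lie in
the ring of multipliers of the translation group. If that ring were the whole field, the non-zero
translation group would be everything and `J` too. The factor `2` is the fibre size of squaring. -/
theorem card_range_stabChar_le [Finite k] {p n : ℕ} (hp : p.Prime) (hk : Nat.card k = p ^ n)
    {M : ℝ} (hM0 : 0 < M) (hM : AdmissibleNat M n) {J : Subgroup SL(2, k)} (hJ : J ≠ ⊤)
    (hA : translations J ≠ ⊥) {j : SL(2, k)} (hj : j ∈ J) (hjb : j ∉ borel k) :
    (Nat.card (stabChar J).range : ℝ) ≤ 2 * (p : ℝ) ^ (n / M : ℝ) := by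
  let S : Subring k :=
    { carrier := {c | ∀ b ∈ translations J, c * b ∈ translations J}
      mul_mem' := fun {x y} hx hy b hb => by
        rw [mul_assoc]
        exact hx _ (hy b hb)
      one_mem' := fun b hb => by rwa [one_mul]
      add_mem' := fun {x y} hx hy b hb => by
        rw [add_mul]
        exact add_mem (hx b hb) (hy b hb)
      zero_mem' := fun b _ => by
        rw [zero_mul]
        exact zero_mem _
      neg_mem' := fun {x} hx b hb => by
        rw [neg_mul]
        exact neg_mem (hx b hb) }
  have hS : S ≠ ⊤ := by
    intro h
    apply hJ
    refine eq_top_of_translations_eq_top ?_ hj hjb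
    obtain ⟨⟨b, hb⟩, hne⟩ := AddSubgroup.ne_bot_iff_exists_ne_zero.1 hA
    have hb0 : b ≠ 0 := fun h0 => hne (Subtype.ext h0)
    refine (AddSubgroup.eq_top_iff' _).2 fun c => ?_
    have hc : c / b ∈ S := by
      rw [h]
      trivial
    have := hc b hb
    rwa [div_mul_cancel₀ _ hb0] at this
  refine le_trans ?_ (mul_le_mul_of_nonneg_left (card_subring_le hp hk hM0 hM hS) zero_le_two)
  have := Fintype.ofFinite (stabChar J).range
  have := Fintype.ofFinite S
  let f : (stabChar J).range → S := fun a => ⟨(a.1 : k) ^ 2, fun b hb => by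
    obtain ⟨g, hg⟩ := a.2
    rw [← hg]
    exact sq_stabChar_mul_mem g hb⟩
  have hle := Finset.card_le_mul_card_image_of_maps_to
    (s := (Finset.univ : Finset (stabChar J).range)) (t := (Finset.univ : Finset S)) (f := f)
    (fun _ _ => Finset.mem_univ _) 2 fun s _ => by
      rcases (Finset.univ.filter fun a => f a = s).eq_empty_or_nonempty with he | ⟨a, ha⟩
      · rw [he]
        simp
      · have hinj : Function.Injective fun a : (stabChar J).range => (a.1 : k) := fun a b h =>
          Subtype.ext (Units.ext h)
        rw [← Finset.card_image_of_injective _ hinj]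
        refine (Finset.card_le_card (t := {(a.1 : k), -(a.1 : k)}) fun c hc => ?_).trans
          Finset.card_le_two
        obtain ⟨b, hb, rfl⟩ := Finset.mem_image.1 hc
        have h1 : f b = f a := ((Finset.mem_filter.1 hb).2).trans (Finset.mem_filter.1 ha).2.symm
        have h2 : (b.1 : k) ^ 2 = (a.1 : k) ^ 2 := congrArg Subtype.val h1
        rw [Finset.mem_insert, Finset.mem_singleton]
        exact sq_eq_sq_iff_eq_or_eq_neg.1 h2
  rw [Finset.card_univ, Finset.card_univ, ← Nat.card_eq_fintype_card,
    ← Nat.card_eq_fintype_card] at hle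
  exact_mod_cast hle

/-- Besides `∞` itself, the orbit contains all translates of the finite point `j • ∞`. -/
theorem card_translations_add_one_le [Finite k] {J : Subgroup SL(2, k)} {j : SL(2, k)}
    (hj : j ∈ J) (hjb : j ∉ borel k) :
    Nat.card (translations J) + 1 ≤ (MulAction.orbit J (OnePoint.infty : OnePoint k)).ncard := by
  have := Fintype.ofFinite k
  rw [mem_borel_iff] at hjb
  set y : k := j 0 0 / j 1 0 with hy
  have hjy : j • (OnePoint.infty : OnePoint k) = (y : OnePoint k) := by
    rw [sl_smul_infty, if_neg hjb]
  let f : Option (translations J) → OnePoint k := fun o =>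
    o.elim OnePoint.infty fun b => ((y + b.1 : k) : OnePoint k)
  have hf : Function.Injective f := by
    rintro (_ | a) (_ | b) h
    · rfl
    · exact absurd h (OnePoint.infty_ne_coe _)
    · exact absurd h (OnePoint.coe_ne_infty _)
    · have : y + a.1 = y + b.1 := OnePoint.coe_eq_coe.1 h
      rw [Subtype.ext (add_left_cancel this)]
  have hsub : Set.range f ⊆ MulAction.orbit J (OnePoint.infty : OnePoint k) := by
    rintro _ ⟨_ | b, rfl⟩
    · exact MulAction.mem_orbit_self _
    · refine ⟨⟨upperUnipotent b.1 * j, J.mul_mem b.2 hj⟩, ?_⟩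
      change (upperUnipotent b.1 * j) • (OnePoint.infty : OnePoint k) = _
      rw [mul_smul, hjy, upperUnipotent_smul_coe]
      rfl
  have hcard : (Set.range f).ncard = Nat.card (translations J) + 1 := by
    rw [← Set.image_univ, Set.ncard_image_of_injective _ hf, Set.ncard_univ, Finite.card_option]
  rw [← hcard]
  exact Set.ncard_le_ncard hsub (Set.toFinite _)

/-- The case of a large group of dilations at a parabolic fixed point. -/
theorem card_le_of_large_dilations [Finite k] {p n : ℕ} (hp : p.Prime) (hk : Nat.card k = p ^ n)
    {M : ℝ} (hM0 : 0 < M) (hM : AdmissibleNat M n) {J : Subgroup SL(2, k)} (hJ : J ≠ ⊤) {j : SL(2, k)} (hj : j ∈ J) (hjb : j ∉ borel k) {K : ℕ}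
    (hQ : 3 ≤ stabCount J OnePoint.infty (· = 2))
    (hQK : stabCount J OnePoint.infty (fun _ => True) =
      2 * (stabCount J OnePoint.infty (· = 2) * K))
    (hcard : Nat.card J < 12 * stabCount J OnePoint.infty (· = 2) * K ^ 2) :
    (Nat.card J : ℝ) ≤ 72 * (p : ℝ) ^ (3 * n / M : ℝ) := by
  have := Fintype.ofFinite k
  have horb := card_orbit_mul_stabCount J OnePoint.infty
  have hT := stabCount_infty_true J
  have hle := card_translations_add_one_le hj hjb
  rw [hQK] at horb hT
  rw [stabCount_infty_eq_two] at hQ horb hT hcard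
  set Q := Nat.card (translations J) with hQdef
  have hA : translations J ≠ ⊥ := by
    intro h
    rw [hQdef, h] at hQ
    simp at hQ
  have hR := card_range_stabChar_le hp hk hM0 hM hJ hA hj hjb
  have hRK : Nat.card (stabChar J).range = 2 * K := by
    have : Q * Nat.card (stabChar J).range = Q * (2 * K) := by rw [← hT]; ring
    exact Nat.eq_of_mul_eq_mul_left (by omega) this
  rw [hRK] at hR
  push_cast at hR
  have hKle : (K : ℝ) ≤ (p : ℝ) ^ (n / M : ℝ) := by linarith
  have h3 : (Q + 1) * (2 * (Q * K)) ≤ Nat.card J := by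
    rw [← horb]
    exact Nat.mul_le_mul_right _ hle
  have hKpos : 0 < K := by
    rcases Nat.eq_zero_or_pos K with h | h
    · rw [h] at hcard
      simp at hcard
    · exact h
  have h4 : Q + 1 < 6 * K := by
    have h5 : (2 * Q * K) * (Q + 1) < (2 * Q * K) * (6 * K) :=
      calc _ = (Q + 1) * (2 * (Q * K)) := by ring
        _ ≤ Nat.card J := h3
        _ < 12 * Q * K ^ 2 := hcard
        _ = _ := by ring
    exact lt_of_mul_lt_mul_left h5 (Nat.zero_le _)
  have h6 : Nat.card J ≤ 72 * K ^ 3 :=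
    calc Nat.card J ≤ 12 * Q * K ^ 2 := hcard.le
      _ ≤ 12 * (6 * K) * K ^ 2 := by gcongr; omega
      _ = 72 * K ^ 3 := by ring
  calc (Nat.card J : ℝ) ≤ 72 * (K : ℝ) ^ 3 := by exact_mod_cast h6
    _ ≤ 72 * ((p : ℝ) ^ (n / M : ℝ)) ^ 3 := by gcongr
    _ = 72 * (p : ℝ) ^ (3 * n / M : ℝ) := by
      rw [← Real.rpow_natCast, ← Real.rpow_mul (by positivity)]
      congr 2
      push_cast
      ring

variable {E : Type*} [Field E] [DecidableEq E] [Algebra k E]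

theorem sl_map_smul (g : SL(2, k)) (x : OnePoint k) :
    OnePoint.map (algebraMap k E) (g • x) =
      Matrix.SpecialLinearGroup.map (algebraMap k E) g • OnePoint.map (algebraMap k E) x := by
  change OnePoint.map (algebraMap k E) (Matrix.SpecialLinearGroup.toGL g • x) =
    Matrix.SpecialLinearGroup.toGL (Matrix.SpecialLinearGroup.map (algebraMap k E) g) • _
  rw [OnePoint.map_smul]
  congr 1
  ext i j
  simp

omit [DecidableEq k] [DecidableEq E] in
theorem onePoint_map_injective :
    Function.Injective (OnePoint.map (algebraMap k E) : OnePoint k → OnePoint E) :=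
  Option.map_injective (algebraMap k E).injective

omit [DecidableEq k] [DecidableEq E] in
theorem sl_map_injective :
    Function.Injective (Matrix.SpecialLinearGroup.map (n := Fin 2) (algebraMap k E)) := by
  intro g h hgh
  refine Matrix.SpecialLinearGroup.ext _ _ fun i j => (algebraMap k E).injective ?_
  exact congrArg (fun m : SL(2, E) => m i j) hgh

omit [DecidableEq k] [DecidableEq E] in
theorem trace_sl_map (g : SL(2, k)) :
    Matrix.trace (Matrix.SpecialLinearGroup.map (algebraMap k E) g).1 =
      algebraMap k E (Matrix.trace g.1) := by
  rw [Matrix.trace_fin_two, Matrix.trace_fin_two, map_add]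
  rfl

theorem stabCount_map (H : Subgroup SL(2, k)) (x : OnePoint k) (P : E → Prop) :
    stabCount (H.map (Matrix.SpecialLinearGroup.map (algebraMap k E)))
      (OnePoint.map (algebraMap k E) x) P = stabCount H x fun t => P (algebraMap k E t) := by
  symm
  refine Nat.card_congr ((H.equivMapOfInjective _ sl_map_injective).toEquiv.subtypeEquiv
    fun h => ?_)
  change _ ↔ Matrix.SpecialLinearGroup.map (algebraMap k E) h.1 • _ = _ ∧
    P (Matrix.trace (Matrix.SpecialLinearGroup.map (algebraMap k E) h.1).1)
  rw [← sl_map_smul, onePoint_map_injective.eq_iff, trace_sl_map]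

/-- The splitting field of the product of all polynomials `X ^ 2 - t X + 1` contains the eigenvalues
of every element of `SL₂(k)`. -/
theorem exists_finite_extension_splitting.{u} (k : Type u) [Field k] [Finite k] :
    ∃ (E : Type u) (_ : Field E) (_ : Fintype E) (_ : Algebra k E),
      ∀ t : k, ∃ r : E, r ^ 2 - algebraMap k E t * r + 1 = 0 := by
  classical
  have := Fintype.ofFinite k
  let f : k → k[X] := fun t => X ^ 2 - C t * X + 1
  have hdeg : ∀ t, (f t).degree = 2 := by
    intro t
    have h : f t = C 1 * X ^ 2 + C (-t) * X + C 1 := by simp [f]; ring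
    rw [h]
    exact degree_quadratic one_ne_zero
  have hf0 : ∏ t, f t ≠ 0 := Finset.prod_ne_zero_iff.2 fun t _ h => by
    have := hdeg t
    rw [h, degree_zero] at this
    exact absurd this (by decide)
  refine ⟨SplittingField (∏ t, f t), inferInstance, ?_, inferInstance, fun t => ?_⟩
  · have : Finite (SplittingField (∏ t, f t)) := Module.finite_of_finite k
    exact Fintype.ofFinite _
  · have hs := SplittingField.splits (∏ t, f t)
    have hdvd : (f t).map (algebraMap k (SplittingField (∏ t, f t))) ∣
        (∏ t, f t).map (algebraMap k _) :=
      Polynomial.map_dvd _ (Finset.dvd_prod_of_mem f (Finset.mem_univ t))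
    have hst := hs.of_dvd (Polynomial.map_ne_zero hf0) hdvd
    obtain ⟨r, hr⟩ := hst.exists_eval_eq_zero (by
      rw [degree_map, hdeg]
      decide)
    refine ⟨r, ?_⟩
    simpa [f, eval_map] using hr

end WeakDickson

/-! ### Metabelian subgroups of small index in proper subgroups -/

section MetabelianSubgroup

open scoped commutatorElement

/-- Double commutators of elements of `B` are trivial. -/
def MetabelianLaw {G : Type*} [Group G] (B : Subgroup G) : Prop :=
  ∀ a ∈ B, ∀ b ∈ B, ∀ c ∈ B, ∀ d ∈ B, ⁅⁅a, b⁆, ⁅c, d⁆⁆ = 1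

variable {k : Type*} [Field k]

theorem exists_upper_conj [DecidableEq k] {u : SL(2, k)} (hu : Matrix.trace u.1 = 2) :
    ∃ y : OnePoint k, u • y = y :=
  exists_fixed_point u (r := 1) (by rw [hu]; norm_num)

theorem exists_metabelian_subgroup_of_neg_one_mem [Finite k] {p n : ℕ} (hp : p.Prime)
    (hk : Nat.card k = p ^ n) (h2 : (2 : k) ≠ 0) {M : ℝ} (hM0 : 0 < M) (hM : AdmissibleNat M n)
    {H : Subgroup SL(2, k)} (hH1 : -1 ∈ H) (hH : H ≠ ⊤) :
    ∃ B ≤ H, MetabelianLaw B ∧ (B.relIndex H : ℝ) ≤ 120 * (p : ℝ) ^ (3 * n / M : ℝ) := by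
  classical
  obtain ⟨E, _, _, _, hE⟩ := exists_finite_extension_splitting k
  set ψ := Matrix.SpecialLinearGroup.map (n := Fin 2) (algebraMap k E) with hψ
  set H' := H.map ψ with hH'
  have hcardH : Nat.card H' = Nat.card H := Subgroup.card_map_of_injective sl_map_injective
  have hp1 : (1 : ℝ) ≤ (p : ℝ) ^ (3 * n / M : ℝ) :=
    Real.one_le_rpow (by exact_mod_cast hp.one_lt.le) (by positivity)
  have h2E : (2 : E) ≠ 0 := by
    rw [← map_ofNat (algebraMap k E) 2]
    exact (_root_.map_ne_zero _).2 h2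
  have hH1' : (-1 : SL(2, E)) ∈ H' := ⟨-1, hH1, by
    refine Matrix.SpecialLinearGroup.ext _ _ fun i j => ?_
    fin_cases i <;> fin_cases j <;> simp [hψ]⟩
  -- When `H` itself is small, the trivial subgroup serves.
  have hsmall : (Nat.card H : ℝ) ≤ 120 * (p : ℝ) ^ (3 * n / M : ℝ) →
      ∃ B ≤ H, MetabelianLaw B ∧ (B.relIndex H : ℝ) ≤ 120 * (p : ℝ) ^ (3 * n / M : ℝ) :=
    fun h => ⟨⊥, bot_le, fun a ha b hb c _ d _ => by
      rw [Subgroup.mem_bot.1 ha, Subgroup.mem_bot.1 hb]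
      simp, by rwa [Subgroup.relIndex_bot_left]⟩
  -- A stabiliser of index at most two serves, pulled back from `E` to `k`.
  have hpoint : ∀ x : OnePoint E, Nat.card H' ≤ 2 * stabCount H' x (fun _ => True) →
      ∃ B ≤ H, MetabelianLaw B ∧ (B.relIndex H : ℝ) ≤ 120 * (p : ℝ) ^ (3 * n / M : ℝ) := by
    intro x hx
    refine ⟨H ⊓ (MulAction.stabilizer SL(2, E) x).comap ψ, inf_le_left, ?_, ?_⟩
    · intro a ha b hb c hc d hd
      have key := stabilizer_metabelian x ha.2 hb.2 hc.2 hd.2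
      rw [← map_commutatorElement, ← map_commutatorElement, ← map_commutatorElement] at key
      exact (map_eq_one_iff ψ sl_map_injective).1 key
    · rw [Subgroup.inf_relIndex_left, Subgroup.relIndex_comap, ← hH']
      have h3 := card_orbit_mul_stabCount H' x
      have h4 : (MulAction.stabilizer SL(2, E) x).relIndex H' = (MulAction.orbit H' x).ncard := by
        rw [← MulAction.index_stabilizer]
        rfl
      rw [h4]
      have hpos : 0 < stabCount H' x (fun _ => True) := by
        have : 0 < Nat.card H' := Nat.card_pos
        omega
      have h5 : (MulAction.orbit H' x).ncard ≤ 2 := by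
        refine Nat.le_of_mul_le_mul_right ?_ hpos
        rw [h3]
        exact hx
      have h6 : ((MulAction.orbit H' x).ncard : ℝ) ≤ 2 := by exact_mod_cast h5
      linarith
  rcases exists_large_stabilizer h2E hH1' (fun h hh => by
    obtain ⟨g, -, rfl⟩ := hh
    obtain ⟨r, hr⟩ := hE (Matrix.trace g.1)
    exact ⟨r, by rwa [hψ, trace_sl_map]⟩) with ⟨x, hx⟩ | h120 | ⟨x, K, hQ, hQK, hcard⟩
  · exact hpoint x hx
  · apply hsmall
    have : (Nat.card H : ℝ) ≤ 120 := by
      rw [← hcardH]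
      exact_mod_cast h120
    linarith
  -- The parabolic fixed point must come from `k`, since the subring argument takes place in `k`,
  -- whose degree is admissible.
  · by_cases hx : ∃ y : OnePoint k, OnePoint.map (algebraMap k E) y = x
    · obtain ⟨y, rfl⟩ := hx
      obtain ⟨g, rfl⟩ := exists_smul_infty_eq y
      have h2iff : ∀ t : k, algebraMap k E t = 2 ↔ t = 2 := fun t => by
        rw [← map_ofNat (algebraMap k E) 2, (algebraMap k E).injective.eq_iff]
      rw [hcardH] at hcard
      by_cases hfix : ∀ h ∈ H, h • g • (OnePoint.infty : OnePoint k) = g • OnePoint.infty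
      · refine hpoint (OnePoint.map (algebraMap k E) (g • OnePoint.infty)) ?_
        have : stabCount H' (OnePoint.map (algebraMap k E) (g • OnePoint.infty)) (fun _ => True) =
            Nat.card H' := by
          rw [hH', hψ, stabCount_map, ← hψ, ← hH', hcardH]
          exact Nat.card_congr (Equiv.subtypeUnivEquiv fun h => ⟨hfix h.1 h.2, trivial⟩)
        omega
      · push Not at hfix
        obtain ⟨h₀, hh₀, hne⟩ := hfix
        simp only [hH', hψ, stabCount_map, stabCount_smul, h2iff] at hQ hQK hcard
        set J := H.map (MulAut.conj g⁻¹).toMonoidHom with hJ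
        have hcardJ : Nat.card J = Nat.card H :=
          Subgroup.card_map_of_injective (MulAut.conj g⁻¹).injective
        rw [← hcardJ] at hcard
        have hJtop : J ≠ ⊤ := by
          intro hc
          apply hH
          apply Subgroup.eq_top_of_card_eq
          rw [← hcardJ, hc, Subgroup.card_top]
        have hj : MulAut.conj g⁻¹ h₀ ∈ J := ⟨h₀, hh₀, rfl⟩
        have hjb : MulAut.conj g⁻¹ h₀ ∉ borel k := by
          rw [borel, MulAction.mem_stabilizer_iff, MulAut.conj_apply, inv_inv, mul_smul, mul_smul,
            inv_smul_eq_iff]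
          exact hne
        have hle := card_le_of_large_dilations hp hk hM0 hM hJtop hj hjb hQ hQK hcard
        apply hsmall
        rw [← hcardJ]
        linarith
    -- As `Q ≥ 3`, some non-trivial unipotent of `H` fixes `x`. Its eigenvalue `1` lies in `k`, so
    -- it has a fixed point over `k`; a non-central parabolic element has only one fixed point,
    -- which is therefore `x`.
    · exfalso
      apply hx
      have : Nontrivial {h : H' // h.1 • x = x ∧ Matrix.trace h.1.1 = 2} := by
        rw [← Finite.one_lt_card_iff_nontrivial]
        exact lt_of_lt_of_le (by norm_num) hQ
      obtain ⟨⟨⟨_, ⟨u, hu, rfl⟩⟩, hux, hut⟩, hne⟩ :=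
        exists_ne (⟨1, one_smul _ _, by simp⟩ :
          {h : H' // h.1 • x = x ∧ Matrix.trace h.1.1 = 2})
      have hu1 : ψ u ≠ 1 := fun hc => hne (Subtype.ext (Subtype.ext hc))
      have hut' : Matrix.trace (ψ u).1 = 2 := hut
      have hu1' : ψ u ≠ -1 := by
        intro hc
        rw [hc] at hut'
        simp only [Matrix.SpecialLinearGroup.coe_neg, Matrix.SpecialLinearGroup.coe_one,
          Matrix.trace_neg, Matrix.trace_one, Fintype.card_fin, Nat.cast_ofNat] at hut'
        have h4 : (2 : E) * 2 = 0 := by linear_combination -hut'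
        exact h2E (mul_self_eq_zero.1 h4)
      rw [hψ, trace_sl_map, ← map_ofNat (algebraMap k E) 2,
        (algebraMap k E).injective.eq_iff] at hut'
      obtain ⟨y, hy⟩ := exists_upper_conj hut'
      refine ⟨y, ?_⟩
      have hy' : ψ u • OnePoint.map (algebraMap k E) y = OnePoint.map (algebraMap k E) y := by
        rw [hψ, ← sl_map_smul, hy]
      have hut4 : Matrix.trace (ψ u).1 ^ 2 = 4 := by
        rw [show Matrix.trace (ψ u).1 = 2 from hut]
        norm_num
      obtain ⟨g, rfl⟩ := exists_smul_infty_eq x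
      set j := g⁻¹ * ψ u * g with hj
      have hjs : ∀ z : OnePoint E, ψ u • g • z = g • z ↔ j • z = z := fun z => by
        rw [hj, mul_smul, mul_smul, inv_smul_eq_iff]
      have hj1 : j ≠ 1 := fun hc => hu1 (by
        rw [show ψ u = g * j * g⁻¹ by rw [hj]; group, hc]; group)
      have hj1' : j ≠ -1 := fun hc => hu1' (by
        rw [show ψ u = g * j * g⁻¹ by rw [hj]; group, hc]; simp)
      have hjb : j ∈ borel E := (hjs _).1 hux
      have huniq := (fixed_points_of_upper hj1 hj1' hjb).1 (by rwa [hj, trace_conj])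
      have h5 := huniq (g⁻¹ • OnePoint.map (algebraMap k E) y)
      rw [← hjs, smul_inv_smul] at h5
      rw [← h5.1 hy', smul_inv_smul]

/-- Each elementary unipotent is the square of the one with half its parameter, and these generate.
-/
theorem eq_top_of_sq_mem (h2 : (2 : k) ≠ 0) {H : Subgroup SL(2, k)}
    (h : ∀ g, g ^ 2 ∈ H) : H = ⊤ := by
  refine eq_top_of_unipotent_mem (fun b => ?_) fun b => ?_
  · have := h (upperUnipotent (b / 2))
    rwa [pow_two, ← upperUnipotent_add, show b / 2 + b / 2 = b by field_simp; ring] at this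
  · have := h (lowerUnipotent (b / 2))
    rwa [show lowerUnipotent (b / 2) ^ 2 = lowerUnipotent b from ?_] at this
    obtain ⟨⟨e1, e2⟩, e3, e4⟩ := lowerUnipotent_apply (b / 2)
    obtain ⟨⟨f1, f2⟩, f3, f4⟩ := lowerUnipotent_apply b
    rw [pow_two]
    apply sl_two_ext <;> simp only [sl_two_mul_apply, *]
    · ring
    · ring
    · field_simp
      ring
    · ring

/-- A proper subgroup of `SL(2, p ^ n)`, where `n` has no small prime factor, has a subgroup of
small index satisfying the metabelian law. -/
theorem exists_metabelian_subgroup [Finite k] {p n : ℕ} (hp : p.Prime)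
    (hk : Nat.card k = p ^ n) (h2 : (2 : k) ≠ 0) {M : ℝ} (hM0 : 0 < M) (hM : AdmissibleNat M n)
    {H : Subgroup SL(2, k)} (hH : H ≠ ⊤) :
    ∃ B : Subgroup SL(2, k), MetabelianLaw B ∧ B.relIndex H ≠ 0 ∧
      (B.relIndex H : ℝ) ≤ 120 * (p : ℝ) ^ (3 * n / M : ℝ) := by
  -- The orbit count needs `-1`, so `H` is enlarged to `H ∪ -H`. This is still proper: otherwise all
  -- squares would lie in `H`.
  let H' : Subgroup SL(2, k) :=
    { carrier := {g | g ∈ H ∨ -g ∈ H}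
      one_mem' := Or.inl H.one_mem
      mul_mem' := fun {a b} ha hb => by
        rcases ha with ha | ha <;> rcases hb with hb | hb
        · exact Or.inl (H.mul_mem ha hb)
        · exact Or.inr (by simpa using H.mul_mem ha hb)
        · exact Or.inr (by simpa using H.mul_mem ha hb)
        · exact Or.inl (by simpa using H.mul_mem ha hb)
      inv_mem' := fun {a} ha => by
        rcases ha with ha | ha
        · exact Or.inl (H.inv_mem ha)
        · exact Or.inr (by
            have := H.inv_mem ha
            rwa [show (-a)⁻¹ = -a⁻¹ from ?_] at this
            rw [inv_eq_iff_mul_eq_one]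
            simp) }
  have hle : H ≤ H' := fun g hg => Or.inl hg
  have hH' : H' ≠ ⊤ := by
    intro hc
    refine hH (eq_top_of_sq_mem h2 fun g => ?_)
    have hg : g ∈ H' := hc ▸ Subgroup.mem_top g
    rcases hg with hg | hg
    · exact H.pow_mem hg 2
    · simpa using H.pow_mem hg 2
  obtain ⟨B, -, hB, hBi⟩ := exists_metabelian_subgroup_of_neg_one_mem hp hk h2 hM0 hM
    (H := H') (Or.inr (by simp)) hH'
  have hne : B.relIndex H' ≠ 0 := by
    rw [Subgroup.relIndex]
    exact Subgroup.index_ne_zero_of_finite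
  refine ⟨B, hB, ?_, ?_⟩
  · rw [Subgroup.relIndex]
    exact Subgroup.index_ne_zero_of_finite
  · refine le_trans ?_ hBi
    exact_mod_cast Subgroup.relIndex_le_of_le_right hle hne

end MetabelianSubgroup

/-! ### Independence of several surjections onto `SL₂` -/

section Goursat

open scoped commutatorElement

/-- In a perfect target it suffices to hit commutators. If `a` is killed by all maps in `t` and `b`
by `φ j`, then `⁅a, b⁆` is killed by all of them, so pairwise independence propagates to joint
kernels. The prescribed values are then attained one coordinate at a time. -/
theorem exists_joint_preimage {Γ ι : Type*} [Group Γ] [DecidableEq ι] {G : ι → Type*}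
    [∀ i, Group (G i)] (φ : ∀ i, Γ →* G i) (hperf : ∀ i, commutator (G i) = ⊤) (s : Finset ι)
    (hsurj : ∀ i ∈ s, Function.Surjective (φ i))
    (hpair : ∀ i ∈ s, ∀ j ∈ s, i ≠ j → (φ j).ker.map (φ i) = ⊤) (g : ∀ i, G i) :
    ∃ γ : Γ, ∀ i ∈ s, φ i γ = g i := by
  have key : ∀ i ∈ s, ∀ t ⊆ s, i ∉ t → (⨅ j ∈ t, (φ j).ker).map (φ i) = ⊤ := by
    intro i hi t
    induction t using Finset.induction_on with
    | empty =>
      intro _ _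
      simpa [← MonoidHom.range_eq_map] using MonoidHom.range_eq_top.2 (hsurj i hi)
    | insert j t hjt ih =>
      intro hts hit
      rw [Finset.mem_insert, not_or] at hit
      have h1 := ih ((Finset.subset_insert j t).trans hts) hit.2
      have h2 := hpair i hi j (hts (Finset.mem_insert_self j t)) hit.1
      rw [eq_top_iff, ← hperf i, commutator_def, Subgroup.commutator_le]
      intro x _ y _
      obtain ⟨a, ha, rfl⟩ : x ∈ (⨅ j ∈ t, (φ j).ker).map (φ i) := h1 ▸ Subgroup.mem_top x
      obtain ⟨b, hb, rfl⟩ : y ∈ (φ j).ker.map (φ i) := h2 ▸ Subgroup.mem_top y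
      refine ⟨⁅a, b⁆, ?_, map_commutatorElement _ _ _⟩
      simp only [Subgroup.coe_iInf, Set.mem_iInter, SetLike.mem_coe, MonoidHom.mem_ker] at ha ⊢
      rw [SetLike.mem_coe, MonoidHom.mem_ker] at hb
      intro l hl
      rw [map_commutatorElement]
      rcases Finset.mem_insert.1 hl with rfl | hl
      · rw [hb, commutatorElement_one_right]
      · rw [ha l hl, commutatorElement_one_left]
  have main : ∀ t ⊆ s, ∃ γ : Γ, ∀ i ∈ t, φ i γ = g i := by
    intro t
    induction t using Finset.induction_on with
    | empty => exact fun _ => ⟨1, by simp⟩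
    | insert i t hit ih =>
      intro hts
      have hts' := (Finset.subset_insert i t).trans hts
      obtain ⟨γ, hγ⟩ := ih hts'
      obtain ⟨δ, hδ, hδ'⟩ : (φ i γ)⁻¹ * g i ∈ (⨅ j ∈ t, (φ j).ker).map (φ i) :=
        key i (hts (Finset.mem_insert_self i t)) t hts' hit ▸ Subgroup.mem_top _
      simp only [Subgroup.coe_iInf, Set.mem_iInter, SetLike.mem_coe, MonoidHom.mem_ker] at hδ
      refine ⟨γ * δ, fun j hj => ?_⟩
      rcases Finset.mem_insert.1 hj with rfl | hj
      · rw [map_mul, hδ', mul_inv_cancel_left]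
      · rw [map_mul, hδ j hj, mul_one, hγ j hj]
  exact main s subset_rfl

variable {k : Type*} [Field k]

theorem exists_ne_zero_sq_ne_one (hk : 4 ≤ Nat.card k) : ∃ a : k, a ≠ 0 ∧ a ^ 2 ≠ 1 := by
  classical
  have : Finite k := (Nat.card_pos_iff.1 (by omega)).2
  have := Fintype.ofFinite k
  rw [Nat.card_eq_fintype_card] at hk
  obtain ⟨a, -, ha⟩ : ∃ a ∈ (Finset.univ : Finset k), a ∉ ({0, 1, -1} : Finset k) :=
    Finset.exists_mem_notMem_of_card_lt_card
      (lt_of_le_of_lt Finset.card_le_three (by rwa [Finset.card_univ]))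
  simp only [Finset.mem_insert, Finset.mem_singleton, not_or] at ha
  exact ⟨a, ha.1, fun h => (sq_eq_one_iff.1 h).elim ha.2.1 ha.2.2⟩

theorem commutator_sl_two_eq_top (hk : 4 ≤ Nat.card k) : commutator SL(2, k) = ⊤ := by
  obtain ⟨a, ha, ha2⟩ := exists_ne_zero_sq_ne_one hk
  exact Matrix.SL2.commutator_eq_top ha ha2

/-- The image in the simple group `PSL₂` is trivial or everything. In the latter case `N` and the
centre generate, and perfectness of `SL₂` removes the abelian centre. -/
theorem normal_subgroup_sl_two (hk : 4 ≤ Nat.card k) (N : Subgroup SL(2, k)) [N.Normal] :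
    N ≤ Subgroup.center SL(2, k) ∨ N = ⊤ := by
  have := Matrix.ProjectiveSpecialLinearGroup.rank_two_simple hk
  let mk := QuotientGroup.mk' (Subgroup.center SL(2, k))
  have hn : (N.map mk).Normal := Subgroup.Normal.map ‹_› _ (QuotientGroup.mk'_surjective _)
  have hn' : (N.map mk = ⊥) ∨ (N.map mk = ⊤) := Subgroup.Normal.eq_bot_or_eq_top
    (G := Matrix.ProjectiveSpecialLinearGroup (Fin 2) k) hn
  rcases hn' with h | h
  · left
    rw [Subgroup.map_eq_bot_iff] at h
    exact h.trans_eq (QuotientGroup.ker_mk' _)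
  · right
    have hsup : N ⊔ Subgroup.center SL(2, k) = ⊤ := by
      have h1 := congrArg (Subgroup.comap mk) h
      rwa [Subgroup.comap_map_eq, QuotientGroup.ker_mk', Subgroup.comap_top] at h1
    rw [eq_top_iff, ← commutator_sl_two_eq_top hk]
    exact Subgroup.Normal.commutator_le_of_self_sup_commutative_eq_top hsup inferInstance

theorem card_center_sl_two_le [Finite k] : Nat.card (Subgroup.center SL(2, k)) ≤ 2 := by
  rw [Nat.card_congr (Matrix.SpecialLinearGroup.center_equiv_rootsOfUnity (n := Fin 2)
    (R := k)).toEquiv, Fintype.card_fin]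
  exact card_rootsOfUnity k 2

theorem not_dvd_card_of_le_center [Finite k] {p : ℕ} (hp3 : 3 ≤ p) {N : Subgroup SL(2, k)}
    (hN : N ≤ Subgroup.center SL(2, k)) : ¬ p ∣ Nat.card N := fun hdvd => by
  have h5 : Nat.card N ≤ 2 := (Subgroup.card_le_of_le hN).trans card_center_sl_two_le
  have h6 := Nat.le_of_dvd Nat.card_pos hdvd
  omega

/-- The order is `(q + 1) * q` times the order of a group of units, with `q = p ^ n`. The `p`-part
therefore determines `n`. -/
theorem card_sl_two [Finite k] {p n : ℕ} (hp : p.Prime) (hn : n ≠ 0) (hk : Nat.card k = p ^ n) :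
    ∃ m, Nat.card SL(2, k) = p ^ n * m ∧ ¬ p ∣ m := by
  classical
  have := Fintype.ofFinite k
  have h1 := card_orbit_mul_stabCount (⊤ : Subgroup SL(2, k)) OnePoint.infty
  have horb : MulAction.orbit (⊤ : Subgroup SL(2, k)) (OnePoint.infty : OnePoint k) = Set.univ := by
    refine Set.eq_univ_of_forall fun x => ?_
    obtain ⟨g, hg⟩ := exists_smul_infty_eq x
    exact ⟨⟨g, trivial⟩, hg⟩
  have htr : translations (⊤ : Subgroup SL(2, k)) = ⊤ := by
    ext b
    simp [mem_translations]
  rw [horb, Set.ncard_univ, stabCount_infty_true, htr, AddSubgroup.card_top, Subgroup.card_top,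
    show Nat.card (OnePoint k) = Nat.card k + 1 from Finite.card_option, hk] at h1
  refine ⟨(p ^ n + 1) * Nat.card (stabChar (⊤ : Subgroup SL(2, k))).range, ?_, ?_⟩
  · rw [← h1]
    ring
  · rw [hp.dvd_mul, not_or]
    have hpn : p ∣ p ^ n := dvd_pow_self p hn
    have h3 : 1 ≤ p ^ n := Nat.one_le_pow _ _ hp.pos
    constructor
    · intro h
      exact hp.one_lt.ne' (Nat.dvd_one.1 ((Nat.dvd_add_right hpn).1 h))
    · intro h
      have h2 := h.trans (Subgroup.card_subgroup_dvd_card _)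
      rw [Nat.card_units, hk] at h2
      have h4 := Nat.dvd_sub hpn h2
      rw [Nat.sub_sub_self h3] at h4
      exact hp.one_lt.ne' (Nat.dvd_one.1 h4)

theorem card_map_ker_mul {Γ G₁ G₂ : Type*} [Group Γ] [Finite Γ] [Group G₁] [Group G₂]
    (φ₁ : Γ →* G₁) (φ₂ : Γ →* G₂) (h₂ : Function.Surjective φ₂) :
    Nat.card G₂ * (Nat.card (φ₂.ker.map φ₁) * Nat.card (φ₁.ker ⊓ φ₂.ker : Subgroup Γ)) =
      Nat.card Γ := by
  have h3 : Nat.card (φ₂.ker.map φ₁) * Nat.card (φ₁.ker ⊓ φ₂.ker : Subgroup Γ) =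
      Nat.card φ₂.ker := by
    let f := φ₁.comp φ₂.ker.subtype
    have hr : f.range = φ₂.ker.map φ₁ := by
      rw [MonoidHom.range_comp, Subgroup.range_subtype]
    have hk : Nat.card f.ker = Nat.card (φ₁.ker ⊓ φ₂.ker : Subgroup Γ) := by
      refine Nat.card_congr ((Equiv.subtypeSubtypeEquivSubtypeInter (fun g => g ∈ φ₂.ker)
        (fun g => g ∈ φ₁.ker)).trans (Equiv.subtypeEquivRight fun g => ?_))
      rw [Subgroup.mem_inf, and_comm]
    rw [← hk, ← hr, ← Subgroup.index_ker, mul_comm, Subgroup.card_mul_index]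
  rw [h3, mul_comm]
  have h4 : φ₂.ker.index = Nat.card G₂ := by
    rw [Subgroup.index_ker, MonoidHom.range_eq_top.2 h₂, Subgroup.card_top]
  rw [← h4, Subgroup.card_mul_index]

/-- Surjections of a finite group onto `SL(2)` over fields of the same characteristic and of
different orders are independent. -/
theorem map_ker_eq_top {Γ : Type*} [Group Γ] [Finite Γ] {k₁ k₂ : Type*} [Field k₁] [Field k₂]
    [Finite k₁] [Finite k₂] {p n₁ n₂ : ℕ} (hp : p.Prime) (hp3 : 3 ≤ p) (hn₁ : 2 ≤ n₁)
    (hn₂ : 2 ≤ n₂) (hk₁ : Nat.card k₁ = p ^ n₁) (hk₂ : Nat.card k₂ = p ^ n₂) (hn : n₁ ≠ n₂)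
    (φ₁ : Γ →* SL(2, k₁)) (φ₂ : Γ →* SL(2, k₂)) (h₁ : Function.Surjective φ₁)
    (h₂ : Function.Surjective φ₂) : φ₂.ker.map φ₁ = ⊤ := by
  have four_le : ∀ {n}, 2 ≤ n → 4 ≤ p ^ n := fun {n} hn =>
    calc 4 ≤ 3 ^ 2 := by norm_num
      _ ≤ p ^ 2 := Nat.pow_le_pow_left hp3 2
      _ ≤ p ^ n := Nat.pow_le_pow_right hp.pos hn
  have e1 := card_map_ker_mul φ₁ φ₂ h₂
  have e2 := card_map_ker_mul φ₂ φ₁ h₁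
  rw [inf_comm] at e2
  have hKpos : 0 < Nat.card (φ₁.ker ⊓ φ₂.ker : Subgroup Γ) := Nat.card_pos
  have e3 : Nat.card SL(2, k₂) * Nat.card (φ₂.ker.map φ₁) =
      Nat.card SL(2, k₁) * Nat.card (φ₁.ker.map φ₂) := by
    refine Nat.eq_of_mul_eq_mul_right hKpos ?_
    rw [mul_assoc, mul_assoc, e1, e2]
  have hN1 : (φ₂.ker.map φ₁).Normal := Subgroup.Normal.map inferInstance _ h₁
  have hN2 : (φ₁.ker.map φ₂).Normal := Subgroup.Normal.map inferInstance _ h₂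
  rcases normal_subgroup_sl_two (hk₁ ▸ four_le hn₁) (φ₂.ker.map φ₁) with hc1 | hc1
  · rcases normal_subgroup_sl_two (hk₂ ▸ four_le hn₂) (φ₁.ker.map φ₂) with hc2 | hc2
    -- Both images are central, of order prime to `p`; comparing `p`-parts in `e3` forces `n₁ = n₂`.
    · exfalso
      obtain ⟨m₁, hm₁, hpm₁⟩ := card_sl_two hp (by omega) hk₁
      obtain ⟨m₂, hm₂, hpm₂⟩ := card_sl_two hp (by omega) hk₂
      rw [hm₁, hm₂, mul_assoc, mul_assoc] at e3
      have cop : ∀ {a b n : ℕ}, ¬ p ∣ a → ¬ p ∣ b → Nat.Coprime (p ^ n) (a * b) :=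
        fun {a b n} ha hb => Nat.Coprime.pow_left n (Nat.Coprime.mul_right
          ((Nat.Prime.coprime_iff_not_dvd hp).2 ha) ((Nat.Prime.coprime_iff_not_dvd hp).2 hb))
      have d1 : p ^ n₂ ∣ p ^ n₁ := (cop hpm₁ (not_dvd_card_of_le_center hp3 hc2)).dvd_of_dvd_mul_right
        (e3 ▸ dvd_mul_right _ _)
      have d2 : p ^ n₁ ∣ p ^ n₂ := (cop hpm₂ (not_dvd_card_of_le_center hp3 hc1)).dvd_of_dvd_mul_right
        (e3 ▸ dvd_mul_right _ _)
      exact hn (Nat.pow_right_injective hp.two_le (Nat.dvd_antisymm d2 d1))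
    · rw [hc2, Subgroup.card_top, mul_comm] at e3
      exact Subgroup.eq_top_of_card_eq _ (Nat.eq_of_mul_eq_mul_right Nat.card_pos e3)
  · exact hc1

end Goursat

/-! ### Mass of a subgroup containing a subgroup with trivial short double commutators -/

section Escape

open scoped commutatorElement

variable {X : Type*} [DecidableEq X]

theorem mass_convPow_le [Fintype X] {Γ : Type*} [Group Γ] (hX : 2 ≤ Fintype.card X)
    (φ : FreeGroup X →* Γ) (hφ : Function.Injective (φ ∘ letter)) (H : Subgroup Γ)
    {B : Subgroup (FreeGroup X)} (hB : B.relIndex (H.comap φ) ≠ 0) (L : ℕ)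
    (h : ∀ a ∈ B, ∀ b ∈ B, ∀ c ∈ B, ∀ d ∈ B, a.norm ≤ 2 * L → b.norm ≤ 2 * L → c.norm ≤ 2 * L →
      d.norm ≤ 2 * L → ⁅⁅a, b⁆, ⁅c, d⁆⁆ = 1) :
    mass (convPow (mu (Set.range (φ ∘ letter))) L) (H : Set Γ) ≤
      B.relIndex (H.comap φ) * ((16 * L + 1) * (8 * L + 1)) * (7 / 8 : ℝ) ^ L := by
  rw [mass_convPow_mu hφ, ← map_one φ, ← stepAvg_comp_hom]
  exact iterate_stepAvg_letter_subgroup_le hX hB L h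

theorem norm_double_commutator_le {a b c d : FreeGroup X} {n : ℕ} (ha : a.norm ≤ n)
    (hb : b.norm ≤ n) (hc : c.norm ≤ n) (hd : d.norm ≤ n) :
    ⁅⁅a, b⁆, ⁅c, d⁆⁆.norm ≤ 16 * n := by
  have h1 := norm_commutatorElement_le a b
  have h2 := norm_commutatorElement_le c d
  have h3 := norm_commutatorElement_le ⁅a, b⁆ ⁅c, d⁆
  omega

end Escape

/-! ### Choice of the constants -/

section Numerics

theorem exists_quadratic_mul_pow_le :
    ∃ C₀ : ℝ, 1 ≤ C₀ ∧ ∀ l : ℕ, ((32 * l + 1) * (16 * l + 1)) * (7 / 8 : ℝ) ^ l ≤ C₀ := by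
  have key : ∀ j : ℕ, ∃ C : ℝ, ∀ l : ℕ, (l : ℝ) ^ j * (7 / 8) ^ l ≤ C := fun j => by
    obtain ⟨C, hC⟩ := (tendsto_pow_const_mul_const_pow_of_lt_one j (r := (7 / 8 : ℝ))
      (by norm_num) (by norm_num)).bddAbove_range
    exact ⟨C, fun l => hC ⟨l, rfl⟩⟩
  obtain ⟨C₂, h₂⟩ := key 2
  obtain ⟨C₁, h₁⟩ := key 1
  obtain ⟨C₀, h₀⟩ := key 0
  refine ⟨512 * C₂ + 48 * C₁ + C₀, ?_, fun l => ?_⟩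
  · have e₂ := h₂ 0
    have e₁ := h₁ 0
    have e₀ := h₀ 0
    norm_num at e₂ e₁ e₀
    linarith
  · have e₂ := h₂ l
    have e₁ := h₁ l
    have e₀ := h₀ l
    linarith

/-- One factor `(7/8)^l` absorbs the quadratic polynomial up to a constant `C₀`; the other is at
most `exp (-δ x)`. For large `M`, both `c` and `C₀` are at most `exp (δ x / 4)`, leaving `exp (-δ x
/ 2)`, which is the right-hand side for `γ = δ / (2 log w)`. -/
theorem exists_escape_parameters {A b w : ℝ} (hA : 0 < A) (hb : 1 ≤ b) (hw : 1 < w) :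
    ∃ M γ : ℝ, 1 ≤ M ∧ 0 < γ ∧ ∀ x : ℝ, M ≤ x → ∀ c : ℝ, c ≤ b ^ (x / M) →
      ∀ l : ℕ, l = ⌊x / (64 * A)⌋₊ →
        c * ((16 * (2 * l : ℕ) + 1) * (8 * (2 * l : ℕ) + 1)) * (7 / 8 : ℝ) ^ (2 * l) ≤
          (w ^ x) ^ (-γ) := by
  obtain ⟨C₀, hC₀, hbound⟩ := exists_quadratic_mul_pow_le
  have hlog : 0 < Real.log (8 / 7) := Real.log_pos (by norm_num)
  obtain ⟨δ, hδ⟩ : ∃ δ, δ = Real.log (8 / 7) / (128 * A) := ⟨_, rfl⟩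
  have hδ0 : 0 < δ := hδ ▸ by positivity
  have hw' : 0 < Real.log w := Real.log_pos hw
  -- The term `128 * A` ensures that rounding down `x / (64 * A)` loses at most half of it; the last
  -- two terms control `b ^ (x / M)` and `C₀`.
  obtain ⟨M, hM⟩ : ∃ M, M = max (max 1 (128 * A)) (max (4 * Real.log b / δ)
    (4 * Real.log C₀ / δ)) := ⟨_, rfl⟩
  have hM1 : 1 ≤ M := hM ▸ (le_max_left _ _).trans (le_max_left _ _)
  have hM2 : 128 * A ≤ M := hM ▸ (le_max_right _ _).trans (le_max_left _ _)
  have hM3 : 4 * Real.log b / δ ≤ M := hM ▸ (le_max_left _ _).trans (le_max_right _ _)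
  have hM4 : 4 * Real.log C₀ / δ ≤ M := hM ▸ (le_max_right _ _).trans (le_max_right _ _)
  rw [div_le_iff₀ hδ0] at hM3 hM4
  refine ⟨M, δ / (2 * Real.log w), hM1, by positivity, fun x hx c hc l hl => ?_⟩
  have hM0 : 0 < M := by linarith
  have hx0 : 0 < x := by linarith
  have hl1 : x / (128 * A) ≤ l := by
    have h1 := Nat.lt_floor_add_one (x / (64 * A))
    rw [← hl] at h1
    have h2 : 1 ≤ x / (128 * A) := (one_le_div (by positivity)).2 (by linarith)
    have h3 : x / (64 * A) = 2 * (x / (128 * A)) := by field_simp; norm_num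
    linarith
  have hpow : (7 / 8 : ℝ) ^ l ≤ Real.exp (-(δ * x)) := by
    rw [← Real.rpow_natCast, Real.rpow_def_of_pos (by norm_num), Real.exp_le_exp]
    have h1 : Real.log (7 / 8) = -Real.log (8 / 7) := by
      rw [← Real.log_inv]
      norm_num
    have h2 : δ * x = Real.log (8 / 7) * (x / (128 * A)) := by rw [hδ]; ring
    rw [h1, h2, neg_mul]
    exact neg_le_neg (mul_le_mul_of_nonneg_left hl1 hlog.le)
  have hbx : b ^ (x / M) ≤ Real.exp (δ * x / 4) := by
    rw [Real.rpow_def_of_pos (by linarith), Real.exp_le_exp, ← mul_div_assoc, div_le_iff₀ hM0]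
    nlinarith
  have hCx : C₀ ≤ Real.exp (δ * x / 4) := by
    rw [← Real.log_le_iff_le_exp (by linarith)]
    nlinarith
  have hrhs : (w ^ x) ^ (-(δ / (2 * Real.log w))) =
      Real.exp (δ * x / 4) * Real.exp (δ * x / 4) * Real.exp (-(δ * x)) := by
    rw [← Real.rpow_mul (by linarith), Real.rpow_def_of_pos (by linarith), ← Real.exp_add,
      ← Real.exp_add]
    congr 1
    field_simp
    ring
  rw [hrhs]
  calc c * ((16 * (2 * l : ℕ) + 1) * (8 * (2 * l : ℕ) + 1)) * (7 / 8 : ℝ) ^ (2 * l)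
      = c * (((32 * l + 1) * (16 * l + 1)) * (7 / 8 : ℝ) ^ l) * (7 / 8 : ℝ) ^ l := by
        push_cast
        ring
    _ ≤ Real.exp (δ * x / 4) * Real.exp (δ * x / 4) * Real.exp (-(δ * x)) := by
        refine mul_le_mul ?_ hpow (by positivity) (by positivity)
        exact mul_le_mul (hc.trans hbx) ((hbound l).trans hCx) (by positivity) (by positivity)

end Numerics

/-! ### Symmetric sets as images of letters, and girth -/

section Letters

open scoped commutatorElement

/-- A walk of length `2l` compares elements of length up to `4l` in a coset, and double commutators
multiply length by at most `16`, whence `64 * l`. -/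
theorem mass_convPow_le_of_law {X : Type*} [DecidableEq X] [Fintype X] {Γ : Type*} [Group Γ]
    (hX : 2 ≤ Fintype.card X) (φ : FreeGroup X →* Γ) (hφ : Function.Injective (φ ∘ letter))
    (H : Subgroup Γ) {B : Subgroup (FreeGroup X)} (hB : B.relIndex (H.comap φ) ≠ 0) (l : ℕ)
    (h : ∀ a ∈ B, ∀ b ∈ B, ∀ c ∈ B, ∀ d ∈ B, ⁅⁅a, b⁆, ⁅c, d⁆⁆.norm ≤ 64 * l →
      ⁅⁅a, b⁆, ⁅c, d⁆⁆ = 1) :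
    mass (convPow (mu (Set.range (φ ∘ letter))) (2 * l)) (H : Set Γ) ≤
      B.relIndex (H.comap φ) * ((16 * (2 * l : ℕ) + 1) * (8 * (2 * l : ℕ) + 1)) *
        (7 / 8 : ℝ) ^ (2 * l) :=
  mass_convPow_le hX φ hφ H hB (2 * l) fun a ha b hb c hc d hd na nb nc nd =>
    h a ha b hb c hc d hd ((norm_double_commutator_le na nb nc nd).trans (by omega))

variable {G : Type*} [Group G]

theorem lift_letter {α : Type*} (e : α → G) (a : α × Bool) :
    FreeGroup.lift e (letter a) = if a.2 then e a.1 else (e a.1)⁻¹ := by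
  rcases a with ⟨x, _ | _⟩ <;> simp [letter]

theorem range_lift_letter (X : Set G) :
    Set.range (FreeGroup.lift ((↑) : X → G) ∘ letter) = X ∪ X⁻¹ := by
  ext g
  simp only [Set.mem_range, Function.comp_apply, lift_letter, Prod.exists, Subtype.exists,
    Bool.exists_bool, Set.mem_union, Set.mem_inv]
  constructor
  · rintro ⟨x, hx, h | h⟩
    · right
      simp only [Bool.false_eq_true, if_false] at h
      rwa [← h, inv_inv]
    · left
      simp only [if_true] at h
      rwa [← h]
  · rintro (h | h)
    · exact ⟨g, h, Or.inr (by simp)⟩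
    · exact ⟨g⁻¹, h, Or.inl (by simp)⟩

theorem lift_letter_injective {X : Set G} (hX : ∀ x ∈ X, x⁻¹ ∉ X) :
    Function.Injective (FreeGroup.lift ((↑) : X → G) ∘ letter) := by
  rintro ⟨⟨x, hx⟩, _ | _⟩ ⟨⟨y, hy⟩, _ | _⟩ h <;>
    simp only [Function.comp_apply, lift_letter, Bool.false_eq_true, if_false, if_true] at h
  · simpa using h
  · exact absurd (h ▸ hy) (hX x hx)
  · exact absurd (h ▸ hx) (hX y hy)
  · simpa using h

/-- One element of each pair `s, s⁻¹` is selected, namely the one with the smaller code under an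
injection into `ℕ`. -/
theorem exists_orientation [Countable G] {S : Set G} (hS : S⁻¹ = S) (h : ∀ s ∈ S, s ≠ s⁻¹) :
    ∃ X : Set G, X ∪ X⁻¹ = S ∧ ∀ x ∈ X, x⁻¹ ∉ X := by
  obtain ⟨e, he⟩ := exists_injective_nat G
  have hinv : ∀ {s}, s⁻¹ ∈ S ↔ s ∈ S := fun {s} => by rw [← Set.mem_inv, hS]
  refine ⟨{s | s ∈ S ∧ e s < e s⁻¹}, ?_, ?_⟩
  · ext s
    simp only [Set.mem_union, Set.mem_inv, Set.mem_ofPred_eq, inv_inv, hinv]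
    refine ⟨fun h => h.elim And.left And.left, fun hs => ?_⟩
    rcases lt_or_gt_of_ne (he.ne (h s hs)) with h1 | h1
    exacts [Or.inl ⟨hs, h1⟩, Or.inr ⟨hs, h1⟩]
  · rintro x ⟨_, h1⟩ ⟨_, h2⟩
    rw [inv_inv] at h2
    exact lt_asymm h1 h2

theorem apply_eq_prod_map_letter {α : Type*} [DecidableEq α] (φ : FreeGroup α →* G)
    (w : FreeGroup α) : φ w = (w.toWord.map (φ ∘ letter)).prod := by
  have key : ∀ L : List (α × Bool), φ (FreeGroup.mk L) = (L.map (φ ∘ letter)).prod := by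
    intro L
    induction L with
    | nil => simp [← FreeGroup.one_eq_mk]
    | cons a L ih =>
      rw [List.map_cons, List.prod_cons, ← ih, Function.comp_apply, ← map_mul, letter,
        FreeGroup.mul_mk, List.singleton_append]
  rw [← key, FreeGroup.mk_toWord]

theorem girth_le {S : Set G} {w : List G} (hw : IsReducedWord S w) (h1 : w ≠ [])
    (h2 : w.prod = 1) : girth S ≤ w.length :=
  iInf_le (fun w : {w : List G // IsReducedWord S w ∧ w ≠ [] ∧ w.prod = 1} =>
    (w.1.length : ℕ∞)) ⟨w, hw, h1, h2⟩

/-- Injectivity on letters ensures that a reduced free word stays reduced when read in the group. -/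
theorem girth_le_norm {α : Type*} [DecidableEq α] {φ : FreeGroup α →* G}
    (hφ : Function.Injective (φ ∘ letter)) {w : FreeGroup α} (hw : w ≠ 1) (h : φ w = 1) :
    girth (Set.range (φ ∘ letter)) ≤ w.norm := by
  have hl : (w.toWord.map (φ ∘ letter)).length = w.norm := List.length_map _
  rw [← hl]
  refine girth_le ⟨?_, ?_⟩ ?_ ?_
  · intro s hs
    obtain ⟨a, _, rfl⟩ := List.mem_map.1 hs
    exact ⟨a, rfl⟩
  · rw [List.isChain_map]
    refine (FreeGroup.isReduced_toWord (x := w)).imp fun a b hab h => ?_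
    rw [Function.comp_apply, Function.comp_apply, ← map_inv, letter_inv] at h
    have h' := hφ h
    subst h'
    simpa using hab rfl
  · simpa using hw
  · rw [← apply_eq_prod_map_letter, h]

/-- The word `t z t⁻¹ z` is trivial when `z` is central with `z ^ 2 = 1`. With the next lemma, large
girth excludes self-inverse elements of `S`. -/
theorem girth_le_four {S : Set G} (hS : S⁻¹ = S) (hcard : 3 ≤ S.ncard) {z : G} (hz : z ∈ S)
    (hz2 : z = z⁻¹) (hcomm : ∀ g : G, z * g = g * z) : girth S ≤ 4 := by
  by_cases hz1 : z = 1
  · subst hz1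
    refine (girth_le (w := [1]) ⟨by simpa using hz, by simp⟩ (by simp) (by simp)).trans ?_
    norm_num
  · obtain ⟨t, ht, htz⟩ : ∃ t ∈ S, t ∉ ({z} : Set G) := by
      by_contra! hcon
      have := Set.ncard_le_ncard (s := S) (t := {z}) hcon
      rw [Set.ncard_singleton] at this
      omega
    have ht' : t⁻¹ ∈ S := by rwa [← Set.mem_inv, hS]
    have htz' : t⁻¹ ≠ z := fun h => htz (by rw [Set.mem_singleton_iff, hz2, ← h, inv_inv])
    refine (girth_le (w := [t, z, t⁻¹, z]) ⟨by simp [ht, hz, ht'], ?_⟩ (by simp) ?_).trans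
      (by norm_num)
    · simp only [List.isChain_cons_cons, List.isChain_singleton, inv_inv, and_true]
      exact ⟨htz'.symm, by rwa [← hz2], fun h => htz h.symm⟩
    · simp only [List.prod_cons, List.prod_nil, mul_one]
      rw [hcomm, mul_assoc, mul_inv_cancel_left, mul_eq_one_iff_eq_inv, ← hz2]

theorem sl_two_mul_comm_of_eq_inv {k : Type*} [Field k] (h2 : (2 : k) ≠ 0) {s : SL(2, k)}
    (hs : s = s⁻¹) (g : SL(2, k)) : s * g = g * s := by
  obtain ⟨⟨e1, e2⟩, e3, e4⟩ := sl_two_inv_apply s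
  rw [← hs] at e1 e2 e3 e4
  have zero : ∀ {x : k}, x = -x → x = 0 := fun {x} h =>
    (mul_eq_zero.1 (show 2 * x = 0 by linear_combination h)).resolve_left h2
  refine sl_two_ext ?_ ?_ ?_ ?_ <;> simp only [sl_two_mul_apply, zero e2, zero e3, e1] <;> ring

end Letters

/-! ### Crude bounds for the order of `SL₂` -/

section Card

theorem card_le_card_sl_two {R : Type*} [CommRing R] [Finite R] :
    Nat.card R ≤ Nat.card SL(2, R) := by
  have : Finite SL(2, R) := Subtype.finite
  refine Nat.card_le_card_of_injective upperUnipotent fun a b h => ?_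
  rw [← (upperUnipotent_apply a).1.2, ← (upperUnipotent_apply b).1.2, h]

theorem card_sl_two_le {R : Type*} [CommRing R] [Finite R] :
    Nat.card SL(2, R) ≤ Nat.card R ^ 4 := by
  have : Nat.card R ^ 4 = Nat.card (Fin 2 → Fin 2 → R) := by
    rw [Nat.card_fun, Nat.card_fun, Nat.card_fin, ← pow_mul]
  rw [this]
  exact Nat.card_le_card_of_injective (fun g : SL(2, R) => g.1) Subtype.val_injective

end Card

/-! ### Escape for sets of large girth -/

section Girth

/-- Absorbing `120` into the base is possible since `n / M ≥ 1`; the resulting bound multiplies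
correctly over several factors. -/
theorem exists_metabelian_subgroup_rpow {k : Type*} [Field k] [Finite k] {p n : ℕ} (hp : p.Prime)
    (hk : Nat.card k = p ^ n) (h2 : (2 : k) ≠ 0) {M : ℝ} (hM0 : 0 < M) (hM : AdmissibleNat M n)
    {H : Subgroup SL(2, k)} (hH : H ≠ ⊤) :
    ∃ B : Subgroup SL(2, k), MetabelianLaw B ∧ B.relIndex H ≠ 0 ∧
      (B.relIndex H : ℝ) ≤ (120 * (p : ℝ) ^ 3) ^ (n / M : ℝ) := by
  obtain ⟨B, hB, hB0, hBcard⟩ := exists_metabelian_subgroup hp hk h2 hM0 hM hH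
  refine ⟨B, hB, hB0, hBcard.trans ?_⟩
  have hMn : M ≤ n := hM.le_of_dvd hM.1 dvd_rfl
  calc 120 * (p : ℝ) ^ (3 * n / M : ℝ)
      ≤ (120 : ℝ) ^ (n / M : ℝ) * (p : ℝ) ^ (3 * n / M : ℝ) := by
        gcongr
        exact Real.self_le_rpow_of_one_le (by norm_num) ((one_le_div hM0).2 hMn)
    _ = (120 * (p : ℝ) ^ 3) ^ (n / M : ℝ) := by
        rw [Real.mul_rpow (by norm_num) (by positivity), ← Real.rpow_natCast,
          ← Real.rpow_mul (by positivity), mul_div_assoc]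
        norm_num

theorem card_ge_two_of_ncard {G : Type*} [Group G] {X S : Set G} [Finite X] {k : ℕ}
    (hS : X ∪ X⁻¹ = S) (hk : 2 ≤ k) (hc : S.ncard = 2 * k) : 2 ≤ Nat.card X := by
  have h1 := Set.ncard_union_le X X⁻¹
  rw [hS, hc, Set.ncard_inv] at h1
  rw [Nat.card_coe_set_eq]
  omega

theorem escape_of_girth (p : ℕ) [Fact p.Prime] (hp : 3 ≤ p) (C₁ : ℝ) (hC₁ : 0 < C₁) (k : ℕ)
    (hk : 2 ≤ k) :
    ∃ C₂ C₃ γ : ℝ, 0 < C₂ ∧ 0 < C₃ ∧ 0 < γ ∧ ∃ n₀ : ℕ, ∀ n : ℕ, n₀ ≤ n →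
      AdmissibleNat C₂ n →
      ∀ S : Set SL(2, GaloisField p n), S⁻¹ = S → S.ncard = 2 * k →
        ENNReal.ofReal (C₁ * n) ≤ ((girth S : ℕ∞) : ℝ≥0∞) →
        ∀ H : Subgroup SL(2, GaloisField p n), H ≠ ⊤ →
          ∃ l : ℕ, (l : ℝ) ≤ C₃ * Real.log (Nat.card SL(2, GaloisField p n)) ∧
            mass (convPow (mu S) (2 * l)) (H : Set SL(2, GaloisField p n))
              ≤ (Nat.card SL(2, GaloisField p n) : ℝ) ^ (-γ) := by
  have hp0 : p.Prime := Fact.out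
  have hp1 : (3 : ℝ) ≤ p := by exact_mod_cast hp
  have hlogp : 0 < Real.log p := Real.log_pos (by linarith)
  have hA : 0 < 2 / C₁ := by positivity
  have hp3 : (1 : ℝ) ≤ (p : ℝ) ^ 3 := one_le_pow₀ (by linarith)
  obtain ⟨M, γ, hM1, hγ, hMγ⟩ := exists_escape_parameters (A := 2 / C₁)
    (b := 120 * (p : ℝ) ^ 3) (w := (p : ℝ) ^ 4) hA (by linarith)
    (one_lt_pow₀ (by linarith) (by norm_num))
  have hM0 : 0 < M := by linarith
  -- The bound on `n` guarantees `C₁ * n > 4`, so that `girth_le_four` applies.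
  refine ⟨M, 1 / (64 * (2 / C₁) * Real.log p), γ, hM0, by positivity, hγ, ⌊4 / C₁⌋₊ + 1,
    fun n hn hadm S hS hcard hgirth H hH => ?_⟩
  have hMn : M ≤ n := hadm.le_of_dvd hadm.1 dvd_rfl
  have hn4 : 4 < C₁ * n := by
    have h1 : 4 / C₁ < n := (Nat.lt_floor_add_one _).trans_le (by exact_mod_cast hn)
    rwa [div_lt_iff₀' hC₁] at h1
  have girth_gt : ∀ m : ℕ, (m : ℝ) < C₁ * n → ¬ girth S ≤ m := fun m hm hle => by
    have h1 : ((girth S : ℕ∞) : ℝ≥0∞) ≤ (m : ℝ≥0∞) := by exact_mod_cast hle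
    have h2 := hgirth.trans h1
    rw [ENNReal.ofReal_le_natCast] at h2
    linarith
  have hchar : (2 : GaloisField p n) ≠ 0 := by
    intro h
    have h' : ((2 : ℕ) : GaloisField p n) = 0 := by exact_mod_cast h
    rw [CharP.cast_eq_zero_iff (GaloisField p n) p] at h'
    have := Nat.le_of_dvd (by norm_num) h'
    omega
  have hn0 : n ≠ 0 := by have := hadm.1; omega
  have hfield : Nat.card (GaloisField p n) = p ^ n := GaloisField.card p n hn0
  have hfin : Finite (GaloisField p n) := Nat.finite_of_card_ne_zero (by
    rw [hfield]
    exact pow_ne_zero _ hp0.ne_zero)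
  have hfinG : Finite SL(2, GaloisField p n) := Subtype.finite
  obtain ⟨X, hXS, hX⟩ := exists_orientation hS fun s hs hs' =>
    girth_gt 4 (by exact_mod_cast hn4) (girth_le_four hS (by omega) hs hs'
      (sl_two_mul_comm_of_eq_inv hchar hs'))
  classical
  have := Fintype.ofFinite X
  have hX2 : 2 ≤ Fintype.card X := by
    rw [← Nat.card_eq_fintype_card]
    exact card_ge_two_of_ncard hXS hk hcard
  obtain ⟨B, hB, hB0, hBcard⟩ := exists_metabelian_subgroup_rpow hp0 hfield hchar hM0 hadm hH
  let φ := FreeGroup.lift ((↑) : X → SL(2, GaloisField p n))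
  have hφ : Function.Injective (φ ∘ letter) := lift_letter_injective hX
  have hrange : Set.range (φ ∘ letter) = S := (range_lift_letter X).trans hXS
  -- With this length `64 * l ≤ C₁ * n / 2`, strictly below the girth.
  obtain ⟨l, hl⟩ : ∃ l, l = ⌊(n : ℝ) / (64 * (2 / C₁))⌋₊ := ⟨_, rfl⟩
  have hln : (l : ℝ) ≤ n / (64 * (2 / C₁)) := hl ▸ Nat.floor_le (by positivity)
  have hBle : (B.comap φ).relIndex (H.comap φ) ≤ B.relIndex H := by
    rw [Subgroup.relIndex_comap]
    exact Subgroup.relIndex_le_of_le_right (Subgroup.map_comap_le _ _) hB0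
  have hmass := mass_convPow_le_of_law hX2 φ hφ H (Subgroup.relIndex_comap_ne_zero φ hB0) l
    (fun a ha b hb c hc d hd hnorm => by
      by_contra hne
      have h1 := girth_le_norm hφ hne (by
        simp only [map_commutatorElement]
        exact hB _ ha _ hb _ hc _ hd)
      rw [hrange] at h1
      refine girth_gt (64 * l) ?_ (h1.trans (by exact_mod_cast hnorm))
      push_cast
      have h2 : 64 * ((n : ℝ) / (64 * (2 / C₁))) = C₁ * n / 2 := by field_simp
      linarith)
  rw [hrange] at hmass
  have hcard1 : p ^ n ≤ Nat.card SL(2, GaloisField p n) := hfield ▸ card_le_card_sl_two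
  have hcard2 : Nat.card SL(2, GaloisField p n) ≤ (p ^ n) ^ 4 := hfield ▸ card_sl_two_le
  refine ⟨l, ?_, hmass.trans ((hMγ n hMn _ ?_ l hl).trans ?_)⟩
  · have h1 : n * Real.log p ≤ Real.log (Nat.card SL(2, GaloisField p n)) := by
      rw [← Real.log_pow]
      exact Real.log_le_log (by positivity) (by exact_mod_cast hcard1)
    calc (l : ℝ) ≤ n / (64 * (2 / C₁)) := hln
      _ = 1 / (64 * (2 / C₁) * Real.log p) * (n * Real.log p) := by field_simp
      _ ≤ _ := mul_le_mul_of_nonneg_left h1 (by positivity)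
  · exact hBcard.trans' (by exact_mod_cast hBle)
  · refine Real.rpow_le_rpow_of_nonpos (by exact_mod_cast Nat.card_pos) ?_ (by linarith)
    rw [Real.rpow_natCast, ← pow_mul, mul_comm, pow_mul]
    exact_mod_cast hcard2

end Girth

/-! ### Degrees of the entries of a word -/

section Degree

theorem natDegree_list_prod_le {F : Type*} [Field F] {D : ℕ} (L : List SL(2, F[X]))
    (h : ∀ g ∈ L, ∀ i j : Fin 2, (g i j).natDegree ≤ D) (i j : Fin 2) :
    (L.prod i j).natDegree ≤ D * L.length := by
  induction L generalizing i j with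
  | nil => fin_cases i <;> fin_cases j <;> simp
  | cons g L ih =>
    have hg := h g List.mem_cons_self
    have ih' := ih fun g hg => h g (List.mem_cons_of_mem _ hg)
    rw [List.prod_cons, sl_two_mul_apply, List.length_cons, Nat.mul_succ, add_comm (D * _)]
    exact natDegree_add_le_of_degree_le (natDegree_mul_le_of_le (hg i 0) (ih' 0 j))
      (natDegree_mul_le_of_le (hg i 1) (ih' 1 j))

theorem natDegree_apply_le {F X : Type*} [Field F] [DecidableEq X] {D : ℕ}
    (φ : FreeGroup X →* SL(2, F[X]))
    (h : ∀ g ∈ Set.range (φ ∘ letter), ∀ i j : Fin 2, (g i j).natDegree ≤ D) (w : FreeGroup X)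
    (i j : Fin 2) : (φ w i j).natDegree ≤ D * w.norm := by
  have h1 := natDegree_list_prod_le (w.toWord.map (φ ∘ letter)) (fun g hg => by
    obtain ⟨a, _, rfl⟩ := List.mem_map.1 hg
    exact h _ ⟨a, rfl⟩) i j
  rwa [← apply_eq_prod_map_letter, List.length_map] at h1

end Degree

/-! ### Letters and rank of a free basis -/

section FreeBasis

theorem letter_injective {X : Type*} : Function.Injective (letter : X × Bool → FreeGroup X) := by
  classical
  intro a b h
  have h1 := congrArg FreeGroup.toWord h
  simpa [letter, FreeGroup.toWord_mk] using h1

theorem two_le_card_of_mul_ne {G : Type*} [Group G] {X : Set G} [Fintype X]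
    (h : ∃ a ∈ Subgroup.closure X, ∃ b ∈ Subgroup.closure X, a * b ≠ b * a) :
    2 ≤ Fintype.card X := by
  by_contra! hlt
  have hs := Fintype.card_le_one_iff_subsingleton.1 (Nat.lt_succ_iff.1 hlt)
  have hcomm := Subgroup.isMulCommutative_closure (k := X) fun x hx y hy => by
    rw [show x = y from Subtype.ext_iff.1 (hs.elim ⟨x, hx⟩ ⟨y, hy⟩)]
  obtain ⟨a, ha, b, hb, hab⟩ := h
  exact hab (Subtype.ext_iff.1 (hcomm.is_comm.comm (⟨a, ha⟩ : Subgroup.closure X) ⟨b, hb⟩))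

end FreeBasis

/-! ### Subgroups of a group embedded in a product -/

section Product

variable {G ι : Type*} [Group G] {K : ι → Type*} [∀ i, Group (K i)] (R : ∀ i, G →* K i)

/-- By independence, any `g` agrees on the coordinates in `s` with some element of `H`. So each
coset of `H` meets the subgroup trivial on `s`, which embeds in the product of the other
coordinates. -/
theorem index_le_prod_card [Fintype ι] [DecidableEq ι] [∀ i, Finite (K i)]
    (hinj : ∀ g, (∀ i, R i g = 1) → g = 1) (hperf : ∀ i, commutator (K i) = ⊤) (H : Subgroup G)
    (s : Finset ι) (hs : ∀ i ∈ s, H.map (R i) = ⊤)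
    (hpair : ∀ i ∈ s, ∀ j ∈ s, i ≠ j →
      ((R j).comp H.subtype).ker.map ((R i).comp H.subtype) = ⊤) :
    H.index ≤ ∏ i ∈ sᶜ, Nat.card (K i) := by
  let N : Subgroup G := ⨅ i ∈ s, (R i).ker
  have hN : ∀ {g}, g ∈ N ↔ ∀ i ∈ s, R i g = 1 := by simp [N, Subgroup.mem_iInf]
  have hemb : Function.Injective fun (g : N) (i : {i // i ∈ sᶜ}) => R i (g : G) := by
    intro g h hgh
    have h1 : (g : G) * (h : G)⁻¹ = 1 := hinj _ fun i => by
      by_cases hi : i ∈ s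
      · rw [map_mul, map_inv, hN.1 g.2 i hi, hN.1 h.2 i hi, inv_one, mul_one]
      · rw [map_mul, map_inv, mul_inv_eq_one]
        exact congrFun hgh ⟨i, Finset.mem_compl.2 hi⟩
    exact Subtype.ext (mul_inv_eq_one.1 h1)
  have hNfin : Finite N := Finite.of_injective _ hemb
  have h1 : Nat.card N ≤ ∏ i ∈ sᶜ, Nat.card (K i) := by
    rw [← Finset.prod_coe_sort, ← Nat.card_pi]
    exact Nat.card_le_card_of_injective _ hemb
  refine le_trans ?_ h1
  refine Nat.card_le_card_of_surjective (fun g : N => ((g : G) : G ⧸ H)) fun x => ?_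
  obtain ⟨g, rfl⟩ := QuotientGroup.mk_surjective x
  obtain ⟨h, hh⟩ := exists_joint_preimage (fun i => (R i).comp H.subtype) hperf s
    (fun i hi => by
      rw [← MonoidHom.range_eq_top, MonoidHom.range_comp, Subgroup.range_subtype, hs i hi])
    hpair fun i => R i g
  refine ⟨⟨g * (h : G)⁻¹, hN.2 fun i hi => ?_⟩, QuotientGroup.eq.2 ?_⟩
  · rw [map_mul, map_inv, mul_inv_eq_one]
    exact (hh i hi).symm
  · simp

/-- Relative indices of intersections are submultiplicative, so the conditions in the separate
coordinates can be imposed simultaneously. -/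
theorem exists_iInf_comap {Γ : Type*} [Group Γ] (ψ : Γ →* G) (H : Subgroup G) (s : Finset ι)
    (B : ∀ i, Subgroup (K i)) (hB : ∀ i ∈ s, (B i).relIndex (H.map (R i)) ≠ 0) :
    ∃ C : Subgroup Γ, (∀ w, w ∈ C ↔ ∀ i ∈ s, R i (ψ w) ∈ B i) ∧ C.relIndex (H.comap ψ) ≠ 0 ∧
      C.relIndex (H.comap ψ) ≤ ∏ i ∈ s, (B i).relIndex (H.map (R i)) := by
  have hmap : ∀ i, (H.comap ψ).map ((R i).comp ψ) ≤ H.map (R i) := fun i => by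
    rw [← Subgroup.map_map]
    exact Subgroup.map_mono (Subgroup.map_comap_le _ _)
  refine ⟨⨅ i : s, (B i).comap ((R i).comp ψ), fun w => by simp [Subgroup.mem_iInf], ?_, ?_⟩
  · refine Subgroup.relIndex_iInf_ne_zero fun i => ?_
    rw [Subgroup.relIndex_comap]
    exact fun h => hB i i.2 (Subgroup.relIndex_eq_zero_of_le_right (hmap i) h)
  · refine (Subgroup.relIndex_iInf_le _).trans ?_
    rw [← Finset.prod_coe_sort s]
    refine Finset.prod_le_prod' fun i _ => ?_
    rw [Subgroup.relIndex_comap]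
    exact Subgroup.relIndex_le_of_le_right (hmap i) (hB i i.2)

end Product

/-! ### Reduction modulo the irreducible factors of a square-free polynomial -/

section Factors

open UniqueFactorizationMonoid

variable {F : Type*} [Field F]

theorem prod_dvd_of_normalizedFactors [DecidableEq F] {ι : Type*} {f z : F[X]} {q : ι → F[X]}
    (hinj : Function.Injective q) (hq : ∀ i, q i ∈ normalizedFactors f) (s : Finset ι)
    (h : ∀ i ∈ s, q i ∣ z) : ∏ i ∈ s, q i ∣ z := by
  refine Finset.prod_dvd_of_coprime (fun i _ j _ hij => ?_) h
  rw [Function.onFun, (irreducible_of_normalized_factor _ (hq i)).coprime_iff_not_dvd]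
  intro hdvd
  have := (irreducible_of_normalized_factor _ (hq i)).associated_of_dvd
    (irreducible_of_normalized_factor _ (hq j)) hdvd
  exact hij (hinj (this.eq_of_normalized (normalize_normalized_factor _ (hq i))
    (normalize_normalized_factor _ (hq j))))

theorem dvd_of_forall_normalizedFactors [DecidableEq F] {f z : F[X]} (hf : Squarefree f)
    (h : ∀ q ∈ normalizedFactors f, q ∣ z) : f ∣ z := by
  have hf0 := hf.ne_zero
  have hnodup := (squarefree_iff_nodup_normalizedFactors hf0).1 hf
  have h1 : ∏ q ∈ (normalizedFactors f).toFinset, q = (normalizedFactors f).prod := by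
    rw [Finset.prod, Multiset.toFinset_val, hnodup.dedup, Multiset.map_id']
  refine (prod_normalizedFactors hf0).symm.dvd.trans ?_
  rw [← h1, ← Finset.prod_coe_sort]
  exact prod_dvd_of_normalizedFactors Subtype.val_injective
    (fun q => Multiset.mem_toFinset.1 q.2) _ fun q _ => h q (Multiset.mem_toFinset.1 q.2)

/-- Reduction `SL₂(F[t]/(f)) → SL₂(F[t]/(q))` for a divisor `q` of `f`. -/
noncomputable def reduction {f q : F[X]} (h : q ∣ f) : SL2Quot f →* SL(2, AdjoinRoot q) :=
  Matrix.SpecialLinearGroup.map (Ideal.Quotient.lift (Ideal.span {f}) (AdjoinRoot.mk q)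
    fun _ hz => AdjoinRoot.mk_eq_zero.2 (h.trans (Ideal.mem_span_singleton.1 hz)))

theorem reduction_congruenceMap_apply {f q : F[X]} (h : q ∣ f) (g : SL(2, F[X])) (i j : Fin 2) :
    reduction h (congruenceMap f g) i j = AdjoinRoot.mk q (g i j) := by
  simp [reduction, congruenceMap, Matrix.SpecialLinearGroup.map_apply_coe]

theorem reduction_congruenceMap_eq_one {f q : F[X]} (h : q ∣ f) {g : SL(2, F[X])}
    (hg : reduction h (congruenceMap f g) = 1) (i j : Fin 2) :
    q ∣ g i j - (1 : SL(2, F[X])) i j := by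
  rw [← AdjoinRoot.mk_eq_zero, map_sub, ← reduction_congruenceMap_apply h,
    ← reduction_congruenceMap_apply h, hg, map_one, map_one, sub_self]

theorem eq_one_of_forall_reduction_eq_one [DecidableEq F] {f : F[X]} (hf : Squarefree f)
    {g : SL2Quot f}
    (hg : ∀ q (hq : q ∈ normalizedFactors f), reduction (dvd_of_mem_normalizedFactors hq) g = 1) :
    g = 1 := by
  have key : ∀ i j, g i j = (1 : SL2Quot f) i j := fun i j => by
    obtain ⟨y, hy⟩ := Ideal.Quotient.mk_surjective (g i j - (1 : SL2Quot f) i j)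
    rw [← sub_eq_zero, ← hy, Ideal.Quotient.eq_zero_iff_mem, Ideal.mem_span_singleton]
    refine dvd_of_forall_normalizedFactors hf fun q hq => ?_
    have hqf := dvd_of_mem_normalizedFactors hq
    have h1 : ∀ x : SL2Quot f, reduction hqf x i j = Ideal.Quotient.lift (Ideal.span {f})
        (AdjoinRoot.mk q) (fun _ hz => AdjoinRoot.mk_eq_zero.2
          (hqf.trans (Ideal.mem_span_singleton.1 hz))) (x i j) := fun x => by
      simp [reduction, Matrix.SpecialLinearGroup.map_apply_coe]
    rw [← AdjoinRoot.mk_eq_zero, ← Ideal.Quotient.lift_mk (Ideal.span {f}) (AdjoinRoot.mk q)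
      (fun _ hz => AdjoinRoot.mk_eq_zero.2 (hqf.trans (Ideal.mem_span_singleton.1 hz))), hy,
      map_sub, ← h1, ← h1, hg q hq, map_one, sub_self]
  exact sl_two_ext (key 0 0) (key 0 1) (key 1 0) (key 1 1)

theorem card_quotient_span {p : ℕ} [Fact p.Prime] {f : (ZMod p)[X]} (hf : f ≠ 0) :
    Nat.card ((ZMod p)[X] ⧸ Ideal.span {f}) = p ^ f.natDegree := by
  have : Module.Finite (ZMod p) ((ZMod p)[X] ⧸ Ideal.span {f}) :=
    (AdjoinRoot.powerBasis hf).finite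
  rw [Module.natCard_eq_pow_finrank (K := ZMod p), finrank_quotient_span_eq_natDegree,
    Nat.card_zmod]

end Factors

/-! ### Escape modulo square-free polynomials -/

section Congruence

open UniqueFactorizationMonoid

open scoped commutatorElement

/-- Here `g` is the product of the irreducible factors at which `H` does not project onto `SL₂`. Its
degree governs both the index of `H` and that of `C`, the subgroup on which the metabelian law holds
modulo every bad factor, hence modulo `g`. -/
theorem exists_prod_irreducible_divisors {p : ℕ} [Fact p.Prime] (hp : 3 ≤ p) {M : ℝ} (hM0 : 0 < M)
    {f : (ZMod p)[X]} (hf : Squarefree f) (hadm : AdmissiblePoly M f)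
    (hdist : DistinctFactorDegrees f) {H : Subgroup (SL2Quot f)} (hH : H ≠ ⊤) {Γ : Type*} [Group Γ]
    (ψ : Γ →* SL(2, (ZMod p)[X])) :
    ∃ g : (ZMod p)[X], g ∣ f ∧ M ≤ g.natDegree ∧ 0 < g.natDegree ∧
      H.index ≤ (p ^ g.natDegree) ^ 4 ∧
      ∃ C : Subgroup Γ, C.relIndex ((H.comap (congruenceMap f)).comap ψ) ≠ 0 ∧
        (C.relIndex ((H.comap (congruenceMap f)).comap ψ) : ℝ) ≤
          (120 * (p : ℝ) ^ 3) ^ (g.natDegree / M : ℝ) ∧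
        ∀ a ∈ C, ∀ b ∈ C, ∀ c ∈ C, ∀ d ∈ C, ∀ i j,
          g ∣ ψ ⁅⁅a, b⁆, ⁅c, d⁆⁆ i j - (1 : SL(2, (ZMod p)[X])) i j := by
  classical
  have hp0 : p.Prime := Fact.out
  let ι := {q // q ∈ (normalizedFactors f).toFinset}
  have hmem : ∀ q : ι, q.1 ∈ normalizedFactors f := fun q => Multiset.mem_toFinset.1 q.2
  have hirr : ∀ q : ι, Irreducible q.1 := fun q => irreducible_of_normalized_factor _ (hmem q)
  have hdvd : ∀ q : ι, q.1 ∣ f := fun q => dvd_of_mem_normalizedFactors (hmem q)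
  have hadm' : ∀ q : ι, AdmissibleNat M q.1.natDegree := fun q => hadm _ (hirr q) (hdvd q)
  have hfact : ∀ q : ι, Fact (Irreducible q.1) := fun q => ⟨hirr q⟩
  have hcard : ∀ q : ι, Nat.card (AdjoinRoot q.1) = p ^ q.1.natDegree := fun q =>
    card_quotient_span (hirr q).ne_zero
  have hfin : ∀ q : ι, Finite (AdjoinRoot q.1) := fun q => Nat.finite_of_card_ne_zero (by
    rw [hcard]
    exact pow_ne_zero _ hp0.ne_zero)
  have hfinG : ∀ q : ι, Finite SL(2, AdjoinRoot q.1) := fun q => Subtype.finite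
  let R : ∀ q : ι, SL2Quot f →* SL(2, AdjoinRoot q.1) := fun q => reduction (hdvd q)
  have hRinj : ∀ g, (∀ q, R q g = 1) → g = 1 := fun g hg =>
    eq_one_of_forall_reduction_eq_one hf fun q hq => hg ⟨q, Multiset.mem_toFinset.2 hq⟩
  have hfinQ : Finite (SL2Quot f) := by
    refine Finite.of_injective (fun (g : SL2Quot f) q => R q g) fun g h hgh => ?_
    refine mul_inv_eq_one.1 (hRinj _ fun q => ?_)
    rw [map_mul, map_inv, mul_inv_eq_one]
    exact congrFun hgh q
  have hdeg : ∀ q : ι, 2 ≤ q.1.natDegree := fun q => (hadm' q).1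
  have hcard4 : ∀ q : ι, 4 ≤ Nat.card (AdjoinRoot q.1) := fun q => by
    rw [hcard]
    calc 4 ≤ 3 ^ 2 := by norm_num
      _ ≤ p ^ 2 := Nat.pow_le_pow_left hp 2
      _ ≤ p ^ q.1.natDegree := Nat.pow_le_pow_right hp0.pos (hdeg q)
  have htwo : ∀ q : ι, (2 : AdjoinRoot q.1) ≠ 0 := fun q h => by
    have h1 : AdjoinRoot.of q.1 2 = 0 := by rw [map_ofNat, h]
    have h2 := (map_eq_zero_iff _ (AdjoinRoot.of q.1).injective).1 h1
    have h' : ((2 : ℕ) : ZMod p) = 0 := by exact_mod_cast h2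
    rw [CharP.cast_eq_zero_iff (ZMod p) p] at h'
    have := Nat.le_of_dvd (by norm_num) h'
    omega
  let s : Finset ι := Finset.univ.filter fun q => H.map (R q) = ⊤
  have hs : ∀ q, q ∈ s ↔ H.map (R q) = ⊤ := fun q => by simp [s]
  -- Distinct degrees enter here: they make the surjective projections of `H` pairwise independent.
  have hindex := index_le_prod_card R hRinj (fun q => commutator_sl_two_eq_top (hcard4 q)) H s
    (fun q hq => (hs q).1 hq) fun q hq r hr hqr => by
      have surj : ∀ t : ι, t ∈ s → Function.Surjective ((R t).comp H.subtype) := fun t ht => by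
        rw [← MonoidHom.range_eq_top, MonoidHom.range_comp, Subgroup.range_subtype, (hs t).1 ht]
      refine map_ker_eq_top hp0 hp (hdeg q) (hdeg r) (hcard q) (hcard r) (fun h => hqr ?_) _ _
        (surj q hq) (surj r hr)
      exact Subtype.ext ((hdist _ _ (hirr q) (hirr r) (hdvd q) (hdvd r) h).eq_of_normalized
        (normalize_normalized_factor _ (hmem q)) (normalize_normalized_factor _ (hmem r)))
  have hB : ∀ q : ι, ∃ B : Subgroup SL(2, AdjoinRoot q.1), q ∈ sᶜ → MetabelianLaw B ∧
      B.relIndex (H.map (R q)) ≠ 0 ∧ (B.relIndex (H.map (R q)) : ℝ) ≤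
        (120 * (p : ℝ) ^ 3) ^ (q.1.natDegree / M : ℝ) := fun q => by
    by_cases hq : q ∈ s
    · exact ⟨⊤, fun h => absurd hq (Finset.mem_compl.1 h)⟩
    · obtain ⟨B, hB⟩ := exists_metabelian_subgroup_rpow hp0 (hcard q) (htwo q) hM0 (hadm' q)
        (fun h => hq ((hs q).2 h))
      exact ⟨B, fun _ => hB⟩
  choose B hB using hB
  obtain ⟨C, hC, hC0, hCle⟩ := exists_iInf_comap R ((congruenceMap f).comp ψ) H sᶜ B
    fun q hq => (hB q hq).2.1
  have hdegsum : (∏ q ∈ sᶜ, q.1).natDegree = ∑ q ∈ sᶜ, q.1.natDegree :=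
    natDegree_prod _ _ fun q _ => (hirr q).ne_zero
  -- If every projection were onto, the index bound would be an empty product and `H` would be
  -- everything.
  have hne : sᶜ.Nonempty := by
    by_contra hempty
    rw [Finset.not_nonempty_iff_eq_empty] at hempty
    rw [hempty, Finset.prod_empty] at hindex
    have h0 : H.index ≠ 0 := Subgroup.index_ne_zero_of_finite
    exact hH (Subgroup.index_eq_one.1 (by omega))
  obtain ⟨q₀, hq₀⟩ := hne
  have hle : q₀.1.natDegree ≤ (∏ q ∈ sᶜ, q.1).natDegree := by
    rw [hdegsum]
    exact Finset.single_le_sum (f := fun q : ι => q.1.natDegree) (fun _ _ => Nat.zero_le _) hq₀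
  refine ⟨∏ q ∈ sᶜ, q.1, prod_dvd_of_normalizedFactors Subtype.val_injective hmem _
    fun q _ => hdvd q, ?_, ?_, ?_, C, hC0, ?_, ?_⟩
  · exact ((hadm' q₀).le_of_dvd (hdeg q₀) dvd_rfl).trans (by exact_mod_cast hle)
  · have := hdeg q₀
    omega
  · refine hindex.trans ?_
    rw [hdegsum, ← Finset.prod_pow_eq_pow_sum, ← Finset.prod_pow]
    exact Finset.prod_le_prod' fun q _ => hcard q ▸ card_sl_two_le
  · calc (C.relIndex ((H.comap (congruenceMap f)).comap ψ) : ℝ)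
        ≤ ∏ q ∈ sᶜ, ((B q).relIndex (H.map (R q)) : ℝ) := by exact_mod_cast hCle
      _ ≤ ∏ q ∈ sᶜ, (120 * (p : ℝ) ^ 3) ^ (q.1.natDegree / M : ℝ) :=
        Finset.prod_le_prod (fun _ _ => Nat.cast_nonneg _) fun q hq => (hB q hq).2.2
      _ = _ := by
        have : (0 : ℝ) < p := by exact_mod_cast hp0.pos
        rw [← Real.rpow_sum_of_pos (by positivity), ← Finset.sum_div, hdegsum, Nat.cast_sum]
  · intro a ha b hb c hc d hd i j
    refine prod_dvd_of_normalizedFactors Subtype.val_injective hmem _ fun q hq => ?_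
    refine reduction_congruenceMap_eq_one (hdvd q) ?_ i j
    simp only [map_commutatorElement]
    exact (hB q hq).1 _ ((hC a).1 ha q hq) _ ((hC b).1 hb q hq) _ ((hC c).1 hc q hq) _
      ((hC d).1 hd q hq)

theorem escape_mod_squarefree (p : ℕ) [Fact p.Prime] (hp : 3 ≤ p) (D : ℕ) :
    ∃ C M γ : ℝ, 0 < C ∧ 0 < M ∧ 0 < γ ∧
      ∀ T : Set SL(2, (ZMod p)[X]), IsSymmetricFreeBasis T →
        (∀ g ∈ T, ∀ i j : Fin 2, (g i j).natDegree ≤ D) →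
        ∀ f : (ZMod p)[X], Squarefree f → AdmissiblePoly M f → DistinctFactorDegrees f →
          ∀ H : Subgroup (SL2Quot f), H ≠ ⊤ →
            ∃ l : ℕ, (l : ℝ) ≤ C * Real.log (Nat.card (SL2Quot f)) ∧
              mass (convPow (mu T) (2 * l)) (congruenceMap f ⁻¹' (H : Set (SL2Quot f)))
                ≤ (H.index : ℝ) ^ (-γ) := by
  have hp0 : p.Prime := Fact.out
  have hp1 : (3 : ℝ) ≤ p := by exact_mod_cast hp
  have hlogp : 0 < Real.log p := Real.log_pos (by linarith)
  have hA : (0 : ℝ) < D + 1 := by positivity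
  have hp3 : (1 : ℝ) ≤ (p : ℝ) ^ 3 := one_le_pow₀ (by linarith)
  -- The shift in `D + 1` keeps `A` positive when `D = 0` and gives a strict degree inequality
  -- below. The base `p ^ 4` matches the bound on the index of `H`.
  obtain ⟨M, γ, hM1, hγ, hMγ⟩ := exists_escape_parameters (A := D + 1)
    (b := 120 * (p : ℝ) ^ 3) (w := (p : ℝ) ^ 4) hA (by linarith)
    (one_lt_pow₀ (by linarith) (by norm_num))
  have hM0 : 0 < M := by linarith
  refine ⟨1 / (64 * (D + 1) * Real.log p), M, γ, by positivity, hM0, hγ,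
    fun T hT hTD f hf hadm hdist H hH => ?_⟩
  obtain ⟨X, hXfin, rfl, hXinj, hXcomm⟩ := hT
  classical
  have := hXfin.fintype
  let φ := FreeGroup.lift ((↑) : X → SL(2, (ZMod p)[X]))
  have hφ : Function.Injective (φ ∘ letter) := hXinj.comp letter_injective
  rw [← range_lift_letter] at hTD ⊢
  obtain ⟨g, hgf, hMg, hg0, hindex, C, hC0, hCle, hClaw⟩ :=
    exists_prod_irreducible_divisors hp hM0 hf hadm hdist hH φ
  obtain ⟨l, hl⟩ : ∃ l, l = ⌊(g.natDegree : ℝ) / (64 * (D + 1))⌋₊ := ⟨_, rfl⟩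
  have hln : (l : ℝ) ≤ g.natDegree / (64 * (D + 1)) := hl ▸ Nat.floor_le (by positivity)
  have hlD : 64 * l * D < g.natDegree := by
    rw [le_div_iff₀ (by positivity)] at hln
    have h1 : l * (64 * (D + 1)) ≤ g.natDegree := by exact_mod_cast hln
    rcases Nat.eq_zero_or_pos l with rfl | hl0
    · simpa using hg0
    · nlinarith
  -- The entries of a double commutator minus the identity are divisible by `g` and of smaller
  -- degree, so they vanish; freeness of the basis then makes the word trivial.
  have hmass := mass_convPow_le_of_law (two_le_card_of_mul_ne hXcomm) φ hφ
    (H.comap (congruenceMap f)) hC0 l (fun a ha b hb c hc d hd hnorm => by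
      refine hXinj ?_
      rw [map_one]
      have key : ∀ i j, φ ⁅⁅a, b⁆, ⁅c, d⁆⁆ i j = (1 : SL(2, (ZMod p)[X])) i j := fun i j => by
        refine sub_eq_zero.1 (eq_zero_of_dvd_of_natDegree_lt (hClaw a ha b hb c hc d hd i j) ?_)
        refine lt_of_le_of_lt ((natDegree_sub_le _ _).trans (max_le ?_ ?_)) hlD
        · refine (natDegree_apply_le φ hTD _ i j).trans ?_
          rw [mul_comm]
          exact Nat.mul_le_mul_right _ hnorm
        · fin_cases i <;> fin_cases j <;> simp
      exact sl_two_ext (key 0 0) (key 0 1) (key 1 0) (key 1 1))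
  have hcard : p ^ g.natDegree ≤ Nat.card (SL2Quot f) := by
    have hR := card_quotient_span hf.ne_zero
    have : Finite ((ZMod p)[X] ⧸ Ideal.span {f}) := Nat.finite_of_card_ne_zero (by
      rw [hR]
      exact pow_ne_zero _ hp0.ne_zero)
    refine le_trans ?_ card_le_card_sl_two
    rw [hR]
    exact Nat.pow_le_pow_right hp0.pos (natDegree_le_of_dvd hgf hf.ne_zero)
  have hfinG : Finite (SL2Quot f) := Nat.finite_of_card_ne_zero
    ((pow_pos hp0.pos _).trans_le hcard).ne'
  refine ⟨l, ?_, hmass.trans ((hMγ g.natDegree hMg _ hCle l hl).trans ?_)⟩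
  · have h1 : g.natDegree * Real.log p ≤ Real.log (Nat.card (SL2Quot f)) := by
      rw [← Real.log_pow]
      exact Real.log_le_log (by positivity) (by exact_mod_cast hcard)
    calc (l : ℝ) ≤ g.natDegree / (64 * (D + 1)) := hln
      _ = 1 / (64 * (D + 1) * Real.log p) * (g.natDegree * Real.log p) := by field_simp
      _ ≤ _ := mul_le_mul_of_nonneg_left h1 (by positivity)
  · have h0 : 0 < H.index := Nat.pos_of_ne_zero Subgroup.index_ne_zero_of_finite
    refine Real.rpow_le_rpow_of_nonpos (by exact_mod_cast h0) ?_ (by linarith)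
    rw [Real.rpow_natCast, ← pow_mul, mul_comm, pow_mul]
    exact_mod_cast hindex

end Congruence

end SL2Walk

theorem proposition2p1 (p : ℕ) [Fact p.Prime] (hp : 3 ≤ p) :
    -- escape from proper subgroups modulo square-free polynomials
    (∀ D m : ℕ, ∃ C M γ : ℝ, 0 < C ∧ 0 < M ∧ 0 < γ ∧
      ∀ T : Set SL(2, (ZMod p)[X]),
        SL2Walk.IsSymmetricFreeBasis T → T.ncard = m →
        (∀ g ∈ T, ∀ i j : Fin 2, (g i j).natDegree ≤ D) →
        ∀ f : (ZMod p)[X], Squarefree f → SL2Walk.AdmissiblePoly M f →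
          SL2Walk.DistinctFactorDegrees f →
          ∀ H : Subgroup (SL2Walk.SL2Quot f), H ≠ ⊤ →
            ∃ l : ℕ, (l : ℝ) ≤ C * Real.log (Nat.card (SL2Walk.SL2Quot f)) ∧
              SL2Walk.mass (SL2Walk.convPow (SL2Walk.mu T) (2 * l))
                  (SL2Walk.congruenceMap f ⁻¹' (H : Set (SL2Walk.SL2Quot f)))
                ≤ (H.index : ℝ) ^ (-γ)) ∧
    -- escape from proper subgroups of `SL₂(pⁿ)` for sets of large girth
    (∀ C₁ : ℝ, 0 < C₁ → ∀ k : ℕ, 2 ≤ k →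
      ∃ C₂ C₃ γ : ℝ, 0 < C₂ ∧ 0 < C₃ ∧ 0 < γ ∧ ∃ n₀ : ℕ, ∀ n : ℕ, n₀ ≤ n →
        SL2Walk.AdmissibleNat C₂ n →
        ∀ S : Set SL(2, GaloisField p n), S⁻¹ = S → S.ncard = 2 * k →
          ENNReal.ofReal (C₁ * n) ≤ ((SL2Walk.girth S : ℕ∞) : ℝ≥0∞) →
          ∀ H : Subgroup SL(2, GaloisField p n), H ≠ ⊤ →
            ∃ l : ℕ, (l : ℝ) ≤ C₃ * Real.log (Nat.card SL(2, GaloisField p n)) ∧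
              SL2Walk.mass (SL2Walk.convPow (SL2Walk.mu S) (2 * l))
                  (H : Set SL(2, GaloisField p n))
                ≤ (Nat.card SL(2, GaloisField p n) : ℝ) ^ (-γ)) := by
  refine ⟨fun D m => ?_, SL2Walk.escape_of_girth p hp⟩
  obtain ⟨C, M, γ, hC, hM, hγ, h⟩ := SL2Walk.escape_mod_squarefree p hp D
  exact ⟨C, M, γ, hC, hM, hγ, fun T hT _ => h T hT⟩
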